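/- **Setting.** Let $U\subset\mathbb R^2$ be a bounded open set containing the origin, let $r\ge 1$ be an integer, and let $\chi^r$ be the space of all $C^r$ vector fields $U\to\mathbb R^2$ with the $C^r$-topology (uniform convergence on compact subsets of $U$ of all derivatives of order $\le r$). Let $\Omega=\chi^r\times\chi^r$ with the product topology. An element $Z=(X,Y)\in\Omega$ is regarded as the piecewise smooth (Filippov) vector field equal to $X$ where $y>0$ and to $Y$ where $y<0$; the switching manifold is $\Sigma=\{(x,y)\in U: y=0\}$, and trajectories are understood in the sense of Filippov. Write $X=(X^1,X^2)$, $Y=(Y^1,Y^2)$, and for $h(x,y)=y$ put $Xh=X\cdot\nabla h=X^2$ and $X(Xh)=X\cdot\nabla (Xh)$, similarly for $Y$. A point $p\in\Sigma$ is a *visible fold* of $X$ if $Xh(p)=0$ and $X(Xh)(p)>0$, a *visible fold* of $Y$ if $Yh(p)=0$ and $Y(Yh)(p)<0$, and a *visible two-fold* of $Z$ if it is both. A point is *regular* for $Z$ if it is not a zero of the field (or, on $\Sigma$, of one of the two fields) defining $Z$ there, not a point of $\Sigma$ with $Xh\cdot Yh=0$, and not a zero of the sliding field $(Yh\,X-Xh\,Y)/(Yh-Xh)$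 in the part of $\Sigma$ where $Xh\cdot Yh<0$. A *simple two-fold cycle* of $Z$ is the image $\Gamma$ of a trajectory $\gamma:[0,T]\to U$ of $Z$, $T>0$, such that $\gamma(0)=\gamma(T)=(p,0)$ is a visible two-fold and $\gamma(t)$ is regular for $0<t<T$. It is *elementary* if, for some $\delta>0$ and all $s\in[0,\delta)$, the trajectory of $X$ starting at $(p+s,0)$ returns forward in time, through $y>0$, to a first point $(\xi_X(s),0)$ of $\Sigma$, the trajectory of $Y$ starting at $(p+s,0)$ returns backward in time, through $y<0$, to a first point $(\xi_Y(s),0)$ of $\Sigma$, the two arcs for $s=0$ form $\Gamma$, and the displacement function satisfies $\xi_X(s)-\xi_Y(s)=Ms^2+o(s^2)$ as $s\to0^+$ with $M\neq0$. $Z$ satisfies condition $(C)$, with cycle $\Gamma$, if $(0,0)$ is a visible two-fold of $Z$ with $X^1(0,0)>0$ and $Y^1(0,0)<0$, and for some $q>0$ the trajectory of $X$ (of $Y$) through $(0,0)$ first meets $\Sigma$ again, forward in time and through $y>0$ (backward in time and through $y<0$), at $(q,0)$, transversally; $\Gamma$ is the union of these two closed arcs. **Theorem.** Let $\Gamma_0$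 be an elementary simple two-fold cycle of $Z_0\in\Omega$, given by condition $(C)$. Then there are an open annulus $\mathcal A_0\subset U$ around $\Gamma_0$ (the image of an open topological embedding of $S^1\times(-1,1)$ that maps $S^1\times\{0\}$ onto $\Gamma_0$) and an open neighborhood $\mathcal V_0\subset\Omega$ of $Z_0$ with the following properties. For every $Z=(X,Y)\in\mathcal V_0$ the field $X$ (resp. $Y$) has exactly one tangency point $(p_X,0)$ (resp. $(p_Y,0)$) with $\Sigma$ in $\mathcal A_0$; it is a visible fold with $X^1(p_X,0)>0$ (resp. $Y^1(p_Y,0)<0$), and the trajectory of $X$ (resp. $Y$) starting there first meets $\Sigma$ again, forward in time through $y>0$ (resp. backward in time through $y<0$), at a point $(q_X,0)$ (resp. $(q_Y,0)$), transversally and without leaving $\mathcal A_0$. The map $$\eta:\mathcal V_0\to\mathbb R^2,\qquad \eta(Z)=(p_Y-p_X,\;q_X-q_Y),$$ which is $(p_Y,\,q_X-q_Y)$ under the normalization $p_X=0$, is of class $C^r$, and 1. for $Z\in\mathcal V_0$, $\eta(Z)=(0,0)$ if and only if $Z$ has an elementary simple two-fold cycle contained in $\mathcal A_0$; 2. for every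 $Z\in\mathcal V_0$, $\eta$ is (Fréchet) differentiable at $Z$ and $d\eta(Z):\Omega\to\mathbb R^2$ is surjective; if moreover $p_X=0$, i.e. $Z$ lies in the subspace $\Omega_*=\{(X,Y)\in\Omega: X^2(0,0)=0\}$, then already the restriction of $d\eta(Z)$ to $\Omega_*$ is surjective. Consequently $\eta^{-1}(0,0)$ is a $C^r$ submanifold of codimension two of $\mathcal V_0$, and $\eta^{-1}(0,0)\cap\Omega_*$ is a $C^r$ submanifold of codimension two of $\mathcal V_0\cap\Omega_*$. -/

import Mathlib

open Set Filter Topology MeasureTheory TopologicalSpace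

noncomputable section

/-- The plane `ℝ²`, with points `z = (z.1, z.2) = (x, y)`. -/
abbrev Plane : Type := ℝ × ℝ

/-! ### The space of `C^r` vector fields on an open set, with the `C^r`-topology -/

/-- The vector space of `C^r` vector fields on the open set `U`. A vector field on `U` is
represented by its extension by zero to the plane, so that two fields are equal exactly when they
agree on `U`. -/
def crFieldSubmodule (r : ℕ) (U : Opens Plane) : Submodule ℝ (Plane → Plane) where
  carrier := {X | ContDiffOn ℝ r X U ∧ ∀ z ∉ U, X z = 0}
  zero_mem' := ⟨contDiffOn_const, fun _ _ => rfl⟩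
  add_mem' := fun ha hb =>
    ⟨ha.1.add hb.1, fun z hz => by simp [ha.2 z hz, hb.2 z hz]⟩
  smul_mem' := fun c _ ha =>
    ⟨contDiffOn_const.smul ha.1, fun z hz => by simp [ha.2 z hz]⟩

/-- The space `χ^r` of all `C^r` vector fields `X : U → ℝ²`. (It is a type of its own, and not a
subspace of `Plane → Plane`, because it does not carry the topology of pointwise convergence.) -/
def CrField (r : ℕ) (U : Opens Plane) : Type := crFieldSubmodule r U

namespace CrField

variable {r : ℕ} {U : Opens Plane}

instance : AddCommGroup (CrField r U) := inferInstanceAs (AddCommGroup (crFieldSubmodule r U))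

instance : Module ℝ (CrField r U) := inferInstanceAs (Module ℝ (crFieldSubmodule r U))

instance : CoeFun (CrField r U) (fun _ => Plane → Plane) := ⟨fun X => X.1⟩

theorem contDiffAt (X : CrField r U) {i : ℕ} (hi : i ≤ r) {z : Plane} (hz : z ∈ U) :
    ContDiffAt ℝ i (X : Plane → Plane) z :=
  (X.2.1.contDiffAt (U.isOpen.mem_nhds hz)).of_le (by exact_mod_cast hi)

theorem continuousOn_iteratedFDeriv (X : CrField r U) {i : ℕ} (hi : i ≤ r) :
    ContinuousOn (iteratedFDeriv ℝ i (X : Plane → Plane)) U := by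
  refine (X.2.1.continuousOn_iteratedFDerivWithin (m := i) (by exact_mod_cast hi)
    U.isOpen.uniqueDiffOn).congr ?_
  intro z hz
  exact (iteratedFDerivWithin_of_isOpen i U.isOpen hz).symm

/-- Indices of the semi-norms `sup_K ‖D^i X‖`: a compact `K ⊆ U` and an order `i ≤ r`. -/
abbrev JetIndex (r : ℕ) (U : Opens Plane) : Type :=
  {K : Compacts Plane // (K : Set Plane) ⊆ U} × Fin (r + 1)

/-- The `i`-th derivative of `X` on `K`, as an element of the Banach space of continuous functions
on `K` with the supremum norm. -/
def jet (κ : JetIndex r U) :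
    CrField r U →ₗ[ℝ] C((κ.1.1 : Set Plane), Plane [×(κ.2 : ℕ)]→L[ℝ] Plane) where
  toFun X := ⟨fun z => iteratedFDeriv ℝ κ.2 (X : Plane → Plane) z,
    continuousOn_iff_continuous_domRestrict.1
      ((continuousOn_iteratedFDeriv X (Nat.lt_succ_iff.1 κ.2.2)).mono κ.1.2)⟩
  map_add' X Y := by
    ext1 z
    exact iteratedFDeriv_add_apply
      (contDiffAt X (Nat.lt_succ_iff.1 κ.2.2) (κ.1.2 z.2))
      (contDiffAt Y (Nat.lt_succ_iff.1 κ.2.2) (κ.1.2 z.2))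
  map_smul' c X := by
    ext1 z
    exact iteratedFDeriv_const_smul_apply
      (contDiffAt X (Nat.lt_succ_iff.1 κ.2.2) (κ.1.2 z.2))

/-- The `C^r`-topology: uniform convergence on the compact subsets of `U` of all derivatives of
order at most `r`. -/
instance : TopologicalSpace (CrField r U) :=
  ⨅ κ : JetIndex r U, TopologicalSpace.induced (jet κ) inferInstance

instance : IsTopologicalAddGroup (CrField r U) :=
  topologicalAddGroup_iInf fun κ => topologicalAddGroup_induced (jet κ)

instance : ContinuousSMul ℝ (CrField r U) :=
  continuousSMul_iInf fun κ => continuousSMul_induced (jet κ)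

end CrField

/-- The space `Ω^r = χ^r × χ^r`, with the product topology: `Z = (X, Y)` is the piecewise smooth
vector field equal to `X = Z.1` where `y > 0` and to `Y = Z.2` where `y < 0`; the switching manifold
is `Σ = {(x, y) ∈ U : y = 0}`, given by `h(x, y) = y`. -/
abbrev PiecewiseField (r : ℕ) (U : Opens Plane) : Type := CrField r U × CrField r U

/-! ### Differentiability in topological vector spaces, and submanifolds -/

/-- `f` is of class `C^n` on the (open) set `W` of a topological vector space, in the usual sense of
calculus in locally convex spaces: `f` is continuous on `W` and, if `n ≥ 1`, the directional
derivatives `df (x, v) = lim_{t → 0} (f (x + t v) - f x) / t` exist for `x ∈ W` and all `v`, and `df` is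
of class `C^(n-1)` on `W × E`. -/
def IsCrOn {F : Type*} [AddCommGroup F] [Module ℝ F] [TopologicalSpace F] :
    (n : ℕ) → {E : Type*} → [AddCommGroup E] → [Module ℝ E] → [TopologicalSpace E] →
      (E → F) → Set E → Prop
  | 0, _, _, _, _, f, W => ContinuousOn f W
  | n + 1, E, _, _, _, f, W =>
      ContinuousOn f W ∧
        ∃ df : E × E → F,
          (∀ x ∈ W, ∀ v : E,
            Tendsto (fun t : ℝ => t⁻¹ • (f (x + t • v) - f x)) (𝓝[≠] 0) (𝓝 (df (x, v)))) ∧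
          IsCrOn n df (W ×ˢ (univ : Set E))

/-- `S` is a submanifold of class `C^n` and codimension `k` of the topological vector space `E`:
around each of its points there is a `C^n` chart of `E`, with `C^n` inverse, that maps `S` to a closed
linear subspace of codimension `k`. -/
def IsSubmanifoldOfCodim {E : Type*} [AddCommGroup E] [Module ℝ E] [TopologicalSpace E]
    (n k : ℕ) (S : Set E) : Prop :=
  ∀ z ∈ S, ∃ (Φ : OpenPartialHomeomorph E E) (F : Submodule ℝ E),
    z ∈ Φ.source ∧ IsCrOn n Φ Φ.source ∧ IsCrOn n Φ.symm Φ.target ∧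
    IsClosed (F : Set E) ∧ Module.Finite ℝ (E ⧸ F) ∧ Module.finrank ℝ (E ⧸ F) = k ∧
    ∀ x ∈ Φ.source, x ∈ S ↔ Φ x ∈ F

/-! ### Filippov systems -/

section Filippov

variable {r : ℕ} {U : Opens Plane}

/-- `X h = X · ∇h` for `h(x, y) = y`, that is, the second component of `X`. -/
def lieH (X : CrField r U) (z : Plane) : ℝ := (X z).2

/-- `X (X h) = X · ∇(X h)`. -/
def lieLieH (X : CrField r U) (z : Plane) : ℝ := fderiv ℝ (lieH X) z (X z)

/-- `p ∈ Σ` is a visible fold of `X` (the field in `y > 0`). -/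
def IsVisibleFoldAbove (X : CrField r U) (p : Plane) : Prop :=
  p ∈ U ∧ p.2 = 0 ∧ lieH X p = 0 ∧ 0 < lieLieH X p

/-- `p ∈ Σ` is a visible fold of `Y` (the field in `y < 0`). -/
def IsVisibleFoldBelow (Y : CrField r U) (p : Plane) : Prop :=
  p ∈ U ∧ p.2 = 0 ∧ lieH Y p = 0 ∧ lieLieH Y p < 0

/-- `p` is a visible two-fold singularity of `Z = (X, Y)`. -/
def IsVisibleTwoFold (Z : PiecewiseField r U) (p : Plane) : Prop :=
  IsVisibleFoldAbove Z.1 p ∧ IsVisibleFoldBelow Z.2 p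

/-- The sliding vector field `Z^s = (Yh X - Xh Y) / (Yh - Xh)`. -/
def slidingField (Z : PiecewiseField r U) (p : Plane) : Plane :=
  (lieH Z.2 p - lieH Z.1 p)⁻¹ • (lieH Z.2 p • Z.1 p - lieH Z.1 p • Z.2 p)

/-- `p` is a regular point of `Z`: it is not a zero of the field(s) that define `Z` at `p`, not a
tangency point (`p ∈ Σ` with `Xh(p) Yh(p) = 0`), and not a pseudo equilibrium (a zero of `Z^s` in
the sliding or escaping region, i.e. where `Xh(p) Yh(p) < 0`). -/
def IsRegularPoint (Z : PiecewiseField r U) (p : Plane) : Prop :=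
  p ∈ U ∧ (0 ≤ p.2 → Z.1 p ≠ 0) ∧ (p.2 ≤ 0 → Z.2 p ≠ 0) ∧
    (p.2 = 0 → lieH Z.1 p * lieH Z.2 p ≠ 0 ∧
      (lieH Z.1 p * lieH Z.2 p < 0 → slidingField Z p ≠ 0))

/-- Filippov's set-valued field: `{X}` where `y > 0`, `{Y}` where `y < 0`, and the convex hull of `X`
and `Y` on `Σ`. -/
def filippovSet (Z : PiecewiseField r U) (p : Plane) : Set Plane :=
  {v | (0 < p.2 → v = Z.1 p) ∧ (p.2 < 0 → v = Z.2 p) ∧ (p.2 = 0 → v ∈ segment ℝ (Z.1 p) (Z.2 p))}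

/-- `γ` is a trajectory of `Z` on `[0, T]` in the sense of Filippov: it is absolutely continuous and
solves the differential inclusion almost everywhere. -/
def IsTrajectory (Z : PiecewiseField r U) (T : ℝ) (γ : ℝ → Plane) : Prop :=
  (∀ t ∈ Icc 0 T, γ t ∈ U) ∧ AbsolutelyContinuousOnInterval γ 0 T ∧
    ∀ᵐ t ∂(volume.restrict (Icc 0 T)), ∃ v ∈ filippovSet Z (γ t), HasDerivAt γ v t

/-- `Γ` is a simple two-fold cycle of `Z` with two-fold point `p`. -/
def IsSimpleTwoFoldCycle (Z : PiecewiseField r U) (p : Plane) (Γ : Set Plane) : Prop :=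
  IsVisibleTwoFold Z p ∧
    ∃ T > 0, ∃ γ : ℝ → Plane, IsTrajectory Z T γ ∧ γ 0 = p ∧ γ T = p ∧
      (∀ t ∈ Ioo 0 T, IsRegularPoint Z (γ t)) ∧ Γ = γ '' Icc 0 T

/-- `G` is the arc of the trajectory of `X` that starts at `(x, 0)` and runs forward in time, through
`y > 0`, to its first intersection `(q, 0)` with `Σ`. -/
def IsForwardArc (X : CrField r U) (x q : ℝ) (G : Set Plane) : Prop :=
  ∃ T > 0, ∃ φ : ℝ → Plane, IsIntegralCurveOn φ (fun _ => X) (Icc 0 T) ∧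
    (∀ t ∈ Icc 0 T, φ t ∈ U) ∧ φ 0 = (x, 0) ∧ φ T = (q, 0) ∧
    (∀ t ∈ Ioo 0 T, 0 < (φ t).2) ∧ G = φ '' Icc 0 T

/-- `G` is the arc of the trajectory of `Y` that starts at `(x, 0)` and runs backward in time, through
`y < 0`, to its first intersection `(q, 0)` with `Σ`. -/
def IsBackwardArc (Y : CrField r U) (x q : ℝ) (G : Set Plane) : Prop :=
  ∃ T < 0, ∃ φ : ℝ → Plane, IsIntegralCurveOn φ (fun _ => Y) (Icc T 0) ∧
    (∀ t ∈ Icc T 0, φ t ∈ U) ∧ φ 0 = (x, 0) ∧ φ T = (q, 0) ∧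
    (∀ t ∈ Ioo T 0, (φ t).2 < 0) ∧ G = φ '' Icc T 0

/-- Condition (C) for `Z = (X, Y)`, where `Γ` is the cycle formed by the two arcs. -/
def ConditionC (Z : PiecewiseField r U) (Γ : Set Plane) : Prop :=
  IsVisibleTwoFold Z (0, 0) ∧ 0 < (Z.1 (0, 0)).1 ∧ (Z.2 (0, 0)).1 < 0 ∧
    ∃ q > 0, ∃ GX GY : Set Plane,
      IsForwardArc Z.1 0 q GX ∧ lieH Z.1 (q, 0) ≠ 0 ∧
      IsBackwardArc Z.2 0 q GY ∧ lieH Z.2 (q, 0) ≠ 0 ∧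
      Γ = GX ∪ GY

/-- `Γ` is an elementary simple two-fold cycle of `Z`. If `(p, 0)` is its two-fold point, then the
displacement function `f(s) = ξX s - ξY s` is defined on some `[0, δ)`, where `ξX s` and `ξY s` are the
abscissas at which the forward trajectory of `X` and the backward trajectory of `Y` starting at
`(p + s, 0)` first return to `Σ`; for `s = 0` the two arcs form `Γ`; and `f(s) = M s² + o(s²)` with
`M ≠ 0`. -/
def IsElementarySimpleTwoFoldCycle (Z : PiecewiseField r U) (Γ : Set Plane) : Prop :=
  ∃ p : ℝ, IsSimpleTwoFoldCycle Z (p, 0) Γ ∧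
    ∃ δ > 0, ∃ (ξX ξY : ℝ → ℝ) (GX GY : ℝ → Set Plane),
      (∀ s ∈ Ico 0 δ, IsForwardArc Z.1 (p + s) (ξX s) (GX s) ∧
        IsBackwardArc Z.2 (p + s) (ξY s) (GY s)) ∧
      Γ = GX 0 ∪ GY 0 ∧
      ∃ M : ℝ, M ≠ 0 ∧
        (fun s => ξX s - ξY s - M * s ^ 2) =o[𝓝[≥] 0] (fun s : ℝ => s ^ 2)

/-- `A` is an (open, topological) annulus around the closed curve `Γ`: there is a homeomorphism of
`S¹ × (-1, 1)` onto the open set `A` that maps the core circle `S¹ × {0}` onto `Γ`. -/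
def IsAnnulusAround (A Γ : Set Plane) : Prop :=
  ∃ Φ : Circle × Ioo (-1 : ℝ) 1 → Plane,
    IsOpenEmbedding Φ ∧ range Φ = A ∧ Φ '' {w | (w.2 : ℝ) = 0} = Γ

/-- The quantities `p_X, q_X, p_Y, q_Y` of `Z = (X, Y)` in `A`: `(pX, 0)` and `(pY, 0)` are the only
tangency points of `X` and of `Y` with `Σ` in `A`; they are visible folds with `X¹ > 0` and
`Y¹ < 0`; the trajectory of `X` from `(pX, 0)` forward in time (of `Y` from `(pY, 0)` backward in time)
first meets `Σ` at `(qX, 0)` (at `(qY, 0)`), transversally and without leaving `A`. -/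
def IsFoldReturnData (A : Set Plane) (Z : PiecewiseField r U) (pX qX pY qY : ℝ) : Prop :=
  ((pX, 0) ∈ A ∧ IsVisibleFoldAbove Z.1 (pX, 0) ∧ 0 < (Z.1 (pX, 0)).1 ∧
    (∀ x : ℝ, (x, 0) ∈ A → lieH Z.1 (x, 0) = 0 → x = pX) ∧
    (∃ G ⊆ A, IsForwardArc Z.1 pX qX G) ∧ lieH Z.1 (qX, 0) ≠ 0) ∧
  ((pY, 0) ∈ A ∧ IsVisibleFoldBelow Z.2 (pY, 0) ∧ (Z.2 (pY, 0)).1 < 0 ∧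
    (∀ x : ℝ, (x, 0) ∈ A → lieH Z.2 (x, 0) = 0 → x = pY) ∧
    (∃ G ⊆ A, IsBackwardArc Z.2 pY qY G) ∧ lieH Z.2 (qY, 0) ≠ 0)

end Filippov

/-- The subspace of `Ω^r` of all `Z = (X, Y)` with `X²(0, 0) = 0`: these are the `Z` that, near `Z₀`, are
normalized by `p_X = 0`. -/
def normalizedFields (r : ℕ) (U : Opens Plane) : Submodule ℝ (PiecewiseField r U) where
  carrier := {Z | lieH Z.1 (0, 0) = 0}
  zero_mem' := rfl
  add_mem' := fun {a b} ha hb => by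
    change (a.1 (0, 0)).2 + (b.1 (0, 0)).2 = 0
    exact (congrArg₂ (· + ·) ha hb).trans (add_zero 0)
  smul_mem' := fun c a ha => by
    change c * (a.1 (0, 0)).2 = 0
    exact (congrArg (c * ·) ha).trans (mul_zero c)

end

/-! Each side is treated separately. The fold abscissa is the zero of `x ↦ X²(x, 0)`, nondegenerate
because the fold is quadratic. The return time is a zero of the height along the flow, nondegenerate
because the return is transversal. By the implicit function theorem both depend on the field in a
`C^r` way once the flow is `C^r` jointly in field, time and initial point. The space of fields on
`U` is only locally convex, so a cutoff first sends a field, linearly and continuously, into the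
Banach space `BJet r` of bounded `C^r` fields. There evaluation is jointly `C^r`, and the flow
solves a Volterra equation in `C([0,1])` to which the implicit function theorem applies
(`exists_isSmoothFlow`). Hence `η = g ∘ L` with `L` continuous linear into a Banach space and `g` of
class `C^r`.

The return map `R` is constant along trajectories, so its derivative along `y = 0` is a continuous
multiple of `X²`. It vanishes at the fold and is differentiable there, which gives `ξ(s) = q + m s²
+ o(s²)` even for `r = 1`, with `m` continuous in the field (`IsFoldOrbit.exists_isFoldReturn`). If
the two folds agree and the two returns agree, the arcs close up to a cycle with `M = m_X - m_Y`.
This is nonzero at `Z₀`, hence nearby. Conversely, a cycle in the annulus must start at the only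
tangency points available, and first returns are unique (`IsSideReturn.exists_cycle_iff`).

For surjectivity, perturbing `Y` alone suffices, and this stays inside the normalized subspace. A
vertical constant field moves the fold. The field rotated by a right angle and multiplied by `|z|²`
fixes the fold and moves the return, by a Melnikov-type positivity argument
(`IsSmoothFlow.cross_fderiv_pos`). The resulting nonzero determinant persists under perturbation.
The zero set is straightened by the identity plus a correction of finite rank, which reduces the
inverse function theorem to the Banach space (`isSubmanifoldOfCodim_preimage`).

The lower field is reduced to the upper one by reflection with time reversal (`mirror`). The annulus
is a tube around the cycle whose transversal is horizontal at the cusp and at the corner, where the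
cycle is a graph over `y` (`exists_isAnnulusAround_upperArcs`). -/

noncomputable section

/-! ### Superposition operators on spaces of continuous maps -/

section Superposition

universe u

variable {K : Type*} [TopologicalSpace K] [CompactSpace K]
  {E F : Type u} [NormedAddCommGroup E] [NormedSpace ℝ E] [NormedAddCommGroup F] [NormedSpace ℝ F]

/-- Pointwise application of a continuous family of continuous linear maps. -/
def ContinuousMap.clmApply : C(K, E →L[ℝ] F) →L[ℝ] C(K, E) →L[ℝ] C(K, F) :=
  LinearMap.mkContinuous₂
    (LinearMap.mk₂ ℝ (fun (A : C(K, E →L[ℝ] F)) (h : C(K, E)) =>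
        (⟨fun x => A x (h x), by fun_prop⟩ : C(K, F)))
      (fun A B h => by ext x; simp) (fun c A h => by ext x; simp)
      (fun A h k => by ext x; simp) (fun c A h => by ext x; simp))
    1 (fun A h => by
      rw [one_mul, ContinuousMap.norm_le _ (by positivity)]
      intro x
      exact (A x).le_of_opNorm_le_of_le (A.norm_coe_le_norm x) (h.norm_coe_le_norm x))

@[simp]
theorem ContinuousMap.clmApply_apply (A : C(K, E →L[ℝ] F)) (h : C(K, E)) (x : K) :
    ContinuousMap.clmApply A h x = A x (h x) := rfl

/-- The mean value inequality is applied at each point of `K`. The estimate is uniform on `K`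
because `γ ↦ f' ∘ γ` is continuous for the supremum norm, although `f'` need not be uniformly
continuous on bounded sets. -/
theorem ContinuousMap.hasFDerivAt_postcomp (f : C(E, F)) (f' : C(E, E →L[ℝ] F))
    (hf : ∀ x, HasFDerivAt f (f' x) x) (γ : C(K, E)) :
    HasFDerivAt (fun γ : C(K, E) => f.comp γ) (ContinuousMap.clmApply (f'.comp γ)) γ := by
  rw [hasFDerivAt_iff_isLittleO, Asymptotics.isLittleO_iff]
  intro ε hε
  have hc : Continuous (fun γ : C(K, E) => f'.comp γ) := f'.continuous_postcomp
  obtain ⟨δ, hδ, hball⟩ := (Metric.continuous_iff (α := C(K, E)) (β := C(K, E →L[ℝ] F))).1 hc γ ε hε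
  filter_upwards [Metric.ball_mem_nhds γ hδ] with γ' hγ'
  rw [ContinuousMap.norm_le _ (by positivity)]
  intro x
  have hseg : ∀ z ∈ segment ℝ (γ x) (γ' x), ‖f' z - f' (γ x)‖ ≤ ε := by
    rintro z hz
    rw [segment_eq_image'] at hz
    obtain ⟨t, ht, rfl⟩ := hz
    -- A point of the segment at `x` is the value at `x` of a whole path of the `δ`-ball, so
    -- continuity at the level of paths bounds `f'` there.
    have h1 : dist (γ + t • (γ' - γ)) γ < δ := by
      rw [dist_eq_norm, add_sub_cancel_left, norm_smul, Real.norm_of_nonneg ht.1]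
      calc t * ‖γ' - γ‖ ≤ 1 * ‖γ' - γ‖ := by gcongr; exact ht.2
        _ < δ := by rw [one_mul, ← dist_eq_norm]; exact hγ'
    have h2 := (ContinuousMap.dist_apply_le_dist x).trans (hball _ h1).le
    rw [dist_eq_norm] at h2
    exact h2
  have := (convex_segment (γ x) (γ' x)).norm_image_sub_le_of_norm_hasFDerivWithin_le'
    (fun z _ => (hf z).hasFDerivWithinAt) hseg (left_mem_segment ℝ _ _) (right_mem_segment ℝ _ _)
  refine this.trans ?_
  gcongr
  exact ContinuousMap.norm_coe_le_norm (γ' - γ) x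

/-- The derivative is again a postcomposition, by `fderiv ℝ f`, followed by a continuous linear map.
The induction therefore changes the target to `E →L[ℝ] F`, which is why `F` is quantified inside and
shares the universe of `E`. -/
theorem ContinuousMap.contDiff_postcomp_nat (n : ℕ) : ∀ {F : Type u} [NormedAddCommGroup F]
    [NormedSpace ℝ F] (f : C(E, F)), ContDiff ℝ n f →
      ContDiff ℝ n (fun γ : C(K, E) => f.comp γ) := by
  induction n with
  | zero =>
    intro F _ _ f _
    exact contDiff_zero.2 f.continuous_postcomp
  | succ n ih =>
    intro F _ _ f hf
    have hf' := contDiff_succ_iff_fderiv.1 (by exact_mod_cast hf : ContDiff ℝ ((n : WithTop ℕ∞) + 1) f)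
    have hcont : Continuous (fderiv ℝ f) := hf'.2.2.continuous
    refine contDiff_succ_iff_hasFDerivAt.2
      ⟨fun γ => ContinuousMap.clmApply ((⟨fderiv ℝ f, hcont⟩ : C(E, E →L[ℝ] F)).comp γ), ?_, ?_⟩
    · exact ContinuousMap.clmApply.contDiff.comp (ih ⟨fderiv ℝ f, hcont⟩ hf'.2.2)
    · intro γ
      exact ContinuousMap.hasFDerivAt_postcomp f _ (fun x => (hf'.1 x).hasFDerivAt) γ

end Superposition

/-! ### Volterra equations -/

section Volterra

open unitInterval

variable {E : Type*} [NormedAddCommGroup E] [NormedSpace ℝ E]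

/-- The indefinite integral from `0` on the unit interval. -/
def volterraInt : C(I, E) →L[ℝ] C(I, E) :=
  LinearMap.mkContinuous
    { toFun := fun g => ⟨fun s => ∫ u in (0 : ℝ)..s, IccExtend zero_le_one g u,
        (intervalIntegral.continuous_primitive
          (fun a b => (g.continuous.Icc_extend').intervalIntegrable a b) 0).comp
          continuous_subtype_val⟩
      map_add' := fun g h => by
        ext s
        exact intervalIntegral.integral_add (g.continuous.Icc_extend'.intervalIntegrable _ _)
          (h.continuous.Icc_extend'.intervalIntegrable _ _)
      map_smul' := fun c g => by
        ext s
        exact intervalIntegral.integral_smul c _ }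
    1 (fun g => by
      rw [one_mul, ContinuousMap.norm_le _ (norm_nonneg _)]
      intro s
      refine (intervalIntegral.norm_integral_le_of_norm_le_const
        (C := ‖g‖) fun u _ => g.norm_coe_le_norm _).trans ?_
      rw [sub_zero, abs_of_nonneg s.2.1]
      exact mul_le_of_le_one_right (norm_nonneg _) s.2.2)


theorem volterraInt_apply (g : C(I, E)) (s : I) :
    volterraInt g s = ∫ u in (0 : ℝ)..s, IccExtend zero_le_one g u := rfl

/-- Multiplication by the weight `exp (c s)`. -/
def expWeight (c : ℝ) (β : C(I, E)) : C(I, E) :=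
  ⟨fun s => Real.exp (c * s) • β s, by fun_prop⟩

theorem expWeight_apply (c : ℝ) (β : C(I, E)) (s : I) :
    expWeight c β s = Real.exp (c * s) • β s := rfl

theorem expWeight_expWeight_neg (c : ℝ) (β : C(I, E)) : expWeight c (expWeight (-c) β) = β := by
  ext s
  simp [expWeight_apply, smul_smul, ← Real.exp_add]

/-- Bielecki's weighted norm: integrating `K exp (c u)` up to `s` costs only `K / c` relative to
`exp (c s)`. Large `c` makes the integral operator a contraction on the whole interval, whatever the
size of `K`. -/
theorem norm_expWeight_volterraInt_sub_le {K c : ℝ} (hK : 0 ≤ K) (hc : 0 < c)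
    {N : C(I, E) → C(I, E)} (hN : ∀ β β' s, ‖N β s - N β' s‖ ≤ K * ‖β s - β' s‖) (β β' : C(I, E)) :
    ‖expWeight (-c) (volterraInt (N (expWeight c β))) -
      expWeight (-c) (volterraInt (N (expWeight c β')))‖ ≤ K / c * ‖β - β'‖ := by
  rw [ContinuousMap.norm_le _ (by positivity)]
  intro s
  have hint : ‖volterraInt (N (expWeight c β)) s - volterraInt (N (expWeight c β')) s‖ ≤
      ∫ u in (0 : ℝ)..s, K * ‖β - β'‖ * Real.exp (c * u) := by
    rw [← ContinuousMap.sub_apply, ← map_sub, volterraInt_apply]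
    refine intervalIntegral.norm_integral_le_of_norm_le s.2.1 (Eventually.of_forall ?_)
      (Continuous.intervalIntegrable (by fun_prop) _ _)
    intro u hu
    have hu' : u ∈ Icc (0 : ℝ) 1 := ⟨hu.1.le, hu.2.trans s.2.2⟩
    rw [IccExtend_of_mem _ _ hu', ContinuousMap.sub_apply]
    refine (hN _ _ _).trans ?_
    rw [expWeight_apply, expWeight_apply, ← smul_sub, norm_smul, Real.norm_of_nonneg (by positivity)]
    have := ContinuousMap.norm_coe_le_norm (β - β') ⟨u, hu'⟩
    rw [ContinuousMap.sub_apply] at this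
    calc K * (Real.exp (c * u) * ‖β ⟨u, hu'⟩ - β' ⟨u, hu'⟩‖)
        ≤ K * (Real.exp (c * u) * ‖β - β'‖) := by gcongr
      _ = _ := by ring
  have hexp : ∫ u in (0 : ℝ)..s, K * ‖β - β'‖ * Real.exp (c * u) =
      K * ‖β - β'‖ * ((Real.exp (c * s) - 1) / c) := by
    rw [intervalIntegral.integral_const_mul, intervalIntegral.integral_comp_mul_left _ hc.ne',
      integral_exp]
    simp [div_eq_inv_mul]
  rw [ContinuousMap.sub_apply, expWeight_apply, expWeight_apply, ← smul_sub, norm_smul,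
    Real.norm_of_nonneg (by positivity)]
  calc Real.exp (-c * s) * ‖volterraInt (N (expWeight c β)) s - volterraInt (N (expWeight c β')) s‖
      ≤ Real.exp (-c * s) * (K * ‖β - β'‖ * ((Real.exp (c * s) - 1) / c)) := by
        rw [← hexp]; gcongr
    _ = K / c * ‖β - β'‖ * (1 - Real.exp (-c * s)) := by
        have h1 : Real.exp (-c * s) * Real.exp (c * s) = 1 := by
          rw [← Real.exp_add]; simp
        rw [neg_mul] at h1 ⊢
        field_simp
        linear_combination (K * ‖β - β'‖) * h1
    _ ≤ K / c * ‖β - β'‖ * 1 := by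
        gcongr
        have := Real.exp_pos (-c * s)
        linarith
    _ = _ := mul_one _

theorem existsUnique_volterra [CompleteSpace E] {K : ℝ} (hK : 0 ≤ K)
    {N : C(I, E) → C(I, E)} (hN : ∀ β β' s, ‖N β s - N β' s‖ ≤ K * ‖β s - β' s‖) :
    ∃! β, β = volterraInt (N β) := by
  -- This weight gives the contraction constant `K / (K + 1) < 1`. Fixed points of the conjugated
  -- operator `T` correspond to solutions through `expWeight c`.
  set c := K + 1 with hc
  have hc0 : 0 < c := by positivity
  set T : C(I, E) → C(I, E) := fun β => expWeight (-c) (volterraInt (N (expWeight c β))) with hT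
  have hcontr : ContractingWith (K / c).toNNReal T := by
    refine ⟨?_, LipschitzWith.of_dist_le_mul fun β β' => ?_⟩
    · rw [Real.toNNReal_lt_one, div_lt_one hc0]
      linarith
    · rw [dist_eq_norm, dist_eq_norm, Real.coe_toNNReal _ (by positivity)]
      exact norm_expWeight_volterraInt_sub_le hK hc0 hN β β'
  refine ⟨expWeight c (hcontr.fixedPoint T), ?_, ?_⟩
  · have := hcontr.fixedPoint_isFixedPt (f := T)
    have h2 := congrArg (expWeight c) this.eq
    exact h2.symm.trans (expWeight_expWeight_neg c _)
  · intro β hβ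
    have h2 : expWeight c (expWeight (-c) β) = β := expWeight_expWeight_neg c β
    have : Function.IsFixedPt T (expWeight (-c) β) := by
      change expWeight (-c) (volterraInt (N (expWeight c (expWeight (-c) β)))) = _
      rw [h2, ← hβ]
    rw [← hcontr.fixedPoint_unique this, h2]

end Volterra

/-! ### Smooth dependence of solutions of differential equations on parameters -/

section ParametricODE

open unitInterval

universe u

variable {P E : Type u} [NormedAddCommGroup P] [NormedSpace ℝ P]
  [NormedAddCommGroup E] [NormedSpace ℝ E]

/-- The pairing of a constant parameter with a continuous path. -/
def constPair : P × C(I, E) →L[ℝ] C(I, P × E) :=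
  LinearMap.mkContinuous
    { toFun := fun w => (ContinuousMap.const I w.1).prodMk w.2
      map_add' := fun _ _ => rfl
      map_smul' := fun _ _ => rfl }
    1 (fun w => by
      rw [one_mul, ContinuousMap.norm_le _ (norm_nonneg _)]
      intro s
      exact max_le_max le_rfl (w.2.norm_coe_le_norm s))

@[simp]
theorem constPair_apply (w : P × C(I, E)) (s : I) : constPair w s = (w.1, w.2 s) := rfl

/-- The Lipschitz bound in the state variable passes to the derivative, so the linearized Volterra
equation is again covered by `existsUnique_volterra`. -/
theorem norm_fderiv_inr_le_of_lipschitz {e : P × E → E} {w : P × E} (he : DifferentiableAt ℝ e w)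
    {k : ℝ} (hk : 0 ≤ k) (hlip : ∀ x y, ‖e (w.1, x) - e (w.1, y)‖ ≤ k * ‖x - y‖) (h : E) :
    ‖fderiv ℝ e w (0, h)‖ ≤ k * ‖h‖ := by
  have h1 : HasFDerivAt (fun x => e (w.1, x)) (fderiv ℝ e w ∘L .inr ℝ P E) w.2 :=
    HasFDerivAt.comp w.2 he.hasFDerivAt (hasFDerivAt_prodMk_right w.1 w.2)
  exact (fderiv ℝ e w ∘L .inr ℝ P E).le_of_opNorm_le
    (h1.le_of_lip' hk (Eventually.of_forall fun x => hlip x w.2)) h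

/-- The implicit function theorem for `(b, y) ↦ y - ∫ e (b, y)` on `P × C(I, E)`. The partial
derivative in `y` is the identity minus a linear Volterra operator, hence bijective by the same
fixed point argument. The implicit function is the global solution by uniqueness. The Lipschitz
constant may depend on the parameter. -/
theorem exists_contDiff_volterra [CompleteSpace P] [CompleteSpace E] {n : ℕ} (hn : n ≠ 0)
    (e : C(P × E, E)) (he : ContDiff ℝ n e) {k : P → ℝ} (hk : ∀ b, 0 ≤ k b)
    (hlip : ∀ b x y, ‖e (b, x) - e (b, y)‖ ≤ k b * ‖x - y‖) :
    ∃ Y : P → C(I, E), ContDiff ℝ n Y ∧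
      ∀ b y, y = volterraInt (e.comp (constPair (b, y))) ↔ y = Y b := by
  have hex : ∀ b, ∃! y, y = volterraInt (e.comp (constPair (b, y))) := fun b =>
    existsUnique_volterra (N := fun y => e.comp (constPair (b, y))) (hk b)
      fun β β' s => hlip b (β s) (β' s)
  choose Y hY huniq using hex
  refine ⟨Y, ?_, fun b y => ⟨huniq b y, fun h => h ▸ hY b⟩⟩
  have hn' : (n : WithTop ℕ∞) ≠ 0 := by exact_mod_cast hn
  have hdiff : Differentiable ℝ e := he.differentiable hn'
  have hcont : Continuous (fderiv ℝ e) := he.continuous_fderiv hn'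
  set f : P × C(I, E) → C(I, E) := fun w => w.2 - volterraInt (e.comp (constPair w)) with hf
  have hfn : ContDiff ℝ n f := contDiff_snd.sub
    (volterraInt.contDiff.comp
      ((ContinuousMap.contDiff_postcomp_nat n e he).comp constPair.contDiff))
  have hfd : ∀ w, HasFDerivAt f (.snd ℝ P C(I, E) - volterraInt ∘L
      (ContinuousMap.clmApply ((⟨fderiv ℝ e, hcont⟩ : C(P × E, P × E →L[ℝ] E)).comp (constPair w)))
        ∘L constPair) w := by
    intro w
    have h1 := ContinuousMap.hasFDerivAt_postcomp e ⟨fderiv ℝ e, hcont⟩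
      (fun x => (hdiff x).hasFDerivAt) (constPair w)
    have h2 := h1.comp w (constPair (P := P) (E := E)).hasFDerivAt
    exact hasFDerivAt_snd.sub ((volterraInt (E := E)).hasFDerivAt.comp w h2)
  rw [contDiff_iff_contDiffAt]
  intro b
  have hinv : (fderiv ℝ f (b, Y b) ∘L .inr ℝ P C(I, E)).IsInvertible := by
    have hformula : ∀ h, (fderiv ℝ f (b, Y b) ∘L .inr ℝ P C(I, E)) h =
        h - volterraInt (ContinuousMap.clmApply
          ((⟨fderiv ℝ e, hcont⟩ : C(P × E, P × E →L[ℝ] E)).comp (constPair (b, Y b)))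
            (constPair (0, h))) := fun h => by
      rw [(hfd _).fderiv]; rfl
    have hbij : ∀ g, ∃! h, (fderiv ℝ f (b, Y b) ∘L .inr ℝ P C(I, E)) h = g := by
      intro g
      -- Solving `h - V h = g` for the linear Volterra operator `V`: with `h = g + w` it becomes the
      -- fixed point equation `w = V (g + w)`.
      obtain ⟨w, hw, hwu⟩ := existsUnique_volterra (E := E)
        (N := fun w => ContinuousMap.clmApply
          ((⟨fderiv ℝ e, hcont⟩ : C(P × E, P × E →L[ℝ] E)).comp (constPair (b, Y b)))
            (constPair (0, g + w))) (hk b) (by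
          intro β β' s
          simp only [ContinuousMap.clmApply_apply, ← map_sub, constPair_apply]
          have : ((0 : P), (g + β) s) - (0, (g + β') s) = (0, β s - β' s) := by simp
          rw [this]
          exact norm_fderiv_inr_le_of_lipschitz (hdiff _) (hk b) (hlip b) _)
      refine ⟨g + w, ?_, ?_⟩
      · simp only [hformula]
        rw [← hw, add_sub_cancel_right]
      · intro h hh
        simp only [hformula] at hh
        have := hwu (h - g) (by
          simp only
          rw [add_sub_cancel]
          rw [← hh]; abel)
        rw [← this]; abel
    refine ⟨ContinuousLinearEquiv.ofBijective (fderiv ℝ f (b, Y b) ∘L .inr ℝ P C(I, E)) ?_ ?_, ?_⟩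
    · rw [LinearMap.ker_eq_bot]
      intro x y hxy
      exact (hbij _).unique hxy rfl
    · rw [LinearMap.range_eq_top]
      intro g
      exact (hbij g).exists
    · ext1 x; rfl
  have hat : ContDiffAt ℝ n f (b, Y b) := hfn.contDiffAt
  refine (hat.contDiffAt_implicitFunction hn' hinv).congr_of_eventuallyEq ?_
  filter_upwards [hat.eventually_apply_implicitFunction hn' hinv] with b' hb'
  symm
  apply huniq
  have h0 : f (b, Y b) = 0 := sub_eq_zero.2 (hY b)
  rw [h0] at hb'
  exact sub_eq_zero.1 hb'

/-- The linearized equation satisfied by the derivative of the solution with respect to the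
parameter. -/
theorem fderiv_volterra_solution {n : ℕ} (hn : n ≠ 0)
    (e : C(P × E, E)) (he : ContDiff ℝ n e) {Y : P → C(I, E)} (hY : ContDiff ℝ n Y)
    (heq : ∀ b, Y b = volterraInt (e.comp (constPair (b, Y b)))) (b v : P) (s : I) :
    fderiv ℝ Y b v s = ∫ u in (0 : ℝ)..s, IccExtend zero_le_one
      (fun u : I => fderiv ℝ e (b, Y b u) (v, fderiv ℝ Y b v u)) u := by
  have hn' : (n : WithTop ℕ∞) ≠ 0 := by exact_mod_cast hn
  have hdiff : Differentiable ℝ e := he.differentiable hn'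
  have hcont : Continuous (fderiv ℝ e) := he.continuous_fderiv hn'
  have hYd : HasFDerivAt Y (fderiv ℝ Y b) b := (hY.differentiable hn' b).hasFDerivAt
  -- The right-hand side of the fixed point equation `heq` is differentiated by the chain rule.
  -- Uniqueness of the derivative then gives the linearized equation.
  have h1 : HasFDerivAt Y (volterraInt ∘L
      (ContinuousMap.clmApply ((⟨fderiv ℝ e, hcont⟩ : C(P × E, P × E →L[ℝ] E)).comp
        (constPair (b, Y b)))) ∘L constPair ∘L ((ContinuousLinearMap.id ℝ P).prod (fderiv ℝ Y b))) b := by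
    have h2 := ContinuousMap.hasFDerivAt_postcomp e ⟨fderiv ℝ e, hcont⟩
      (fun x => (hdiff x).hasFDerivAt) (constPair (b, Y b))
    have h3 : HasFDerivAt (fun b => constPair (b, Y b)) (constPair ∘L
        ((ContinuousLinearMap.id ℝ P).prod (fderiv ℝ Y b))) b :=
      (constPair (P := P) (E := E)).hasFDerivAt.comp b ((hasFDerivAt_id b).prodMk hYd)
    have h4 := HasFDerivAt.comp b h2 h3
    exact ((volterraInt (E := E)).hasFDerivAt.comp b h4).congr_of_eventuallyEq
      (Eventually.of_forall heq)
  have h3 := congrArg (fun A : P →L[ℝ] C(I, E) => A v s) (hYd.unique h1)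
  exact h3

end ParametricODE


/-! ### The Banach space of bounded `C^r` vector fields on the plane -/

open scoped BoundedContinuousFunction

/-- The values of the `i`-th derivative of a planar vector field. -/
def JetCoeff (i : ℕ) : Type := Plane [×i]→L[ℝ] Plane

instance (i : ℕ) : NormedAddCommGroup (JetCoeff i) :=
  inferInstanceAs (NormedAddCommGroup (Plane [×i]→L[ℝ] Plane))

instance (i : ℕ) : NormedSpace ℝ (JetCoeff i) :=
  inferInstanceAs (NormedSpace ℝ (Plane [×i]→L[ℝ] Plane))

instance (i : ℕ) : CompleteSpace (JetCoeff i) :=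
  inferInstanceAs (CompleteSpace (Plane [×i]→L[ℝ] Plane))

/-- Sequences of bounded continuous maps on the plane with values in the multilinear maps. -/
def JetProd (r : ℕ) : Type := ∀ i : Fin (r + 1), Plane →ᵇ JetCoeff i

instance (r : ℕ) : NormedAddCommGroup (JetProd r) :=
  inferInstanceAs (NormedAddCommGroup (∀ i : Fin (r + 1), Plane →ᵇ JetCoeff i))

instance (r : ℕ) : NormedSpace ℝ (JetProd r) :=
  inferInstanceAs (NormedSpace ℝ (∀ i : Fin (r + 1), Plane →ᵇ JetCoeff i))

instance (r : ℕ) : CompleteSpace (JetProd r) :=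
  inferInstanceAs (CompleteSpace (∀ i : Fin (r + 1), Plane →ᵇ JetCoeff i))

/-- Currying the first variable. -/
def curryPlane (i : ℕ) : JetCoeff (i + 1) →L[ℝ] (Plane →L[ℝ] JetCoeff i) :=
  ((continuousMultilinearCurryLeftEquiv ℝ (fun _ : Fin (i + 1) => Plane)
    Plane).toContinuousLinearEquiv.toContinuousLinearMap :
      (Plane [×(i + 1)]→L[ℝ] Plane) →L[ℝ] (Plane →L[ℝ] Plane [×i]→L[ℝ] Plane))

theorem norm_curryPlane (i : ℕ) (m : JetCoeff (i + 1)) : ‖curryPlane i m‖ = ‖m‖ :=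
  (continuousMultilinearCurryLeftEquiv ℝ (fun _ : Fin (i + 1) => Plane) Plane).norm_map m

/-- A multilinear map in no variables is a vector. -/
def uncurryPlane : JetCoeff 0 →L[ℝ] Plane :=
  ((continuousMultilinearCurryFin0 ℝ Plane Plane).toContinuousLinearEquiv.toContinuousLinearMap :
    (Plane [×0]→L[ℝ] Plane) →L[ℝ] Plane)

theorem norm_uncurryPlane (m : JetCoeff 0) : ‖uncurryPlane m‖ = ‖m‖ :=
  (continuousMultilinearCurryFin0 ℝ Plane Plane).norm_map m

/-- The sequences `(f₀, …, f_r)` of bounded continuous maps on the plane, with values in the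
multilinear maps, such that `f_{i+1}` is the derivative of `f_i`. -/
def jetSubmodule (r : ℕ) : Submodule ℝ (JetProd r) where
  carrier := {f | ∀ (i : Fin r) (x : Plane), HasFDerivAt (f i.castSucc) (curryPlane i (f i.succ x)) x}
  zero_mem' := fun i x => by
    have : curryPlane i ((0 : JetProd r) i.succ x) = 0 := map_zero _
    rw [this]
    exact hasFDerivAt_const _ _
  add_mem' := fun {a b} ha hb i x => by
    have : curryPlane i ((a + b) i.succ x) = curryPlane i (a i.succ x) + curryPlane i (b i.succ x) :=
      map_add _ _ _
    rw [this]
    exact (ha i x).add (hb i x)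
  smul_mem' := fun c f ha i x => by
    have : curryPlane i ((c • f) i.succ x) = c • curryPlane i (f i.succ x) :=
      (curryPlane i).map_smul c (f i.succ x)
    rw [this]
    exact (ha i x).const_smul c

/-- The Banach space of bounded `C^r` vector fields on the plane with bounded derivatives of order
at most `r`, represented by their jets. -/
def BJet (r : ℕ) : Type := jetSubmodule r

instance (r : ℕ) : NormedAddCommGroup (BJet r) := inferInstanceAs (NormedAddCommGroup (jetSubmodule r))

instance (r : ℕ) : NormedSpace ℝ (BJet r) := inferInstanceAs (NormedSpace ℝ (jetSubmodule r))

/-- A uniform limit of functions whose derivatives converge uniformly is differentiable, with the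
limit as its derivative. This gives the completeness of `BJet r` on which the implicit function
theorem depends. -/
theorem isClosed_jetSubmodule (r : ℕ) : IsClosed (jetSubmodule r : Set (JetProd r)) := by
  refine isClosed_of_closure_subset fun f hf => ?_
  obtain ⟨g, hg, hlim⟩ := mem_closure_iff_seq_limit.1 hf
  intro i x
  have h1 := fun j => tendsto_pi_nhds.1 hlim j
  refine hasFDerivAt_of_tendstoUniformly (l := atTop) (g := f i.castSucc)
    (g' := fun x => curryPlane i (f i.succ x))
    (f := fun n => g n i.castSucc)
    (f' := fun n x => curryPlane i (g n i.succ x)) ?_ (fun n x => hg n i x) ?_ x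
  · exact (curryPlane i).uniformContinuous.comp_tendstoUniformly
      (BoundedContinuousFunction.tendsto_iff_tendstoUniformly.1 (h1 i.succ))
  · intro y
    exact (BoundedContinuousFunction.tendsto_iff_tendstoUniformly.1
      (h1 i.castSucc)).tendsto_at y

instance (r : ℕ) : CompleteSpace (BJet r) :=
  (isClosed_jetSubmodule r).completeSpace_coe

namespace BJet

variable {r : ℕ}

theorem continuous_val : Continuous (fun f : BJet r => (f.1 : JetProd r)) :=
  continuous_subtype_val (p := fun f => f ∈ jetSubmodule r)

/-- The `i`-th derivative. -/
def coeff (i : ℕ) (hi : i ≤ r) (f : BJet r) (x : Plane) : JetCoeff i :=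
  f.1 ⟨i, Nat.lt_succ_of_le hi⟩ x

theorem norm_coeff_le (i : ℕ) (hi : i ≤ r) (f : BJet r) (x : Plane) : ‖f.coeff i hi x‖ ≤ ‖f‖ :=
  ((f.1 ⟨i, Nat.lt_succ_of_le hi⟩).norm_coe_le_norm x).trans (norm_le_pi_norm f.1 _)

/-- The evaluation of the `i`-th derivative at a point. -/
def coeffCLM (i : ℕ) (hi : i ≤ r) (x : Plane) : BJet r →L[ℝ] JetCoeff i :=
  LinearMap.mkContinuous
    { toFun := fun f => f.coeff i hi x
      map_add' := fun _ _ => rfl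
      map_smul' := fun _ _ => rfl } 1
    (fun f => by rw [one_mul]; exact norm_coeff_le i hi f x)

theorem hasFDerivAt_coeff (i : ℕ) (hi : i + 1 ≤ r) (f : BJet r) (x : Plane) :
    HasFDerivAt (f.coeff i (Nat.le_of_succ_le hi)) (curryPlane i (f.coeff (i + 1) hi x)) x :=
  f.2 ⟨i, hi⟩ x

theorem norm_coeff_sub_le (i : ℕ) (hi : i + 1 ≤ r) (f : BJet r) (x y : Plane) :
    ‖f.coeff i (Nat.le_of_succ_le hi) y - f.coeff i (Nat.le_of_succ_le hi) x‖ ≤ ‖f‖ * ‖y - x‖ :=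
  convex_univ.norm_image_sub_le_of_norm_hasFDerivWithin_le
    (fun z _ => (f.hasFDerivAt_coeff i hi z).hasFDerivWithinAt)
    (fun z _ => (norm_curryPlane i _).trans_le (f.norm_coeff_le (i + 1) hi z)) (mem_univ x) (mem_univ y)

theorem norm_coeff_sub_sub_le (i : ℕ) (hi : i + 2 ≤ r) (f : BJet r) (x y : Plane) :
    ‖f.coeff i (by omega) y - f.coeff i (by omega) x -
      curryPlane i (f.coeff (i + 1) (by omega) x) (y - x)‖ ≤ ‖f‖ * ‖y - x‖ * ‖y - x‖ := by
  refine (convex_segment x y).norm_image_sub_le_of_norm_hasFDerivWithin_le'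
    (fun z _ => (f.hasFDerivAt_coeff i (by omega) z).hasFDerivWithinAt) ?_
    (left_mem_segment ℝ _ _) (right_mem_segment ℝ _ _)
  intro z hz
  rw [← map_sub, norm_curryPlane]
  refine (f.norm_coeff_sub_le (i + 1) hi x z).trans ?_
  gcongr
  exact norm_sub_le_of_mem_segment hz

theorem continuous_coeffCLM (i : ℕ) (hi : i + 1 ≤ r) :
    Continuous (coeffCLM (r := r) i (Nat.le_of_succ_le hi)) := by
  refine (LipschitzWith.of_dist_le_mul (K := 1) fun y x => ?_).continuous
  rw [dist_eq_norm, dist_eq_norm, NNReal.coe_one, one_mul]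
  refine ContinuousLinearMap.opNorm_le_bound _ (norm_nonneg _) fun f => ?_
  rw [mul_comm]
  exact f.norm_coeff_sub_le i hi x y

/-- Regularity in the operator norm needs bounds uniform over the unit ball of `BJet r`, and these
cost one more derivative than regularity for a single field, whence `i + 1 + k ≤ r`. The derivative
in `x` is the evaluation of the next coefficient, with its arguments exchanged. -/
theorem contDiff_coeffCLM (k : ℕ) : ∀ (i : ℕ) (hi : i + 1 + k ≤ r),
    ContDiff ℝ k (coeffCLM (r := r) i (by omega)) := by
  induction k with
  | zero => exact fun i hi => contDiff_zero.2 (continuous_coeffCLM i hi)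
  | succ k ih =>
    intro i hi
    refine contDiff_succ_iff_hasFDerivAt.2
      ⟨fun x => (curryPlane i ∘L coeffCLM (r := r) (i + 1) (by omega) x).flip, ?_, ?_⟩
    · have hflip : ContDiff ℝ k
          (fun A : BJet r →L[ℝ] Plane →L[ℝ] JetCoeff i => A.flip) :=
        (IsLinearMap.with_bound ⟨fun _ _ => rfl, fun _ _ => rfl⟩ 1
          fun A => by rw [one_mul, ContinuousLinearMap.opNorm_flip]).contDiff
      exact hflip.comp (contDiff_const.clm_comp (ih (i + 1) (by omega)))
    · intro x
      rw [hasFDerivAt_iff_isLittleO]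
      have hO : (fun y => coeffCLM (r := r) i (by omega) y - coeffCLM i (by omega) x -
          (curryPlane i ∘L coeffCLM (r := r) (i + 1) (by omega) x).flip (y - x)) =O[𝓝 x]
          fun y => ‖y - x‖ * ‖y - x‖ := by
        refine Asymptotics.IsBigO.of_bound 1 (Eventually.of_forall fun y => ?_)
        refine ContinuousLinearMap.opNorm_le_bound _ (by positivity) fun f => ?_
        refine (f.norm_coeff_sub_sub_le i (by omega) x y).trans (le_of_eq ?_)
        rw [Real.norm_of_nonneg (by positivity)]
        ring
      refine hO.trans_isLittleO ?_
      have h1 : Tendsto (fun y : Plane => ‖y - x‖) (𝓝 x) (𝓝 0) := by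
        have : Continuous fun y : Plane => ‖y - x‖ := by fun_prop
        simpa using this.tendsto x
      have := ((Asymptotics.isLittleO_one_iff ℝ).2 h1).mul_isBigO
        (Asymptotics.isBigO_refl (fun y : Plane => ‖y - x‖) (𝓝 x))
      simpa using this

/-- Joint evaluation loses no derivative. The weaker regularity of the evaluation functionals in
operator norm enters only through the partial derivative in the field, where one order less is
required. -/
theorem contDiff_coeff (k : ℕ) : ∀ (i : ℕ) (hi : i + k ≤ r),
    ContDiff ℝ k (fun w : BJet r × Plane => w.1.coeff i (by omega) w.2) := by
  induction k with
  | zero =>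
    intro i hi
    refine contDiff_zero.2 ?_
    have h1 : Continuous fun w : BJet r × Plane => w.1.1 ⟨i, Nat.lt_succ_of_le hi⟩ :=
      (continuous_apply _).comp (continuous_val.comp continuous_fst)
    exact h1.eval continuous_snd
  | succ k ih =>
    intro i hi
    refine contDiff_succ_iff_hasFDerivAt.2
      ⟨fun w => coeffCLM i (by omega) w.2 ∘L .fst ℝ (BJet r) Plane +
        curryPlane i (w.1.coeff (i + 1) (by omega) w.2) ∘L .snd ℝ (BJet r) Plane, ?_, ?_⟩
    · refine ContDiff.add ?_ ?_
      · exact ((contDiff_coeffCLM k i (by omega)).comp contDiff_snd).clm_comp contDiff_const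
      · exact ((curryPlane i).contDiff.comp (ih (i + 1) (by omega))).clm_comp contDiff_const
    · rintro ⟨f, x⟩
      have h2 : HasFDerivAt (fun w : BJet r × Plane => f.coeff i (by omega) w.2)
          (curryPlane i (f.coeff (i + 1) (by omega) x) ∘L .snd ℝ (BJet r) Plane) (f, x) :=
        (f.hasFDerivAt_coeff i (by omega) x).comp (f, x)
          (hasFDerivAt_snd (𝕜 := ℝ) (E := BJet r) (F := Plane) (p := (f, x)))
      have h3 : HasFDerivAt (fun w : BJet r × Plane => w.1.coeff i (by omega) x)
          (coeffCLM i (by omega) x ∘L .fst ℝ (BJet r) Plane) (f, x) :=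
        (coeffCLM (r := r) i (by omega) x).hasFDerivAt.comp (f, x)
          (hasFDerivAt_fst (𝕜 := ℝ) (E := BJet r) (F := Plane) (p := (f, x)))
      -- Evaluation is linear in the field but not jointly linear. The mixed remainder is bounded by
      -- the product of the two increments, hence is quadratic and has zero derivative.
      have h4 : HasFDerivAt (fun w : BJet r × Plane =>
          (w.1 - f).coeff i (by omega) w.2 - (w.1 - f).coeff i (by omega) x)
          (0 : BJet r × Plane →L[ℝ] JetCoeff i) (f, x) := by
        refine Asymptotics.IsBigO.hasFDerivAt (n := 2) ?_ one_lt_two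
        refine Asymptotics.IsBigO.of_bound 1 (Eventually.of_forall fun w => ?_)
        refine ((w.1 - f).norm_coeff_sub_le i (by omega) x w.2).trans ?_
        rw [norm_pow, norm_norm, one_mul, sq]
        exact mul_le_mul (norm_fst_le (w - (f, x))) (norm_snd_le (w - (f, x))) (norm_nonneg _)
          (norm_nonneg _)
      have h5 := ((h3.add h2).add h4).sub_const (f.coeff i (by omega) x)
      rw [add_zero] at h5
      refine h5.congr_of_eventuallyEq (Eventually.of_forall fun w => ?_)
      have hs : ∀ y, (w.1 - f).coeff i (by omega) y = w.1.coeff i (by omega) y -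
        f.coeff i (by omega) y := fun _ => rfl
      simp only [Pi.add_apply, hs]
      abel

/-- The vector field given by a jet. -/
def field (f : BJet r) (x : Plane) : Plane :=
  uncurryPlane (f.coeff 0 (Nat.zero_le r) x)

theorem contDiff_field : ContDiff ℝ r (fun w : BJet r × Plane => w.1.field w.2) :=
  uncurryPlane.contDiff.comp (contDiff_coeff r 0 (by omega))

theorem contDiff_field_right (f : BJet r) : ContDiff ℝ r f.field :=
  contDiff_field.comp (contDiff_const.prodMk contDiff_id)

theorem norm_field_sub_le (hr : 1 ≤ r) (f : BJet r) (x y : Plane) :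
    ‖f.field x - f.field y‖ ≤ ‖f‖ * ‖x - y‖ := by
  rw [field, field, ← map_sub, norm_uncurryPlane]
  exact f.norm_coeff_sub_le 0 hr y x

/-- Evaluation of the vector field at a point. -/
def fieldCLM (x : Plane) : BJet r →L[ℝ] Plane :=
  uncurryPlane ∘L coeffCLM 0 (Nat.zero_le r) x

theorem fieldCLM_apply (x : Plane) (f : BJet r) : fieldCLM x f = f.field x := rfl

theorem fderiv_field (hr : 1 ≤ r) (f g : BJet r) (x h : Plane) :
    fderiv ℝ (fun w : BJet r × Plane => w.1.field w.2) (f, x) (g, h) =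
      g.field x + fderiv ℝ f.field x h := by
  have hr' : (r : WithTop ℕ∞) ≠ 0 := by exact_mod_cast (by omega : r ≠ 0)
  have hd := ((contDiff_field (r := r)).differentiable hr' (f, x)).hasFDerivAt
  have h1 : HasFDerivAt (fun g : BJet r => g.field x)
      (fderiv ℝ (fun w : BJet r × Plane => w.1.field w.2) (f, x) ∘L .inl ℝ _ _) f :=
    HasFDerivAt.comp (g := fun w : BJet r × Plane => w.1.field w.2) f hd
      (hasFDerivAt_prodMk_left (𝕜 := ℝ) f x)
  have h2 : HasFDerivAt f.field
      (fderiv ℝ (fun w : BJet r × Plane => w.1.field w.2) (f, x) ∘L .inr ℝ _ _) x :=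
    HasFDerivAt.comp (g := fun w : BJet r × Plane => w.1.field w.2) x hd
      (hasFDerivAt_prodMk_right (𝕜 := ℝ) f x)
  have h3 : HasFDerivAt (fun g : BJet r => g.field x) (fieldCLM x) f := (fieldCLM x).hasFDerivAt
  have h4 : (g, h) = ContinuousLinearMap.inl ℝ (BJet r) Plane g + ContinuousLinearMap.inr ℝ _ _ h := by
    simp
  rw [h4, map_add, h2.fderiv, ← fieldCLM_apply, ← h1.unique h3]
  rfl

end BJet


/-! ### The flow of a bounded `C^r` vector field, as a function of the field -/

section Flow

open unitInterval

/-- Translates an integral equation in rescaled time `s ∈ [0, 1]` into a derivative at the real time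
`T s`. It is used with `T = 2 t` and `s = 1 / 2`, which puts `t` in the interior. -/
theorem hasDerivAt_of_volterraInt {E : Type*} [NormedAddCommGroup E] [NormedSpace ℝ E]
    [CompleteSpace E] {W : ℝ → E}
    {T : ℝ} (hT : T ≠ 0) {G : C(I, E)} {c : E} (hW : ∀ s : I, W (T * s) = c + volterraInt G s)
    {s : ℝ} (hs : s ∈ Ioo (0 : ℝ) 1) :
    HasDerivAt W (T⁻¹ • G ⟨s, Ioo_subset_Icc_self hs⟩) (T * s) := by
  have hG : Continuous (IccExtend zero_le_one G : ℝ → E) := G.continuous.Icc_extend'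
  have h1 : HasDerivAt (fun u => c + ∫ x in (0 : ℝ)..u, IccExtend zero_le_one G x)
      (IccExtend zero_le_one G s) s :=
    ((hG.integral_hasStrictDerivAt 0 s).hasDerivAt).const_add c
  rw [IccExtend_of_mem _ _ (Ioo_subset_Icc_self hs)] at h1
  have h2 : HasDerivAt (fun t : ℝ => T⁻¹ * t) T⁻¹ (T * s) := by
    simpa using (hasDerivAt_id (T * s)).const_mul T⁻¹
  have hTs : T⁻¹ * (T * s) = s := by field_simp
  have h3 := HasDerivAt.scomp_of_eq (T * s) h1 h2 hTs.symm
  refine h3.congr_of_eventuallyEq ?_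
  have hcont : Continuous fun t : ℝ => T⁻¹ * t := by fun_prop
  have hmem : Ioo (0 : ℝ) 1 ∈ 𝓝 (T⁻¹ * (T * s)) := by
    rw [hTs]
    exact Ioo_mem_nhds hs.1 hs.2
  filter_upwards [hcont.continuousAt.preimage_mem_nhds hmem] with t ht
  have := hW ⟨T⁻¹ * t, Ioo_subset_Icc_self ht⟩
  rw [← mul_assoc, mul_inv_cancel₀ hT, one_mul] at this
  exact this

variable {r : ℕ}

/-- The right-hand side of the equation solved by the rescaled and recentred solutions. -/
def flowRHS (r : ℕ) : C((BJet r × ℝ × Plane) × Plane, Plane) :=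
  ⟨fun w => w.1.2.1 • w.1.1.field (w.1.2.2 + w.2), by
    have h : Continuous fun w : (BJet r × ℝ × Plane) × Plane => w.1.1.field (w.1.2.2 + w.2) :=
      (BJet.contDiff_field (r := r)).continuous.comp (by fun_prop : Continuous
        fun w : (BJet r × ℝ × Plane) × Plane => (w.1.1, w.1.2.2 + w.2))
    exact (by fun_prop : Continuous fun w : (BJet r × ℝ × Plane) × Plane => w.1.2.1).smul h⟩

theorem flowRHS_apply (w : (BJet r × ℝ × Plane) × Plane) :
    flowRHS r w = w.1.2.1 • w.1.1.field (w.1.2.2 + w.2) := rfl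

theorem contDiff_flowRHS : ContDiff ℝ r (flowRHS r) := by
  have h : ContDiff ℝ r fun w : (BJet r × ℝ × Plane) × Plane => w.1.1.field (w.1.2.2 + w.2) :=
    (BJet.contDiff_field (r := r)).comp (by fun_prop : ContDiff ℝ r
      fun w : (BJet r × ℝ × Plane) × Plane => (w.1.1, w.1.2.2 + w.2))
  exact (by fun_prop : ContDiff ℝ r fun w : (BJet r × ℝ × Plane) × Plane => w.1.2.1).smul h

/-- `Φ (X, t, z)` is the flow of the field `X`, it is jointly `C^r`, and its derivative with respect to
`X` solves the linearized equation. -/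
structure IsSmoothFlow (Φ : BJet r × ℝ × Plane → Plane) : Prop where
  contDiff : ContDiff ℝ r Φ
  zero : ∀ X z, Φ (X, 0, z) = z
  hasDerivAt : ∀ X t z, HasDerivAt (fun t => Φ (X, t, z)) (X.field (Φ (X, t, z))) t
  hasDerivAt_fderiv : ∀ X V z t, 0 < t → HasDerivAt (fun t => fderiv ℝ Φ (X, t, z) (V, 0, 0))
    (V.field (Φ (X, t, z)) + fderiv ℝ X.field (Φ (X, t, z)) (fderiv ℝ Φ (X, t, z) (V, 0, 0))) t

theorem fderiv_flowRHS (hr : 1 ≤ r) (X V : BJet r) (t : ℝ) (z y h : Plane) :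
    fderiv ℝ (flowRHS r) ((X, t, z), y) ((V, 0, 0), h) =
      t • (V.field (z + y) + fderiv ℝ X.field (z + y) h) := by
  have hr' : (r : WithTop ℕ∞) ≠ 0 := by exact_mod_cast (by omega : r ≠ 0)
  have h1 : HasFDerivAt (fun w : BJet r × Plane => w.1.field w.2)
      (fderiv ℝ (fun w : BJet r × Plane => w.1.field w.2) (X, z + y)) (X, z + y) :=
    ((BJet.contDiff_field (r := r)).differentiable hr' _).hasFDerivAt
  have h2 : HasFDerivAt (fun w : BJet r × Plane => ((w.1, t, z), w.2))
      ((ContinuousLinearMap.fst ℝ (BJet r) Plane).prod 0 |>.prod (.snd ℝ (BJet r) Plane)) (X, y) :=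
    (hasFDerivAt_fst.prodMk (hasFDerivAt_const (t, z) (X, y))).prodMk hasFDerivAt_snd
  have h3 : HasFDerivAt (fun w : BJet r × Plane => flowRHS r ((w.1, t, z), w.2))
      (fderiv ℝ (flowRHS r) ((X, t, z), y) ∘L
        ((ContinuousLinearMap.fst ℝ (BJet r) Plane).prod 0 |>.prod (.snd ℝ (BJet r) Plane))) (X, y) :=
    HasFDerivAt.comp (g := flowRHS r) (X, y)
      ((contDiff_flowRHS.differentiable hr' _).hasFDerivAt) h2
  have h4 : HasFDerivAt (fun w : BJet r × Plane => (w.1, z + w.2))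
      ((ContinuousLinearMap.fst ℝ (BJet r) Plane).prod (.snd ℝ (BJet r) Plane)) (X, y) :=
    hasFDerivAt_fst.prodMk (hasFDerivAt_snd.const_add z)
  have h5 : HasFDerivAt (fun w : BJet r × Plane => flowRHS r ((w.1, t, z), w.2))
      (t • (fderiv ℝ (fun w : BJet r × Plane => w.1.field w.2) (X, z + y) ∘L
        ((ContinuousLinearMap.fst ℝ (BJet r) Plane).prod (.snd ℝ (BJet r) Plane)))) (X, y) :=
    (HasFDerivAt.comp (g := fun w : BJet r × Plane => w.1.field w.2) (X, y) h1 h4).const_smul t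
  have h6 := congrArg (fun A : BJet r × Plane →L[ℝ] Plane => A (V, h)) (h3.unique h5)
  rw [← BJet.fderiv_field hr]
  exact h6

/-- Rescaling time to `[0, 1]` turns the final time into a parameter: `y' = τ X(z + y)`, `y(0) = 0`,
with parameter `(X, τ, z)`. The flow is `z` plus the value of the solution at `1`, so joint
smoothness follows from smooth dependence on parameters. -/
theorem exists_isSmoothFlow (hr : 1 ≤ r) :
    ∃ Φ : BJet r × ℝ × Plane → Plane, IsSmoothFlow Φ := by
  have hr0 : r ≠ 0 := by omega
  have hr' : (r : WithTop ℕ∞) ≠ 0 := by exact_mod_cast hr0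
  obtain ⟨Y, hYc, hY⟩ := exists_contDiff_volterra hr0 (flowRHS r) contDiff_flowRHS
    (k := fun b => |b.2.1| * ‖b.1‖) (fun b => by positivity) (by
      rintro ⟨X, τ, z⟩ x y
      rw [flowRHS_apply, flowRHS_apply, ← smul_sub, norm_smul, Real.norm_eq_abs, mul_assoc]
      gcongr
      simpa using X.norm_field_sub_le hr (z + x) (z + y))
  have hYeq : ∀ b, Y b = volterraInt ((flowRHS r).comp (constPair (b, Y b))) := fun b =>
    (hY b (Y b)).2 rfl
  -- Running for the time `τ s` is the same as stopping the run of length `τ` at the fraction `s`.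
  -- Uniqueness for the Volterra equation proves it, and it lets derivatives along the path be read
  -- as derivatives in the time parameter.
  have hscale : ∀ X τ z (s : I), Y (X, τ * s, z) 1 = Y (X, τ, z) s := by
    intro X τ z s
    set w : C(I, Plane) := ⟨fun s' => Y (X, τ, z) (s * s'), by fun_prop⟩ with hw
    have : w = Y (X, τ * s, z) := by
      refine (hY _ _).1 ?_
      ext1 s'
      have h1 : w s' = Y (X, τ, z) (s * s') := rfl
      rw [h1, hYeq, volterraInt_apply, volterraInt_apply]
      have h2 := intervalIntegral.smul_integral_comp_mul_left (a := 0) (b := (s' : ℝ))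
        (IccExtend zero_le_one ((flowRHS r).comp (constPair ((X, τ, z), Y (X, τ, z))))) (s : ℝ)
      rw [mul_zero] at h2
      rw [Set.Icc.coe_mul, ← h2, ← intervalIntegral.integral_smul]
      refine intervalIntegral.integral_congr fun u hu => ?_
      rw [uIcc_of_le s'.2.1] at hu
      have hu1 : u ∈ Icc (0 : ℝ) 1 := ⟨hu.1, hu.2.trans s'.2.2⟩
      have hu2 : (s : ℝ) * u ∈ Icc (0 : ℝ) 1 := (s * ⟨u, hu1⟩ : I).2
      rw [IccExtend_of_mem _ _ hu1, IccExtend_of_mem _ _ hu2]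
      change (s : ℝ) • (τ • X.field (z + Y (X, τ, z) ⟨s * u, hu2⟩)) =
        (τ * s) • X.field (z + Y (X, τ, z) (s * ⟨u, hu1⟩))
      rw [smul_smul, mul_comm]
      rfl
    rw [← this]
    change Y (X, τ, z) (s * 1) = _
    rw [mul_one]
  have hΦc : ContDiff ℝ r (fun w : BJet r × ℝ × Plane => w.2.2 + Y w 1) :=
    (by fun_prop : ContDiff ℝ r fun w : BJet r × ℝ × Plane => w.2.2).add
      ((ContinuousMap.evalCLM ℝ (1 : I) (M := Plane)).contDiff.comp hYc)
  refine ⟨fun w => w.2.2 + Y w 1, hΦc, ?_, ?_, ?_⟩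
  · intro X z
    have := hscale X 0 z 0
    have h2 : Y (X, 0, z) 0 = 0 := by
      rw [hYeq, volterraInt_apply]
      simp
    rw [zero_mul, h2] at this
    simp [this]
  · intro X t z
    -- The rescaling degenerates at `t = 0`. The derivative there is obtained as the limit of those
    -- at `t ≠ 0`, by continuity.
    refine hasDerivAt_of_hasDerivAt_of_ne' (x := 0) (f := fun t => z + Y (X, t, z) 1)
      (g := fun t => X.field (z + Y (X, t, z) 1)) ?_ ?_ ?_ t
    · intro t ht
      have h1 := hasDerivAt_of_volterraInt (T := 2 * t) (by simpa using ht)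
        (W := fun t => z + Y (X, t, z) 1) (c := z)
        (G := (flowRHS r).comp (constPair ((X, 2 * t, z), Y (X, 2 * t, z))))
        (by
          intro s
          rw [hscale, ← hYeq]) (s := 1 / 2) (by norm_num)
      have h2 : (2 * t) * (1 / 2) = t := by ring
      rw [h2] at h1
      refine h1.congr_deriv ?_
      change (2 * t)⁻¹ • ((2 * t) • X.field (z + Y (X, 2 * t, z) _)) = _
      rw [smul_smul, inv_mul_cancel₀ (by simpa using ht), one_smul, ← hscale, h2]
    · exact (hΦc.continuous.comp (by fun_prop : Continuous fun t : ℝ => (X, t, z))).continuousAt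
    · exact (X.contDiff_field_right.continuous.comp
        (hΦc.continuous.comp (by fun_prop : Continuous fun t : ℝ => (X, t, z)))).continuousAt
  · intro X V z t ht
    have hd : ∀ t, fderiv ℝ (fun w : BJet r × ℝ × Plane => w.2.2 + Y w 1) (X, t, z) (V, 0, 0) =
        fderiv ℝ Y (X, t, z) (V, 0, 0) 1 := by
      intro t
      have h1 : HasFDerivAt (fun w : BJet r × ℝ × Plane => w.2.2 + Y w 1)
          ((ContinuousLinearMap.snd ℝ ℝ Plane) ∘L (.snd ℝ (BJet r) (ℝ × Plane)) +
            ContinuousMap.evalCLM ℝ (1 : I) ∘L fderiv ℝ Y (X, t, z)) (X, t, z) := by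
        refine HasFDerivAt.add ?_ ?_
        · exact ((ContinuousLinearMap.snd ℝ ℝ Plane) ∘L (.snd ℝ (BJet r) (ℝ × Plane))).hasFDerivAt
        · exact (ContinuousMap.evalCLM ℝ (1 : I) (M := Plane)).hasFDerivAt.comp (X, t, z)
            (hYc.differentiable hr' _).hasFDerivAt
      rw [h1.fderiv]
      simp
    -- The scaling identity differentiated with respect to the field, at fixed time and initial
    -- point.
    have hd2 : ∀ t (s : I), fderiv ℝ Y (X, t * s, z) (V, 0, 0) 1 =
        fderiv ℝ Y (X, t, z) (V, 0, 0) s := by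
      intro t s
      have key : ∀ (τ : ℝ) (s : I), HasFDerivAt (fun X' : BJet r => Y (X', τ, z) s)
          (ContinuousMap.evalCLM ℝ s ∘L fderiv ℝ Y (X, τ, z) ∘L
            (.inl ℝ (BJet r) (ℝ × Plane))) X := by
        intro τ s
        have h1 : HasFDerivAt (fun X' : BJet r => Y (X', τ, z)) (fderiv ℝ Y (X, τ, z) ∘L
            (.inl ℝ (BJet r) (ℝ × Plane))) X :=
          HasFDerivAt.comp (g := Y) X (hYc.differentiable hr' _).hasFDerivAt
            (hasFDerivAt_prodMk_left (𝕜 := ℝ) X (τ, z))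
        exact (ContinuousMap.evalCLM ℝ s (M := Plane)).hasFDerivAt.comp X h1
      have h3 := key (t * s) 1
      have h4 := key t s
      simp only [hscale] at h3
      exact congrArg (fun A : BJet r →L[ℝ] Plane => A V) (h3.unique h4)
    simp only [hd]
    set ξ := fderiv ℝ Y (X, 2 * t, z) (V, 0, 0) with hξ
    have hcontD : Continuous (fderiv ℝ (flowRHS r)) := contDiff_flowRHS.continuous_fderiv hr'
    set G : C(I, Plane) := ContinuousMap.clmApply
      ((⟨fderiv ℝ (flowRHS r), hcontD⟩ : C((BJet r × ℝ × Plane) × Plane, _)).comp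
        (constPair ((X, 2 * t, z), Y (X, 2 * t, z)))) (constPair ((V, 0, 0), ξ)) with hG
    have h1 := hasDerivAt_of_volterraInt (T := 2 * t) (by positivity)
      (W := fun t => fderiv ℝ Y (X, t, z) (V, 0, 0) 1) (c := 0) (G := G)
      (by
        intro s
        rw [hd2, zero_add]
        exact fderiv_volterra_solution hr0 (flowRHS r) contDiff_flowRHS hYc hYeq _ _ s)
      (s := 1 / 2) (by norm_num)
    have h2 : (2 * t) * (1 / 2) = t := by ring
    rw [h2] at h1
    refine h1.congr_deriv ?_
    change (2 * t)⁻¹ • fderiv ℝ (flowRHS r) ((X, 2 * t, z), Y (X, 2 * t, z) _) ((V, 0, 0), ξ _) = _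
    rw [fderiv_flowRHS hr, smul_smul, inv_mul_cancel₀ (by positivity), one_smul, ← hscale, hξ, ← hd2]
    simp only [h2]

namespace IsSmoothFlow

variable {Φ : BJet r × ℝ × Plane → Plane}

theorem eq_of_isIntegralCurveOn (hr : 1 ≤ r) (hΦ : IsSmoothFlow Φ) (X : BJet r) {φ : ℝ → Plane}
    {T : ℝ} (hφ : IsIntegralCurveOn φ (fun _ => X.field) (Icc 0 T)) {t : ℝ} (ht : t ∈ Icc 0 T) :
    φ t = Φ (X, t, φ 0) := by
  have hlip : LipschitzWith ‖X‖₊ X.field := LipschitzWith.of_dist_le_mul fun x y => by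
    rw [dist_eq_norm, dist_eq_norm]
    exact X.norm_field_sub_le hr x y
  refine ODE_solution_unique (v := fun _ => X.field) (K := ‖X‖₊) (a := 0) (b := T)
    (g := fun t => Φ (X, t, φ 0)) (fun _ => hlip) hφ.continuousOn ?_ ?_ ?_ ?_ ht
  · intro s hs
    exact (hφ s (Ico_subset_Icc_self hs)).mono_of_mem_nhdsWithin
      (mem_of_superset (Icc_mem_nhdsGE hs.2) (Icc_subset_Icc_left hs.1))
  · exact fun s _ => (hΦ.hasDerivAt X s (φ 0)).continuousAt.continuousWithinAt
  · exact fun s _ => (hΦ.hasDerivAt X s (φ 0)).hasDerivWithinAt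
  · exact (hΦ.zero X (φ 0)).symm

theorem add (hr : 1 ≤ r) (hΦ : IsSmoothFlow Φ) (X : BJet r) (s t : ℝ) (z : Plane) :
    Φ (X, t + s, z) = Φ (X, t, Φ (X, s, z)) := by
  have hlip : LipschitzWith ‖X‖₊ X.field := LipschitzWith.of_dist_le_mul fun x y => by
    rw [dist_eq_norm, dist_eq_norm]
    exact X.norm_field_sub_le hr x y
  refine congrFun (ODE_solution_unique_univ (v := fun _ => X.field) (K := ‖X‖₊) (s := fun _ => univ)
    (f := fun t => Φ (X, t + s, z)) (g := fun t => Φ (X, t, Φ (X, s, z))) (t₀ := 0)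
    (fun _ => hlip.lipschitzOnWith)
    (fun t => ⟨?_, mem_univ _⟩) (fun t => ⟨hΦ.hasDerivAt X t _, mem_univ _⟩) ?_) t
  · exact (hΦ.hasDerivAt X (t + s) z).comp_add_const t s
  · simp [hΦ.zero]

end IsSmoothFlow

end Flow


/-! ### Cutting off vector fields -/

section Cutoff

open scoped Manifold ContDiff BoundedContinuousFunction

/-- A smooth function with compact support in `U`. -/
structure Cutoff (U : Opens Plane) where
  /-- the underlying function -/
  toFun : Plane → ℝ
  contDiff : ContDiff ℝ ∞ toFun
  hasCompactSupport : HasCompactSupport toFun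
  tsupport_subset : tsupport toFun ⊆ U

theorem exists_cutoff {U : Opens Plane} {K : Set Plane} (hK : IsCompact K) (hKU : K ⊆ U) :
    ∃ (c : Cutoff U) (O : Set Plane), IsOpen O ∧ K ⊆ O ∧ O ⊆ U ∧ ∀ z ∈ O, c.toFun z = 1 := by
  obtain ⟨L, hL, hKL, hLU⟩ := exists_compact_between hK U.isOpen hKU
  obtain ⟨f, hf1, hf0, -⟩ := exists_contMDiffMap_one_nhds_of_subset_interior (M := Plane)
    𝓘(ℝ, Plane) hK.isClosed hKL (n := ⊤)
  have hts : tsupport f ⊆ L := closure_minimal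
    (fun x hx => by_contra fun h => hx (hf0 x h)) hL.isClosed
  obtain ⟨O, hO, hKO, hO1⟩ := mem_nhdsSet_iff_exists.1 hf1
  refine ⟨⟨f, f.contMDiff.contDiff, hL.of_isClosed_subset (isClosed_tsupport _) hts,
    hts.trans hLU⟩, O ∩ U, hO.inter U.isOpen, subset_inter hKO hKU, inter_subset_right,
    fun z hz => hO1 hz.1⟩

variable {r : ℕ} {U : Opens Plane}

namespace CrField

/-- The `i`-th derivative of `X` on `K`, with values in the normed space `JetCoeff i`. -/
def jetC (κ : JetIndex r U) : CrField r U →ₗ[ℝ] C((κ.1.1 : Set Plane), JetCoeff κ.2) where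
  toFun X := ⟨fun z => (iteratedFDeriv ℝ κ.2 (X : Plane → Plane) z : JetCoeff κ.2),
    (CrField.jet κ X).continuous⟩
  map_add' X Y := (CrField.jet κ).map_add X Y
  map_smul' a X := (CrField.jet κ).map_smul a X

theorem continuous_jetC (κ : JetIndex r U) : Continuous (jetC κ) := by
  have h : Continuous (CrField.jet κ) := continuous_iInf_dom continuous_induced_dom
  exact h

/-- The seminorm `sup_K ‖D^i X‖`. -/
def jetNorm (κ : JetIndex r U) (X : CrField r U) : ℝ := ‖jetC κ X‖

theorem jetNorm_nonneg (κ : JetIndex r U) (X : CrField r U) : 0 ≤ jetNorm κ X := norm_nonneg _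

theorem jetNorm_zero (κ : JetIndex r U) : jetNorm κ (0 : CrField r U) = 0 := by
  rw [jetNorm, map_zero, norm_zero]

theorem norm_iteratedFDeriv_le_jetNorm (κ : JetIndex r U) (X : CrField r U) {z : Plane}
    (hz : z ∈ (κ.1.1 : Set Plane)) : ‖iteratedFDeriv ℝ κ.2 (X : Plane → Plane) z‖ ≤ jetNorm κ X :=
  (jetC κ X).norm_coe_le_norm ⟨z, hz⟩

theorem continuous_jetNorm (κ : JetIndex r U) : Continuous (jetNorm κ) := (continuous_jetC κ).norm

end CrField

namespace Cutoff

/-- The product of a vector field on `U` and a cutoff function. -/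
def mulField (c : Cutoff U) (X : CrField r U) (z : Plane) : Plane := c.toFun z • X z

theorem mulField_eq_zero (c : Cutoff U) (X : CrField r U) {z : Plane} (hz : z ∉ tsupport c.toFun) :
    c.mulField X z = 0 := by
  rw [mulField, image_eq_zero_of_notMem_tsupport hz, zero_smul]

theorem hasCompactSupport_mulField (c : Cutoff U) (X : CrField r U) :
    HasCompactSupport (c.mulField X) :=
  HasCompactSupport.intro c.hasCompactSupport fun _ hz => c.mulField_eq_zero X hz

theorem contDiffOn (c : Cutoff U) (s : Set Plane) : ContDiffOn ℝ r c.toFun s :=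
  (c.contDiff.of_le (by exact_mod_cast le_top)).contDiffOn

theorem contDiff_mulField (c : Cutoff U) (X : CrField r U) : ContDiff ℝ r (c.mulField X) := by
  rw [contDiff_iff_contDiffAt]
  intro z
  by_cases hz : z ∈ U
  · exact ((c.contDiffOn U).smul X.2.1).contDiffAt (U.isOpen.mem_nhds hz)
  · have hz' : z ∉ tsupport c.toFun := fun h => hz (c.tsupport_subset h)
    refine (contDiffAt_const (c := (0 : Plane))).congr_of_eventuallyEq ?_
    filter_upwards [(isClosed_tsupport c.toFun).isOpen_compl.mem_nhds hz'] with w hw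
    exact c.mulField_eq_zero X hw

/-- The `i`-th derivative of the cut off field, as a bounded continuous map. -/
def coeffBCF (c : Cutoff U) (X : CrField r U) (i : Fin (r + 1)) : Plane →ᵇ JetCoeff i :=
  BoundedContinuousFunction.ofNormedAddCommGroup
    (fun z => (iteratedFDeriv ℝ i (c.mulField X) z : JetCoeff i))
    ((c.contDiff_mulField X).continuous_iteratedFDeriv (by exact_mod_cast Nat.lt_succ_iff.1 i.2))
    (Classical.choose (((c.hasCompactSupport_mulField X).iteratedFDeriv
      (𝕜 := ℝ) i).exists_bound_of_continuous
      ((c.contDiff_mulField X).continuous_iteratedFDeriv (by exact_mod_cast Nat.lt_succ_iff.1 i.2))))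
    (Classical.choose_spec (((c.hasCompactSupport_mulField X).iteratedFDeriv
      (𝕜 := ℝ) i).exists_bound_of_continuous
      ((c.contDiff_mulField X).continuous_iteratedFDeriv (by exact_mod_cast Nat.lt_succ_iff.1 i.2))))

theorem coeffBCF_mem (c : Cutoff U) (X : CrField r U) :
    (c.coeffBCF X : JetProd r) ∈ jetSubmodule r := by
  intro i x
  have h1 := ((c.contDiff_mulField X).differentiable_iteratedFDeriv (m := i)
    (by exact_mod_cast i.2) x).hasFDerivAt
  have h2 : curryPlane i (c.coeffBCF X i.succ x) =
      fderiv ℝ (iteratedFDeriv ℝ i (c.mulField X)) x := by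
    change (continuousMultilinearCurryLeftEquiv ℝ (fun _ : Fin ((i : ℕ) + 1) => Plane) Plane)
      (iteratedFDeriv ℝ ((i : ℕ) + 1) (c.mulField X) x) = _
    rw [iteratedFDeriv_succ_eq_comp_left]
    exact LinearIsometryEquiv.apply_symm_apply _ _
  rw [h2]
  exact h1

theorem mulField_add (c : Cutoff U) (X Y : CrField r U) :
    c.mulField (X + Y) = c.mulField X + c.mulField Y := by
  funext z
  exact smul_add (c.toFun z) (X z) (Y z)

theorem mulField_smul (c : Cutoff U) (a : ℝ) (X : CrField r U) :
    c.mulField (a • X) = a • c.mulField X := by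
  funext z
  exact smul_comm (c.toFun z) a (X z)

/-- The jet of the cut off field. -/
def jetLM (c : Cutoff U) : CrField r U →ₗ[ℝ] BJet r where
  toFun X := ⟨c.coeffBCF X, c.coeffBCF_mem X⟩
  map_add' X Y := by
    refine Subtype.ext (funext fun i => BoundedContinuousFunction.ext fun z => ?_)
    change iteratedFDeriv ℝ i (c.mulField (X + Y)) z = iteratedFDeriv ℝ i (c.mulField X) z +
      iteratedFDeriv ℝ i (c.mulField Y) z
    rw [mulField_add]
    have hi : ((i : ℕ) : WithTop ℕ∞) ≤ r := by exact_mod_cast Nat.lt_succ_iff.1 i.2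
    exact iteratedFDeriv_add_apply ((c.contDiff_mulField X).of_le hi).contDiffAt
      ((c.contDiff_mulField Y).of_le hi).contDiffAt
  map_smul' a X := by
    refine Subtype.ext (funext fun i => BoundedContinuousFunction.ext fun z => ?_)
    change iteratedFDeriv ℝ i (c.mulField (a • X)) z = a • iteratedFDeriv ℝ i (c.mulField X) z
    rw [mulField_smul]
    have hi : ((i : ℕ) : WithTop ℕ∞) ≤ r := by exact_mod_cast Nat.lt_succ_iff.1 i.2
    exact iteratedFDeriv_const_smul_apply ((c.contDiff_mulField X).of_le hi).contDiffAt

/-- The support of a cutoff function. -/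
def support (c : Cutoff U) : {K : Compacts Plane // (K : Set Plane) ⊆ U} :=
  ⟨⟨tsupport c.toFun, c.hasCompactSupport⟩, c.tsupport_subset⟩

/-- By the Leibniz formula the jet of the product is controlled by finitely many of the seminorms
defining the `C^r`-topology, all on the compact support of the cutoff. This makes the passage to the
Banach space continuous. -/
theorem exists_norm_jetLM_le (c : Cutoff U) (r : ℕ) : ∃ C : ℝ, ∀ X : CrField r U,
    ‖c.jetLM X‖ ≤ C * ∑ k : Fin (r + 1), CrField.jetNorm (c.support, k) X := by
  have hb : ∀ j : ℕ, ∃ B, ∀ z, ‖iteratedFDeriv ℝ j c.toFun z‖ ≤ B := fun j =>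
    (c.hasCompactSupport.iteratedFDeriv (𝕜 := ℝ) j).exists_bound_of_continuous
      (c.contDiff.continuous_iteratedFDeriv (by exact_mod_cast le_top))
  choose B hB using hb
  have hB0 : ∀ j, 0 ≤ B j := fun j => (norm_nonneg _).trans (hB j 0)
  set S := ∑ j ∈ Finset.range (r + 1), B j with hS
  have hS0 : 0 ≤ S := Finset.sum_nonneg fun j _ => hB0 j
  refine ⟨2 ^ r * S, fun X => ?_⟩
  set A := ∑ k : Fin (r + 1), CrField.jetNorm (c.support, k) X with hA
  have hA0 : 0 ≤ A := Finset.sum_nonneg fun j _ => CrField.jetNorm_nonneg _ _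
  refine (pi_norm_le_iff_of_nonneg (by positivity)).2 fun i => ?_
  refine (BoundedContinuousFunction.norm_le (by positivity)).2 fun z => ?_
  change ‖iteratedFDeriv ℝ i (c.mulField X) z‖ ≤ _
  have hir : (i : ℕ) ≤ r := Nat.lt_succ_iff.1 i.2
  by_cases hz : z ∈ tsupport c.toFun
  · have hzU : z ∈ (U : Set Plane) := c.tsupport_subset hz
    have h1 := norm_iteratedFDerivWithin_smul_le (c.contDiffOn U) X.2.1 U.isOpen.uniqueDiffOn hzU
      (n := i) (by exact_mod_cast hir)
    simp only [iteratedFDerivWithin_of_isOpen _ U.isOpen hzU] at h1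
    refine h1.trans ?_
    calc ∑ j ∈ Finset.range ((i : ℕ) + 1), (((i : ℕ).choose j : ℕ) : ℝ) *
          ‖iteratedFDeriv ℝ j c.toFun z‖ * ‖iteratedFDeriv ℝ ((i : ℕ) - j) X.1 z‖
        ≤ ∑ j ∈ Finset.range ((i : ℕ) + 1), (((i : ℕ).choose j : ℕ) : ℝ) * S * A := by
          refine Finset.sum_le_sum fun j hj => ?_
          have hj' : j ≤ (i : ℕ) := Nat.lt_succ_iff.1 (Finset.mem_range.1 hj)
          have e1 : ‖iteratedFDeriv ℝ j c.toFun z‖ ≤ S := (hB j z).trans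
            (Finset.single_le_sum (f := B) (fun j _ => hB0 j) (Finset.mem_range.2 (by omega)))
          have e2 : ‖iteratedFDeriv ℝ ((i : ℕ) - j) X.1 z‖ ≤ A := by
            have e3 := CrField.norm_iteratedFDeriv_le_jetNorm (c.support, ⟨(i : ℕ) - j, by omega⟩) X hz
            exact e3.trans (Finset.single_le_sum
              (f := fun k : Fin (r + 1) => CrField.jetNorm (c.support, k) X)
              (fun j _ => CrField.jetNorm_nonneg _ _) (Finset.mem_univ _))
          gcongr
      _ = 2 ^ (i : ℕ) * S * A := by
          rw [← Finset.sum_mul, ← Finset.sum_mul]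
          congr 2
          exact_mod_cast Nat.sum_range_choose (i : ℕ)
      _ ≤ 2 ^ r * S * A := by
          gcongr
          exact one_le_two
  · have : iteratedFDeriv ℝ (i : ℕ) (c.mulField X) z = 0 := by
      have h1 : c.mulField X =ᶠ[𝓝 z] fun _ => 0 := by
        filter_upwards [(isClosed_tsupport c.toFun).isOpen_compl.mem_nhds hz] with w hw
        exact c.mulField_eq_zero X hw
      have h2 := (h1.iteratedFDeriv (𝕜 := ℝ) (i : ℕ)).eq_of_nhds
      rw [h2]
      rw [iteratedFDeriv_fun_zero]
      rfl
    rw [this, norm_zero]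
    positivity

theorem continuous_of_norm_le {G : Type*} [SeminormedAddCommGroup G] [Module ℝ G]
    (f : CrField r U →ₗ[ℝ] G) {b : CrField r U → ℝ} (hb : Continuous b) (hb0 : b 0 = 0)
    (hfb : ∀ X, ‖f X‖ ≤ b X) : Continuous f := by
  refine continuous_of_continuousAt_zero f ?_
  rw [ContinuousAt, map_zero, tendsto_zero_iff_norm_tendsto_zero]
  exact squeeze_zero (fun _ => norm_nonneg _) hfb (hb0 ▸ hb.tendsto 0)

/-- The continuous linear map that sends a field to the jet of the cut off field. -/
def jetCLM (c : Cutoff U) : CrField r U →L[ℝ] BJet r where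
  toLinearMap := c.jetLM
  cont := by
    obtain ⟨C, hC⟩ := c.exists_norm_jetLM_le r
    refine continuous_of_norm_le c.jetLM
      (b := fun X => C * ∑ k : Fin (r + 1), CrField.jetNorm (c.support, k) X) ?_ (by simp [CrField.jetNorm_zero]) hC
    exact continuous_const.mul (continuous_finsetSum _ fun k _ => CrField.continuous_jetNorm _)

theorem field_jetCLM (c : Cutoff U) (X : CrField r U) (z : Plane) :
    (c.jetCLM X).field z = c.toFun z • X z := rfl

end Cutoff

end Cutoff

/-! ### Reflection and time reversal -/

section Mirror

variable {r : ℕ} {U : Opens Plane}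

/-- The reflection `(x, y) ↦ (x, -y)`. -/
def reflect : Plane ≃ₗᵢ[ℝ] Plane where
  toLinearEquiv := (LinearEquiv.refl ℝ ℝ).prodCongr (LinearEquiv.neg ℝ)
  norm_map' := fun z => by simp [Prod.norm_def]

theorem reflect_apply (z : Plane) : reflect z = (z.1, -z.2) := rfl

@[simp]
theorem reflect_reflect (z : Plane) : reflect (reflect z) = z := by simp [reflect_apply]

/-- The image of an open set under the reflection. -/
def mirrorOpens (U : Opens Plane) : Opens Plane := ⟨reflect ⁻¹' U, U.isOpen.preimage reflect.continuous⟩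

theorem mem_mirrorOpens {z : Plane} : z ∈ mirrorOpens U ↔ reflect z ∈ U := Iff.rfl

/-- The reflection of a vector field, with time reversed. -/
def mirrorLM : CrField r U →ₗ[ℝ] CrField r (mirrorOpens U) where
  toFun Y := ⟨fun z => -reflect (Y (reflect z)),
    (reflect.contDiff.comp_contDiffOn (Y.2.1.comp reflect.contDiff.contDiffOn fun _ hz => hz)).neg,
    fun z hz => (congrArg (fun w => -reflect w) (Y.2.2 (reflect z) hz)).trans (by simp)⟩
  map_add' X Y := by
    refine Subtype.ext (funext fun z => ?_)
    change -reflect (X (reflect z) + Y (reflect z)) = -reflect (X (reflect z)) + -reflect (Y (reflect z))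
    rw [map_add, neg_add]
  map_smul' a X := by
    refine Subtype.ext (funext fun z => ?_)
    change -reflect (a • X (reflect z)) = a • -reflect (X (reflect z))
    rw [map_smul, smul_neg]

/-- Reflection with time reversal, as a continuous linear map. -/
def mirror : CrField r U →L[ℝ] CrField r (mirrorOpens U) where
  toLinearMap := mirrorLM
  cont := by
    refine continuous_iInf_rng.2 fun κ => continuous_induced_rng.2 ?_
    set κ' : CrField.JetIndex r U := (⟨κ.1.1.map reflect reflect.continuous, by
      rintro _ ⟨z, hz, rfl⟩
      exact κ.1.2 hz⟩, κ.2) with hκ'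
    have hc : Continuous (CrField.jetC κ ∘ₗ mirrorLM) := by
      refine Cutoff.continuous_of_norm_le _ (CrField.continuous_jetNorm κ') (CrField.jetNorm_zero κ')
        fun X => ?_
      rw [ContinuousMap.norm_le _ (CrField.jetNorm_nonneg _ _)]
      rintro ⟨z, hz⟩
      have h1 : ‖iteratedFDeriv ℝ κ.2
          (fun z => (LinearIsometryEquiv.neg ℝ) (reflect (X (reflect z)))) z‖
          = ‖iteratedFDeriv ℝ κ.2 X.1 (reflect z)‖ := by
        rw [← LinearIsometryEquiv.norm_iteratedFDeriv_comp_right reflect X.1 z,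
          ← LinearIsometryEquiv.norm_iteratedFDeriv_comp_left
            (reflect.trans (LinearIsometryEquiv.neg ℝ)) (X.1 ∘ reflect)]
        rfl
      exact h1.trans_le (CrField.norm_iteratedFDeriv_le_jetNorm κ' X ⟨z, hz, rfl⟩)
    exact hc

theorem mirror_apply (Y : CrField r U) (z : Plane) : mirror Y z = -reflect (Y (reflect z)) := rfl

theorem lieH_mirror (Y : CrField r U) (x : ℝ) : lieH (mirror Y) (x, 0) = lieH Y (x, 0) := by
  simp [lieH, mirror_apply, reflect_apply]

theorem mirror_fst (Y : CrField r U) (x : ℝ) : (mirror Y (x, 0)).1 = -(Y (x, 0)).1 := by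
  simp [mirror_apply, reflect_apply]

/-- The reflection changes the sign of `h` and the time reversal changes it back, so `Yh` is merely
composed with the reflection. The derivative along the reversed field then brings one sign, which
exchanges the two visibility conditions. -/
theorem lieLieH_mirror (hr : 1 ≤ r) (Y : CrField r U) {x : ℝ} (hx : ((x, 0) : Plane) ∈ U) :
    lieLieH (mirror Y) (x, 0) = -lieLieH Y (x, 0) := by
  have h0 : reflect ((x, 0) : Plane) = (x, 0) := by simp [reflect_apply]
  have hY : DifferentiableAt ℝ (lieH Y) (x, 0) :=
    ((Y.contDiffAt le_rfl hx).differentiableAt (by exact_mod_cast (by omega : r ≠ 0))).snd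
  have h1 : lieH (mirror Y) = fun z => lieH Y (reflect z) := by
    funext z
    simp [lieH, mirror_apply, reflect_apply]
  have h2 : HasFDerivAt (fun z => lieH Y (reflect z))
      (fderiv ℝ (lieH Y) (x, 0) ∘L (reflect.toContinuousLinearEquiv : Plane →L[ℝ] Plane)) (x, 0) :=
    HasFDerivAt.comp (g := lieH Y) (x, 0) (by rw [h0]; exact hY.hasFDerivAt)
      (reflect.toContinuousLinearEquiv : Plane →L[ℝ] Plane).hasFDerivAt
  rw [lieLieH, h1, h2.fderiv, lieLieH, mirror_apply, h0]
  change fderiv ℝ (lieH Y) (x, 0) (reflect (-reflect (Y (x, 0)))) = _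
  rw [map_neg, reflect_reflect, map_neg]

theorem isVisibleFoldAbove_mirror (hr : 1 ≤ r) (Y : CrField r U) (x : ℝ) :
    IsVisibleFoldAbove (mirror Y) (x, 0) ↔ IsVisibleFoldBelow Y (x, 0) := by
  have h0 : reflect ((x, 0) : Plane) = (x, 0) := by simp [reflect_apply]
  rw [IsVisibleFoldAbove, IsVisibleFoldBelow, mem_mirrorOpens, h0, lieH_mirror]
  refine and_congr_right fun h => ?_
  rw [lieLieH_mirror hr Y h, neg_pos]

/-- The reflection fixes the switching line pointwise, and the sign in `mirror` reverses time. All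
results on the lower field are deduced from those on the upper one through this equivalence. -/
theorem isForwardArc_mirror (Y : CrField r U) (x q : ℝ) (G : Set Plane) :
    IsForwardArc (mirror Y) x q (reflect '' G) ↔ IsBackwardArc Y x q G := by
  have hσd : ∀ {f : ℝ → Plane} {f' : Plane} {s : Set ℝ} {t : ℝ}, HasDerivWithinAt f f' s t →
      HasDerivWithinAt (fun t => reflect (f t)) (reflect f') s t := fun h =>
    (reflect.toContinuousLinearEquiv : Plane →L[ℝ] Plane).hasFDerivAt.comp_hasDerivWithinAt _ h
  have hneg : ∀ {f : ℝ → Plane} {f' : Plane} {s : Set ℝ} {t : ℝ}, HasDerivWithinAt f f' s (-t) →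
      HasDerivWithinAt (fun t => f (-t)) (-f') (Neg.neg ⁻¹' s) t := fun {f f' s t} h => by
    have := HasDerivWithinAt.scomp t h (hasDerivAt_neg t).hasDerivWithinAt
      (fun u hu => hu : MapsTo (fun u : ℝ => -u) (Neg.neg ⁻¹' s) s)
    rw [neg_one_smul] at this
    exact this
  constructor
  · rintro ⟨T, hT, φ, hφ, hU, h0, hTq, hpos, hG⟩
    refine ⟨-T, by linarith, fun t => reflect (φ (-t)), ?_, ?_, ?_, ?_, ?_, ?_⟩
    · intro t ht
      have ht' : -t ∈ Icc 0 T := ⟨by linarith [ht.2], by linarith [ht.1]⟩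
      have h1 := hσd (hneg (hφ (-t) ht'))
      rw [neg_preimage, neg_Icc, neg_zero] at h1
      refine h1.congr_deriv ?_
      change reflect (-(-reflect (Y (reflect (φ (-t)))))) = Y (reflect (φ (-t)))
      rw [neg_neg, reflect_reflect]
    · intro t ht
      exact hU (-t) ⟨by linarith [ht.2], by linarith [ht.1]⟩
    · simp [h0, reflect_apply]
    · simp [hTq, reflect_apply]
    · intro t ht
      have := hpos (-t) ⟨by linarith [ht.2], by linarith [ht.1]⟩
      simp only [reflect_apply]
      linarith
    · have h1 : G = reflect '' (reflect '' G) := by simp [image_image]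
      rw [h1, hG, image_image]
      ext z
      constructor
      · rintro ⟨t, ht, rfl⟩
        exact ⟨-t, ⟨by linarith [ht.2], by linarith [ht.1]⟩, by simp⟩
      · rintro ⟨t, ht, rfl⟩
        exact ⟨-t, ⟨by linarith [ht.2], by linarith [ht.1]⟩, by simp⟩
  · rintro ⟨T, hT, φ, hφ, hU, h0, hTq, hpos, hG⟩
    refine ⟨-T, by linarith, fun t => reflect (φ (-t)), ?_, ?_, ?_, ?_, ?_, ?_⟩
    · intro t ht
      have ht' : -t ∈ Icc T 0 := ⟨by linarith [ht.2], by linarith [ht.1]⟩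
      have h1 := hσd (hneg (hφ (-t) ht'))
      rw [neg_preimage, neg_Icc, neg_zero] at h1
      refine h1.congr_deriv ?_
      change reflect (-Y (φ (-t))) = -reflect (Y (reflect (reflect (φ (-t)))))
      rw [map_neg, reflect_reflect]
    · intro t ht
      rw [mem_mirrorOpens, reflect_reflect]
      exact hU (-t) ⟨by linarith [ht.2], by linarith [ht.1]⟩
    · simp [h0, reflect_apply]
    · simp [hTq, reflect_apply]
    · intro t ht
      have := hpos (-t) ⟨by linarith [ht.2], by linarith [ht.1]⟩
      simp only [reflect_apply]
      linarith
    · rw [hG, image_image]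
      ext z
      constructor
      · rintro ⟨t, ht, rfl⟩
        exact ⟨-t, ⟨by linarith [ht.2], by linarith [ht.1]⟩, by simp⟩
      · rintro ⟨t, ht, rfl⟩
        exact ⟨-t, ⟨by linarith [ht.2], by linarith [ht.1]⟩, by simp⟩

end Mirror


/-! ### Auxiliary facts of one-variable calculus -/

section Calculus

theorem exists_implicit_real {E : Type*} [NormedAddCommGroup E] [NormedSpace ℝ E] [CompleteSpace E]
    {n : ℕ} (hn : n ≠ 0) {F : E × ℝ → ℝ} {e : E} {x a : ℝ} (hF : ContDiffAt ℝ n F (e, x))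
    (h0 : F (e, x) = 0) (ha : HasDerivAt (fun x => F (e, x)) a x) (ha0 : a ≠ 0) :
    ∃ ψ : E → ℝ, ContDiffAt ℝ n ψ e ∧ ψ e = x ∧ (∀ᶠ e' in 𝓝 e, F (e', ψ e') = 0) ∧
      ∀ᶠ w in 𝓝 (e, x), F w = 0 ↔ ψ w.1 = w.2 := by
  have hn' : (n : WithTop ℕ∞) ≠ 0 := by exact_mod_cast hn
  have h1 : HasFDerivAt (fun x => F (e, x)) (fderiv ℝ F (e, x) ∘L .inr ℝ E ℝ) x :=
    HasFDerivAt.comp (g := F) x (hF.differentiableAt hn').hasFDerivAt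
      (hasFDerivAt_prodMk_right (𝕜 := ℝ) e x)
  have hinv : (fderiv ℝ F (e, x) ∘L .inr ℝ E ℝ).IsInvertible := by
    refine ⟨ContinuousLinearEquiv.unitsEquivAut ℝ (Units.mk0 a ha0), ?_⟩
    rw [h1.unique ha.hasFDerivAt]
    ext
    simp
  refine ⟨hF.implicitFunction hn' hinv, hF.contDiffAt_implicitFunction hn' hinv,
    hF.implicitFunction_apply_self hn' hinv, ?_, ?_⟩
  · simpa only [h0] using hF.eventually_apply_implicitFunction hn' hinv
  · simpa only [h0] using hF.eventually_apply_eq_iff_implicitFunction hn' hinv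

/-- At a zero of `v` the factor `k` need only be continuous. This is what gives the quadratic
expansion of the return map when the fields are only `C^1`. -/
theorem HasDerivAt.mul_of_eq_zero {k v : ℝ → ℝ} {a x : ℝ} (hv : HasDerivAt v a x)
    (hv0 : v x = 0) (hk : ContinuousAt k x) : HasDerivAt (fun y => k y * v y) (k x * a) x := by
  rw [hasDerivAt_iff_tendsto_slope] at hv ⊢
  have h1 : Tendsto k (𝓝[≠] x) (𝓝 (k x)) := hk.tendsto.mono_left nhdsWithin_le_nhds
  refine (h1.mul hv).congr fun y => ?_
  simp only [slope_def_field, hv0]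
  ring

/-- A second order Taylor formula in which `g'` is differentiable at the single point `p`. The mean
value inequality is applied to the difference of `g` and its quadratic polynomial, whose derivative
is `o(s)`. -/
theorem sub_sub_isLittleO_sq {g α : ℝ → ℝ} {p c : ℝ} (hg : ∀ᶠ x in 𝓝 p, HasDerivAt g (α x) x)
    (hα : HasDerivAt α c p) (hα0 : α p = 0) :
    (fun s => g (p + s) - g p - c / 2 * s ^ 2) =o[𝓝 0] (fun s : ℝ => s ^ 2) := by
  rw [Asymptotics.isLittleO_iff]
  intro ε hε
  have hα' := hα.isLittleO
  rw [Asymptotics.isLittleO_iff] at hα'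
  have hshift : Tendsto (fun s : ℝ => p + s) (𝓝 0) (𝓝 p) := by
    have : Continuous fun s : ℝ => p + s := by fun_prop
    simpa using this.tendsto 0
  obtain ⟨δ, hδ, hball⟩ := Metric.eventually_nhds_iff_ball.1
    (hshift.eventually (hg.and (hα' hε)))
  filter_upwards [Metric.ball_mem_nhds (0 : ℝ) hδ] with s hs
  have hseg : ∀ u ∈ uIcc 0 s, |u| ≤ |s| := fun u hu => by
    simpa using abs_sub_left_of_mem_uIcc hu
  have h1 : ∀ u ∈ uIcc 0 s, HasDerivWithinAt (fun s => g (p + s) - g p - c / 2 * s ^ 2)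
      (α (p + u) - c * u) (uIcc 0 s) u := by
    intro u hu
    have hu' : u ∈ Metric.ball (0 : ℝ) δ := by
      rw [Metric.mem_ball, dist_zero_right, Real.norm_eq_abs] at hs ⊢
      exact (hseg u hu).trans_lt hs
    have h2 : HasDerivAt (fun s => g (p + s)) (α (p + u)) u :=
      (hball u hu').1.comp_const_add p u
    have h3 : HasDerivAt (fun s : ℝ => c / 2 * s ^ 2) (c * u) u := by
      have := ((hasDerivAt_id u).pow 2).const_mul (c / 2)
      refine this.congr_deriv ?_
      simp only [id]
      ring
    exact ((h2.sub_const (g p)).sub h3).hasDerivWithinAt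
  have h2 : ∀ u ∈ uIcc 0 s, ‖α (p + u) - c * u‖ ≤ ε * |s| := by
    intro u hu
    have hu' : u ∈ Metric.ball (0 : ℝ) δ := by
      rw [Metric.mem_ball, dist_zero_right, Real.norm_eq_abs] at hs ⊢
      exact (hseg u hu).trans_lt hs
    have := (hball u hu').2
    simp only [hα0, sub_zero, add_sub_cancel_left, smul_eq_mul, Real.norm_eq_abs] at this
    rw [Real.norm_eq_abs, mul_comm c u]
    exact this.trans (mul_le_mul_of_nonneg_left (hseg u hu) hε.le)
  have h3 := (convex_uIcc 0 s).norm_image_sub_le_of_norm_hasDerivWithin_le h1 h2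
    left_mem_uIcc right_mem_uIcc
  simpa [sq, mul_assoc, abs_mul] using h3

theorem HasDerivAt.fst_plane {f : ℝ → Plane} {f' : Plane} {t : ℝ} (h : HasDerivAt f f' t) :
    HasDerivAt (fun t => (f t).1) f'.1 t :=
  (ContinuousLinearMap.fst ℝ ℝ ℝ).hasFDerivAt.comp_hasDerivAt t h

theorem HasDerivAt.snd_plane {f : ℝ → Plane} {f' : Plane} {t : ℝ} (h : HasDerivAt f f' t) :
    HasDerivAt (fun t => (f t).2) f'.2 t :=
  (ContinuousLinearMap.snd ℝ ℝ ℝ).hasFDerivAt.comp_hasDerivAt t h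

end Calculus

/-! ### Fields, folds and first returns in the Banach space of jets -/

section Return

variable {r : ℕ}

/-- The planar cross product. -/
def cross (a b : Plane) : ℝ := a.1 * b.2 - a.2 * b.1

/-- The coefficient is the trace of `A`: the infinitesimal form of Liouville's formula for areas. -/
theorem cross_clm_add (A : Plane →L[ℝ] Plane) (a b : Plane) :
    cross (A a) b + cross a (A b) = ((A (1, 0)).1 + (A (0, 1)).2) * cross a b := by
  have h : ∀ v : Plane, A v = v.1 • A (1, 0) + v.2 • A (0, 1) := fun v => by
    rw [← map_smul, ← map_smul, ← map_add]
    congr 1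
    ext <;> simp
  rw [h a, h b]
  simp only [cross, Prod.fst_add, Prod.snd_add, Prod.smul_fst, Prod.smul_snd, smul_eq_mul]
  ring

theorem BJet.continuous_fderiv_field (hr : 1 ≤ r) :
    Continuous fun w : BJet r × Plane => fderiv ℝ w.1.field w.2 := by
  have hr' : (r : WithTop ℕ∞) ≠ 0 := by exact_mod_cast (by omega : r ≠ 0)
  have h1 : Continuous (fderiv ℝ (fun w : BJet r × Plane => w.1.field w.2)) :=
    BJet.contDiff_field.continuous_fderiv hr'
  have h2 : ∀ w : BJet r × Plane, fderiv ℝ w.1.field w.2 =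
      fderiv ℝ (fun w : BJet r × Plane => w.1.field w.2) w ∘L .inr ℝ _ _ := by
    rintro ⟨X, z⟩
    refine ContinuousLinearMap.ext fun h => ?_
    change _ = fderiv ℝ (fun w : BJet r × Plane => w.1.field w.2) (X, z) (0, h)
    rw [BJet.fderiv_field hr]
    have : (0 : BJet r).field z = 0 := (BJet.fieldCLM (r := r) z).map_zero
    rw [this, zero_add]
  simp only [h2]
  exact h1.clm_comp continuous_const

theorem BJet.differentiable_field (hr : 1 ≤ r) (X : BJet r) : Differentiable ℝ X.field :=
  X.contDiff_field_right.differentiable (by exact_mod_cast (by omega : r ≠ 0))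

theorem BJet.hasDerivAt_field_snd (hr : 1 ≤ r) (X : BJet r) (x : ℝ) :
    HasDerivAt (fun x => (X.field (x, 0)).2) (fderiv ℝ X.field (x, 0) (1, 0)).2 x := by
  have h1 : HasDerivAt (fun x : ℝ => ((x, 0) : Plane)) (1, 0) x :=
    (hasDerivAt_id x).prodMk (hasDerivAt_const x 0)
  have h2 := (X.differentiable_field hr (x, 0)).hasFDerivAt.comp_hasDerivAt x h1
  exact h2.snd_plane

namespace IsSmoothFlow

variable {Φ : BJet r × ℝ × Plane → Plane}

theorem continuous (hΦ : IsSmoothFlow Φ) : Continuous Φ := hΦ.contDiff.continuous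

theorem hasDerivAt_snd (hΦ : IsSmoothFlow Φ) (X : BJet r) (t : ℝ) (z : Plane) :
    HasDerivAt (fun t => (Φ (X, t, z)).2) (X.field (Φ (X, t, z))).2 t := (hΦ.hasDerivAt X t z).snd_plane

theorem hasDerivAt_field_snd (hr : 1 ≤ r) (hΦ : IsSmoothFlow Φ) (X : BJet r) (t : ℝ) (z : Plane) :
    HasDerivAt (fun t => (X.field (Φ (X, t, z))).2)
      (fderiv ℝ X.field (Φ (X, t, z)) (X.field (Φ (X, t, z)))).2 t :=
  HasDerivAt.snd_plane (HasFDerivAt.comp_hasDerivAt t (X.differentiable_field hr _).hasFDerivAt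
    (hΦ.hasDerivAt X t z))

theorem fderiv_time (hr : 1 ≤ r) (hΦ : IsSmoothFlow Φ) (X : BJet r) (t : ℝ) (z : Plane) (c : ℝ) :
    fderiv ℝ Φ (X, t, z) (0, c, 0) = c • X.field (Φ (X, t, z)) := by
  have hr' : (r : WithTop ℕ∞) ≠ 0 := by exact_mod_cast (by omega : r ≠ 0)
  have h1 : HasDerivAt (fun t : ℝ => (X, t, z)) ((0 : BJet r), (1 : ℝ), (0 : Plane)) t :=
    (hasDerivAt_const t X).prodMk ((hasDerivAt_id t).prodMk (hasDerivAt_const t z))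
  have h2 := (hΦ.contDiff.differentiable hr' (X, t, z)).hasFDerivAt.comp_hasDerivAt t h1
  rw [← (h2.unique (hΦ.hasDerivAt X t z)), ← map_smul]
  simp

/-- Zeros of the field are fixed points of the flow. -/
theorem field_ne_zero (hr : 1 ≤ r) (hΦ : IsSmoothFlow Φ) {X : BJet r} {z : Plane}
    (hz : X.field z ≠ 0) (t : ℝ) : X.field (Φ (X, t, z)) ≠ 0 := by
  intro h
  have hlip : LipschitzWith ‖X‖₊ X.field := LipschitzWith.of_dist_le_mul fun x y => by
    rw [dist_eq_norm, dist_eq_norm]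
    exact X.norm_field_sub_le hr x y
  have h1 := ODE_solution_unique_univ (v := fun _ => X.field) (K := ‖X‖₊) (s := fun _ => univ)
    (f := fun s => Φ (X, s, z)) (g := fun _ => Φ (X, t, z)) (t₀ := t)
    (fun _ => hlip.lipschitzOnWith) (fun s => ⟨hΦ.hasDerivAt X s z, mem_univ _⟩)
    (fun s => ⟨by rw [h]; exact hasDerivAt_const s _, mem_univ _⟩) rfl
  have h2 := congrFun h1 0
  simp only [hΦ.zero] at h2
  rw [← h2] at h
  exact hz h

/-- The first variation `ξ` of the flow in the direction `V` satisfies `ξ' = V + DX ξ`, so `c = X ∧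
ξ` satisfies `c' = (div X) c + X ∧ V` with `c(0) = 0`. Positivity of `X ∧ V` forces `c(T) > 0`, as
in a Melnikov integral. -/
theorem cross_fderiv_pos (hr : 1 ≤ r) (hΦ : IsSmoothFlow Φ) (X V : BJet r) (z : Plane) {T : ℝ}
    (hT : 0 < T)
    (hpos : ∀ t ∈ Ioo 0 T, 0 < cross (X.field (Φ (X, t, z))) (V.field (Φ (X, t, z)))) :
    0 < cross (X.field (Φ (X, T, z))) (fderiv ℝ Φ (X, T, z) (V, 0, 0)) := by
  have hr' : (r : WithTop ℕ∞) ≠ 0 := by exact_mod_cast (by omega : r ≠ 0)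
  set ξ : ℝ → Plane := fun t => fderiv ℝ Φ (X, t, z) (V, 0, 0) with hξ
  set γ : ℝ → Plane := fun t => Φ (X, t, z) with hγ
  have hγc : Continuous γ := hΦ.continuous.comp (by fun_prop)
  have hξc : Continuous ξ := ((hΦ.contDiff.continuous_fderiv hr').comp
    (by fun_prop : Continuous fun t : ℝ => (X, t, z))).clm_apply continuous_const
  have hXc : Continuous fun t => X.field (γ t) := X.contDiff_field_right.continuous.comp hγc
  have hAc : Continuous fun t => fderiv ℝ X.field (γ t) :=
    (BJet.continuous_fderiv_field hr).comp (by fun_prop : Continuous fun t => (X, γ t))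
  set k : ℝ → ℝ := fun t => (fderiv ℝ X.field (γ t) (1, 0)).1 + (fderiv ℝ X.field (γ t) (0, 1)).2
    with hk
  have hkc : Continuous k := by
    have e1 := hAc.clm_apply (continuous_const (y := ((1, 0) : Plane)))
    have e2 := hAc.clm_apply (continuous_const (y := ((0, 1) : Plane)))
    exact e1.fst.add e2.snd
  set c : ℝ → ℝ := fun t => cross (X.field (γ t)) (ξ t) with hc
  have hcc : Continuous c := by
    simp only [hc, cross]
    exact (hXc.fst.mul hξc.snd).sub (hXc.snd.mul hξc.fst)
  have hξ0 : ξ 0 = 0 := by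
    have h1 : HasFDerivAt (fun X' : BJet r => Φ (X', 0, z))
        (fderiv ℝ Φ (X, 0, z) ∘L .inl ℝ (BJet r) (ℝ × Plane)) X :=
      HasFDerivAt.comp (g := Φ) X (hΦ.contDiff.differentiable hr' _).hasFDerivAt
        (hasFDerivAt_prodMk_left (𝕜 := ℝ) X ((0 : ℝ), z))
    simp only [hΦ.zero] at h1
    exact congrArg (fun A : BJet r →L[ℝ] Plane => A V) (h1.unique (hasFDerivAt_const z X))
  have hcd : ∀ t, 0 < t → HasDerivAt c (k t * c t + cross (X.field (γ t)) (V.field (γ t))) t := by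
    intro t ht
    have h1 : HasDerivAt (fun t => X.field (γ t)) (fderiv ℝ X.field (γ t) (X.field (γ t))) t :=
      HasFDerivAt.comp_hasDerivAt t (X.differentiable_field hr _).hasFDerivAt (hΦ.hasDerivAt X t z)
    have h2 : HasDerivAt ξ (V.field (γ t) + fderiv ℝ X.field (γ t) (ξ t)) t :=
      hΦ.hasDerivAt_fderiv X V z t ht
    have h3 := (h1.fst_plane.mul h2.snd_plane).sub (h1.snd_plane.mul h2.fst_plane)
    refine h3.congr_deriv ?_
    have h4 := cross_clm_add (fderiv ℝ X.field (γ t)) (X.field (γ t)) (ξ t)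
    simp only [hk, hc]
    rw [← h4]
    simp only [cross, Prod.fst_add, Prod.snd_add]
    ring
  set μ : ℝ → ℝ := fun t => ∫ u in (0 : ℝ)..t, k u with hμ
  have hμd : ∀ t, HasDerivAt μ (k t) t := fun t => (hkc.integral_hasStrictDerivAt 0 t).hasDerivAt
  have hμc : Continuous μ := continuous_iff_continuousAt.2 fun t => (hμd t).continuousAt
  -- The integrating factor removes the divergence term, so `d` is strictly increasing from `d 0 =
  -- 0`.
  set d : ℝ → ℝ := fun t => Real.exp (-μ t) * c t with hd
  have hdd : ∀ t ∈ Ioo 0 T, HasDerivAt d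
      (Real.exp (-μ t) * cross (X.field (γ t)) (V.field (γ t))) t := by
    intro t ht
    have h1 := ((hμd t).neg.exp).mul (hcd t ht.1)
    refine h1.congr_deriv ?_
    simp only [Pi.neg_apply]
    ring
  have hmono : StrictMonoOn d (Icc 0 T) := by
    refine strictMonoOn_of_deriv_pos (convex_Icc 0 T) ?_ ?_
    · exact ((Real.continuous_exp.comp hμc.neg).mul hcc).continuousOn
    · rw [interior_Icc]
      intro t ht
      rw [(hdd t ht).deriv]
      exact mul_pos (Real.exp_pos _) (hpos t ht)
  have h1 := hmono (left_mem_Icc.2 hT.le) (right_mem_Icc.2 hT.le) hT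
  have h2 : d 0 = 0 := by
    simp only [hd, hc, hξ0]
    simp [cross]
  rw [h2] at h1
  exact (mul_pos_iff_of_pos_left (Real.exp_pos _)).1 h1

end IsSmoothFlow

end Return


/-! ### The first return of a fold trajectory -/

section FirstReturn

variable {r : ℕ} {Φ : BJet r × ℝ × Plane → Plane}

/-- The orbit of the fold `(0, 0)` of `X` first returns to `y = 0` at the time `T`, at the point
`(q, 0)`, through `y > 0`, inside `W` and transversally. -/
structure IsFoldOrbit (Φ : BJet r × ℝ × Plane → Plane) (W : Set Plane) (X : BJet r) (T q : ℝ) :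
    Prop where
  snd_eq_zero : (X.field (0, 0)).2 = 0
  fst_pos : 0 < (X.field (0, 0)).1
  deriv_pos : 0 < (fderiv ℝ X.field (0, 0) (1, 0)).2
  time_pos : 0 < T
  apply_time : Φ (X, T, (0, 0)) = (q, 0)
  snd_neg : (X.field (q, 0)).2 < 0
  pos : ∀ t ∈ Ioo 0 T, 0 < (Φ (X, t, (0, 0))).2
  isOpen : IsOpen W
  mem : ∀ t ∈ Icc 0 T, Φ (X, t, (0, 0)) ∈ W

/-- `T` is the time of the first return of the trajectory of `X` through `z`. -/
structure IsReturnTime (Φ : BJet r × ℝ × Plane → Plane) (W : Set Plane) (X : BJet r) (z : Plane)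
    (T : ℝ) : Prop where
  time_pos : 0 < T
  apply_time : (Φ (X, T, z)).2 = 0
  pos : ∀ t ∈ Ioo 0 T, 0 < (Φ (X, t, z)).2
  mem : ∀ t ∈ Icc 0 T, Φ (X, t, z) ∈ W
  snd_neg : (X.field (Φ (X, T, z))).2 < 0

theorem exists_ball_of_eventually_prod {α : Type*} [TopologicalSpace α] {a : α} {t₀ : ℝ}
    {Q : α × ℝ → Prop} (h : ∀ᶠ v in 𝓝 (a, t₀), Q v) :
    ∃ ε > 0, ∀ᶠ w in 𝓝 a, ∀ t, |t - t₀| < ε → Q (w, t) := by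
  rw [nhds_prod_eq] at h
  obtain ⟨pa, ha, pb, hb, hab⟩ := eventually_prod_iff.1 h
  obtain ⟨ε, hε, hball⟩ := Metric.eventually_nhds_iff.1 hb
  exact ⟨ε, hε, ha.mono fun w hw t ht => hab hw (hball ht)⟩

namespace IsFoldOrbit

variable {W : Set Plane} {X₀ : BJet r} {T₀ q₀ : ℝ}

theorem exists_time (hr : 1 ≤ r) (hΦ : IsSmoothFlow Φ) (h : IsFoldOrbit Φ W X₀ T₀ q₀) :
    ∃ τ : BJet r × Plane → ℝ, ContDiffAt ℝ r τ (X₀, (0, 0)) ∧ τ (X₀, (0, 0)) = T₀ ∧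
      (∀ᶠ w in 𝓝 (X₀, ((0, 0) : Plane)), (Φ (w.1, τ w, w.2)).2 = 0) ∧
      ∀ᶠ v in 𝓝 ((X₀, ((0, 0) : Plane)), T₀), (Φ (v.1.1, v.2, v.1.2)).2 = 0 ↔ τ v.1 = v.2 := by
  have h1 : ContDiff ℝ r fun v : (BJet r × Plane) × ℝ => (Φ (v.1.1, v.2, v.1.2)).2 :=
    contDiff_snd.comp (hΦ.contDiff.comp (by fun_prop : ContDiff ℝ r
      fun v : (BJet r × Plane) × ℝ => (v.1.1, v.2, v.1.2)))
  have h2 := hΦ.hasDerivAt_snd X₀ T₀ (0, 0)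
  rw [h.apply_time] at h2
  exact exists_implicit_real (by omega) h1.contDiffAt (by rw [h.apply_time]) h2 h.snd_neg.ne

/-- The time interval is cut in three. Near `0` the height is strictly convex, and it starts at `0`
with nonnegative slope. In the middle, positivity persists by compactness. Near `T₀` the height
decreases strictly to its zero at `τ w`. The condition `0 ≤ X²` selects the starting points that do
not first move down. -/
theorem eventually_isReturnTime (hr : 1 ≤ r) (hΦ : IsSmoothFlow Φ) (h : IsFoldOrbit Φ W X₀ T₀ q₀)
    {τ : BJet r × Plane → ℝ} (hτc : ContinuousAt τ (X₀, (0, 0))) (hτ0 : τ (X₀, (0, 0)) = T₀)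
    (hτ : ∀ᶠ w in 𝓝 (X₀, ((0, 0) : Plane)), (Φ (w.1, τ w, w.2)).2 = 0) :
    ∀ᶠ w in 𝓝 (X₀, ((0, 0) : Plane)), w.2.2 = 0 → 0 ≤ (w.1.field w.2).2 →
      IsReturnTime Φ W w.1 w.2 (τ w) := by
  have hΦc : Continuous fun v : (BJet r × Plane) × ℝ => Φ (v.1.1, v.2, v.1.2) :=
    hΦ.continuous.comp (by fun_prop)
  have hXc : Continuous fun v : (BJet r × Plane) × ℝ => v.1.1.field (Φ (v.1.1, v.2, v.1.2)) :=
    BJet.contDiff_field.continuous.comp (continuous_fst.fst.prodMk hΦc)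
  have hSc : Continuous fun v : (BJet r × Plane) × ℝ =>
      (fderiv ℝ v.1.1.field (Φ (v.1.1, v.2, v.1.2)) (v.1.1.field (Φ (v.1.1, v.2, v.1.2)))).2 :=
    (((BJet.continuous_fderiv_field hr).comp
      (continuous_fst.fst.prodMk hΦc)).clm_apply hXc).snd
  have hS0 : 0 < (fderiv ℝ X₀.field (0, 0) (X₀.field (0, 0))).2 := by
    have e1 : X₀.field (0, 0) = (X₀.field (0, 0)).1 • ((1, 0) : Plane) := by
      ext <;> simp [h.snd_eq_zero]
    rw [e1, map_smul]
    exact mul_pos h.fst_pos h.deriv_pos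
  obtain ⟨ε₁, hε₁, hS⟩ := exists_ball_of_eventually_prod
    ((hSc.tendsto ((X₀, (0, 0)), 0)).eventually_const_lt (by simpa only [hΦ.zero] using hS0))
  have hT1 : ∀ᶠ v in 𝓝 ((X₀, ((0, 0) : Plane)), T₀),
      (v.1.1.field (Φ (v.1.1, v.2, v.1.2))).2 < 0 ∧ Φ (v.1.1, v.2, v.1.2) ∈ W := by
    refine ((hXc.snd.tendsto ((X₀, (0, 0)), T₀)).eventually_lt_const ?_).and
      ((hΦc.tendsto ((X₀, (0, 0)), T₀)).eventually (h.isOpen.mem_nhds ?_))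
    · simpa only [h.apply_time] using h.snd_neg
    · exact h.mem T₀ (right_mem_Icc.2 h.time_pos.le)
  obtain ⟨ε₂, hε₂, hT⟩ := exists_ball_of_eventually_prod hT1
  have hmid : ∀ᶠ w in 𝓝 (X₀, ((0, 0) : Plane)), ∀ t ∈ Icc (min (ε₁ / 2) T₀) (T₀ - ε₂ / 2),
      0 < (Φ (w.1, t, w.2)).2 := by
    refine isCompact_Icc.eventually_forall_of_forall_eventually fun t ht => ?_
    refine (hΦc.snd.tendsto ((X₀, (0, 0)), t)).eventually_const_lt (h.pos t ⟨?_, ?_⟩)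
    · exact (lt_min (half_pos hε₁) h.time_pos).trans_le ht.1
    · linarith [ht.2]
  have hW : ∀ᶠ w in 𝓝 (X₀, ((0, 0) : Plane)), ∀ t ∈ Icc 0 T₀, Φ (w.1, t, w.2) ∈ W := by
    refine isCompact_Icc.eventually_forall_of_forall_eventually fun t ht => ?_
    exact (hΦc.tendsto ((X₀, (0, 0)), t)).eventually (h.isOpen.mem_nhds (h.mem t ht))
  have hτT : ∀ᶠ w in 𝓝 (X₀, ((0, 0) : Plane)), |τ w - T₀| < min (ε₂ / 2) T₀ := by
    have := Metric.continuousAt_iff'.1 hτc (min (ε₂ / 2) T₀) (lt_min (half_pos hε₂) h.time_pos)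
    simpa only [hτ0, Real.dist_eq] using this
  filter_upwards [hS, hT, hmid, hW, hτT, hτ] with w hS hT hmid hW hτT hτ hw0 hw1
  have hτpos : 0 < τ w := by
    have := (abs_lt.1 (hτT.trans_le (min_le_right _ _))).1
    linarith
  have hτ2 := abs_lt.1 (hτT.trans_le (min_le_left _ _))
  have hyd := fun t => hΦ.hasDerivAt_snd w.1 t w.2
  have hyc : Continuous fun t => (Φ (w.1, t, w.2)).2 :=
    continuous_iff_continuousAt.2 fun t => (hyd t).continuousAt
  refine ⟨hτpos, hτ, fun t ht => ?_, fun t ht => ?_, ?_⟩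
  · rcases lt_or_ge (T₀ - ε₂ / 2) t with h1 | h1
    · have hanti : StrictAntiOn (fun t => (Φ (w.1, t, w.2)).2) (Icc t (τ w)) := by
        refine strictAntiOn_of_deriv_neg (convex_Icc _ _) hyc.continuousOn fun u hu => ?_
        rw [interior_Icc] at hu
        rw [(hyd u).deriv]
        refine (hT u (abs_lt.2 ⟨?_, ?_⟩)).1 <;> linarith [hu.1, hu.2]
      have := hanti (left_mem_Icc.2 ht.2.le) (right_mem_Icc.2 ht.2.le) ht.2
      simpa only [hτ] using this
    · rcases le_or_gt (min (ε₁ / 2) T₀) t with h2 | h2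
      · exact hmid t ⟨h2, h1⟩
      have ht1 : t < ε₁ / 2 := h2.trans_le (min_le_left _ _)
      have hv : StrictMonoOn (fun t => (w.1.field (Φ (w.1, t, w.2))).2) (Icc 0 t) := by
        have hvd := fun t => hΦ.hasDerivAt_field_snd hr w.1 t w.2
        refine strictMonoOn_of_deriv_pos (convex_Icc _ _)
          (fun u _ => (hvd u).continuousAt.continuousWithinAt) fun u hu => ?_
        rw [interior_Icc] at hu
        rw [(hvd u).deriv]
        refine hS u (abs_lt.2 ⟨?_, ?_⟩) <;> linarith [hu.1, hu.2]
      have hy : StrictMonoOn (fun t => (Φ (w.1, t, w.2)).2) (Icc 0 t) := by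
        refine strictMonoOn_of_deriv_pos (convex_Icc _ _) hyc.continuousOn fun u hu => ?_
        rw [interior_Icc] at hu
        rw [(hyd u).deriv]
        have := hv (left_mem_Icc.2 ht.1.le) (Ioo_subset_Icc_self hu) hu.1
        simp only [hΦ.zero] at this
        exact hw1.trans_lt this
      have := hy (left_mem_Icc.2 ht.1.le) (right_mem_Icc.2 ht.1.le) ht.1
      simpa only [hΦ.zero, hw0] using this
  · rcases le_or_gt t T₀ with h1 | h1
    · exact hW t ⟨ht.1, h1⟩
    · refine (hT t (abs_lt.2 ⟨?_, ?_⟩)).2 <;> linarith [ht.2]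
  · refine (hT (τ w) (abs_lt.2 ⟨?_, ?_⟩)).1 <;> linarith

/-- The return abscissa is constant along the trajectories. -/
theorem eventually_return_const (hr : 1 ≤ r) (hΦ : IsSmoothFlow Φ)
    {τ : BJet r × Plane → ℝ} (hτc : ContinuousAt τ (X₀, (0, 0))) (hτ0 : τ (X₀, (0, 0)) = T₀)
    (hτ : ∀ᶠ w in 𝓝 (X₀, ((0, 0) : Plane)), (Φ (w.1, τ w, w.2)).2 = 0)
    (hτu : ∀ᶠ v in 𝓝 ((X₀, ((0, 0) : Plane)), T₀),
      (Φ (v.1.1, v.2, v.1.2)).2 = 0 ↔ τ v.1 = v.2) :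
    ∀ᶠ w in 𝓝 (X₀, ((0, 0) : Plane)), ∀ᶠ t in 𝓝 (0 : ℝ),
      Φ (w.1, τ (w.1, Φ (w.1, t, w.2)), Φ (w.1, t, w.2)) = Φ (w.1, τ w, w.2) := by
  have h1 : Tendsto (fun w : BJet r × Plane => (w, τ w)) (𝓝 (X₀, (0, 0)))
      (𝓝 ((X₀, (0, 0)), T₀)) := by
    have := (continuousAt_id (x := (X₀, ((0, 0) : Plane)))).prodMk hτc
    rw [← hτ0]
    exact this
  filter_upwards [h1.eventually hτu.eventually_nhds, hτ] with w hw hw0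
  have h2 : Tendsto (fun t : ℝ => ((w.1, Φ (w.1, t, w.2)), τ w - t)) (𝓝 0) (𝓝 (w, τ w)) := by
    have : Continuous fun t : ℝ => ((w.1, Φ (w.1, t, w.2)), τ w - t) := by
      have : Continuous fun t : ℝ => Φ (w.1, t, w.2) := hΦ.continuous.comp (by fun_prop)
      exact (continuous_const.prodMk this).prodMk (by fun_prop)
    simpa [hΦ.zero] using this.tendsto 0
  filter_upwards [h2.eventually hw] with t ht
  have h3 : Φ (w.1, τ w - t, Φ (w.1, t, w.2)) = Φ (w.1, τ w, w.2) := by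
    rw [← hΦ.add hr, sub_add_cancel]
  -- After flowing for the time `t`, the remaining time `τ w - t` is a zero of the height near `T₀`.
  -- Local uniqueness in the implicit function theorem identifies it with `τ`.
  have h4 : τ (w.1, Φ (w.1, t, w.2)) = τ w - t := ht.1 (by rw [h3, hw0])
  rw [h4, h3]

end IsFoldOrbit

/-- `(p, 0)` is a visible fold of `X` with `X¹ > 0`. The trajectories of `X` from `(p + s, 0)`, for
small `s ≥ 0`, return to `y = 0` at `(ξ s, 0)` through `y > 0`, inside `W` and
`ξ s = q + m s² + o(s²)`. -/
structure IsFoldReturn (Φ : BJet r × ℝ × Plane → Plane) (W : Set Plane) (X : BJet r)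
    (p q m : ℝ) : Prop where
  snd_eq_zero : (X.field (p, 0)).2 = 0
  fst_pos : 0 < (X.field (p, 0)).1
  deriv_pos : 0 < (fderiv ℝ X.field (p, 0) (1, 0)).2
  snd_neg : (X.field (q, 0)).2 < 0
  exists_return : ∃ δ > 0, ∃ ξ : ℝ → ℝ, ξ 0 = q ∧
    (∀ s ∈ Ico 0 δ, ∃ T > 0, Φ (X, T, (p + s, 0)) = (ξ s, 0) ∧
      (∀ t ∈ Ioo 0 T, 0 < (Φ (X, t, (p + s, 0))).2) ∧ ∀ t ∈ Icc 0 T, Φ (X, t, (p + s, 0)) ∈ W) ∧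
    (fun s => ξ s - q - m * s ^ 2) =o[𝓝 0] (fun s : ℝ => s ^ 2)

theorem HasDerivAt.eventually_pos_of_pos {v : ℝ → ℝ} {a p : ℝ} (hv : HasDerivAt v a p)
    (hv0 : v p = 0) (ha : 0 < a) : ∀ᶠ s in 𝓝 (0 : ℝ), 0 < s → 0 < v (p + s) := by
  have h1 := (hasDerivAt_iff_tendsto_slope.1 hv).eventually_const_lt ha
  rw [eventually_nhdsWithin_iff] at h1
  have hshift : Tendsto (fun s : ℝ => p + s) (𝓝 0) (𝓝 p) := by
    have : Continuous fun s : ℝ => p + s := by fun_prop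
    simpa using this.tendsto 0
  filter_upwards [hshift.eventually h1] with s hs hs0
  have := hs (by simp [hs0.ne'])
  simp only [slope_def_field, hv0, sub_zero, add_sub_cancel_left] at this
  exact (div_pos_iff_of_pos_right hs0).1 this

/-- The fold and its first return depend on the field in a `C^r` manner. -/
theorem IsFoldOrbit.exists_isFoldReturn (hr : 1 ≤ r) (hΦ : IsSmoothFlow Φ) {W : Set Plane}
    {X₀ : BJet r} {T₀ q₀ : ℝ} (h : IsFoldOrbit Φ W X₀ T₀ q₀) :
    ∃ p q m : BJet r → ℝ, p X₀ = 0 ∧ q X₀ = q₀ ∧ ContDiffAt ℝ r p X₀ ∧ ContDiffAt ℝ r q X₀ ∧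
      ContinuousAt m X₀ ∧
      (∀ V : BJet r, fderiv ℝ p X₀ V * (fderiv ℝ X₀.field (0, 0) (1, 0)).2 =
        -(V.field (0, 0)).2) ∧
      (∀ V : BJet r, (V.field (0, 0)).2 = 0 →
        (∀ t ∈ Ioo 0 T₀, 0 < cross (X₀.field (Φ (X₀, t, (0, 0)))) (V.field (Φ (X₀, t, (0, 0))))) →
        fderiv ℝ q X₀ V ≠ 0) ∧
      ∀ᶠ X in 𝓝 X₀, IsFoldReturn Φ W X (p X) (q X) (m X) := by
  have hr0 : (r : WithTop ℕ∞) ≠ 0 := by exact_mod_cast (by omega : r ≠ 0)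
  have hev : ContDiff ℝ r fun w : BJet r × ℝ => w.1.field (w.2, 0) :=
    BJet.contDiff_field.comp (by fun_prop : ContDiff ℝ r
      fun w : BJet r × ℝ => (w.1, ((w.2, 0) : Plane)))
  obtain ⟨p, hp, hp0, hpz, -⟩ := exists_implicit_real (F := fun w : BJet r × ℝ =>
    (w.1.field (w.2, 0)).2) (by omega) (contDiff_snd.comp hev).contDiffAt h.snd_eq_zero
    (X₀.hasDerivAt_field_snd hr 0) h.deriv_pos.ne'
  obtain ⟨τ, hτ, hτ0, hτz, hτu⟩ := h.exists_time hr hΦ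
  have hret := h.eventually_isReturnTime hr hΦ hτ.continuousAt hτ0 hτz
  have hconst := IsFoldOrbit.eventually_return_const hr hΦ hτ.continuousAt hτ0 hτz hτu
  -- the return map in terms of `(X, z)`
  set R : BJet r × Plane → Plane := fun w => Φ (w.1, τ w, w.2) with hR
  have hRd : ContDiffAt ℝ r R (X₀, (0, 0)) :=
    hΦ.contDiff.contDiffAt.comp (X₀, ((0, 0) : Plane))
      (contDiffAt_fst.prodMk (hτ.prodMk contDiffAt_snd))
  have hR0 : R (X₀, (0, 0)) = (q₀, 0) := by simp only [hR, hτ0, h.apply_time]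
  set ι : BJet r → BJet r × Plane := fun X => (X, (p X, 0)) with hι
  have hι0 : ι X₀ = (X₀, (0, 0)) := by simp only [hι, hp0]
  have hιd : ContDiffAt ℝ r ι X₀ := contDiffAt_id.prodMk (hp.prodMk contDiffAt_const)
  have hιt : Tendsto ι (𝓝 X₀) (𝓝 (X₀, (0, 0))) := by
    rw [← hι0]
    exact hιd.continuousAt
  have hRι : ContDiffAt ℝ r (fun X => R (ι X)) X₀ := by
    refine ContDiffAt.comp (g := R) X₀ ?_ hιd
    rw [hι0]
    exact hRd
  -- `β` is the derivative of the return abscissa across the line, and `b` below is the slope of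
  -- `X²` along the line. The quadratic coefficient will be `m = -(β / X¹) b / 2`.
  set β : BJet r × Plane → ℝ := fun w => (fderiv ℝ R w (0, (0, 1))).1 with hβ
  have hRev : ∀ᶠ w in 𝓝 (X₀, ((0, 0) : Plane)), ContDiffAt ℝ r R w :=
    hRd.eventually (by simp)
  have hβc : ∀ {w}, ContDiffAt ℝ r R w → ContinuousAt β w := fun {w} hw => by
    have h1 : ContinuousAt (fderiv ℝ R) w :=
      (hw.fderiv_right (m := 0) (by
        rw [zero_add]; exact_mod_cast hr)).continuousAt
    exact (h1.clm_apply continuousAt_const).fst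
  set b : BJet r × Plane → ℝ := fun w => (fderiv ℝ w.1.field w.2 (1, 0)).2 with hb
  have hbc : Continuous b := ((BJet.continuous_fderiv_field hr).clm_apply continuous_const).snd
  have hevc : Continuous fun w : BJet r × Plane => w.1.field w.2 :=
    BJet.contDiff_field.continuous
  have hιf : ∀ V, fderiv ℝ ι X₀ V = (V, (fderiv ℝ p X₀ V, 0)) := fun V => by
    have := (hasFDerivAt_id (𝕜 := ℝ) X₀).prodMk
      ((hp.differentiableAt hr0).hasFDerivAt.prodMk (hasFDerivAt_const (0 : ℝ) X₀))
    rw [HasFDerivAt.fderiv (f := ι) this]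
    rfl
  have hιD : HasFDerivAt ι (fderiv ℝ ι X₀) X₀ := (hιd.differentiableAt hr0).hasFDerivAt
  -- Obtained by differentiating the identity `X²(p(X), 0) = 0` in the direction `V`.
  have hdp : ∀ V : BJet r, fderiv ℝ p X₀ V * (fderiv ℝ X₀.field (0, 0) (1, 0)).2 =
      -(V.field (0, 0)).2 := fun V => by
    have e1 : HasFDerivAt (fun X => ((ι X).1.field (ι X).2))
        (fderiv ℝ (fun w : BJet r × Plane => w.1.field w.2) (X₀, (0, 0)) ∘L fderiv ℝ ι X₀) X₀ := by
      refine HasFDerivAt.comp (g := fun w : BJet r × Plane => w.1.field w.2) X₀ ?_ hιD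
      rw [hι0]
      exact (BJet.contDiff_field.differentiable hr0 _).hasFDerivAt
    have e2 := ((ContinuousLinearMap.snd ℝ ℝ ℝ).hasFDerivAt.comp X₀ e1).congr_of_eventuallyEq
      (f₁ := fun _ => (0 : ℝ)) (hpz.mono fun X hX => hX.symm)
    have e3 := congrArg (fun A : BJet r →L[ℝ] ℝ => A V) (e2.unique (hasFDerivAt_const (0 : ℝ) X₀))
    simp only [ContinuousLinearMap.comp_apply, hιf, BJet.fderiv_field hr,
      zero_apply, ContinuousLinearMap.coe_snd', Prod.snd_add] at e3
    have e4 : ((fderiv ℝ p X₀ V, 0) : Plane) = fderiv ℝ p X₀ V • ((1, 0) : Plane) := by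
      ext <;> simp
    rw [e4, map_smul, Prod.smul_snd, smul_eq_mul] at e3
    linarith
  -- Here the fold does not move to first order. If the return abscissa did not either, the whole
  -- derivative of the return point would vanish, since the return point stays on the line. The
  -- variation of the flow would then cancel a multiple of `X`, so its cross product with `X` would
  -- be zero.
  have hdq : ∀ V : BJet r, (V.field (0, 0)).2 = 0 →
      (∀ t ∈ Ioo 0 T₀, 0 < cross (X₀.field (Φ (X₀, t, (0, 0)))) (V.field (Φ (X₀, t, (0, 0))))) →
      fderiv ℝ (fun X => (R (ι X)).1) X₀ V ≠ 0 := fun V hV0 hV hcon => by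
    have hp' : fderiv ℝ p X₀ V = 0 := by
      have := hdp V
      rw [hV0, neg_zero] at this
      exact (mul_eq_zero.1 this).resolve_right h.deriv_pos.ne'
    have hRιD := (hRι.differentiableAt hr0).hasFDerivAt
    have e1 : HasFDerivAt (fun X => (R (ι X)).1)
        (ContinuousLinearMap.fst ℝ ℝ ℝ ∘L fderiv ℝ (fun X => R (ι X)) X₀) X₀ :=
      (ContinuousLinearMap.fst ℝ ℝ ℝ).hasFDerivAt.comp X₀ hRιD
    have e2 : (fderiv ℝ (fun X => R (ι X)) X₀ V).2 = 0 := by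
      have := ((ContinuousLinearMap.snd ℝ ℝ ℝ).hasFDerivAt.comp X₀ hRιD).congr_of_eventuallyEq
        (f₁ := fun _ => (0 : ℝ)) ((hιt.eventually hτz).mono fun X hX => hX.symm)
      exact congrArg (fun A : BJet r →L[ℝ] ℝ => A V) (this.unique (hasFDerivAt_const (0 : ℝ) X₀))
    rw [e1.fderiv] at hcon
    have e3 : fderiv ℝ (fun X => R (ι X)) X₀ V = 0 := Prod.ext hcon e2
    have hτι : DifferentiableAt ℝ (fun X => τ (ι X)) X₀ := by
      refine DifferentiableAt.comp (g := τ) X₀ ?_ hιD.differentiableAt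
      rw [hι0]
      exact hτ.differentiableAt hr0
    have e4 : HasFDerivAt (fun X => (X, τ (ι X), (ι X).2))
        ((ContinuousLinearMap.id ℝ (BJet r)).prod ((fderiv ℝ (fun X => τ (ι X)) X₀).prod
          (ContinuousLinearMap.snd ℝ (BJet r) Plane ∘L fderiv ℝ ι X₀))) X₀ :=
      (hasFDerivAt_id X₀).prodMk (hτι.hasFDerivAt.prodMk hιD.snd)
    have hΦD : HasFDerivAt Φ (fderiv ℝ Φ (X₀, T₀, (0, 0))) (X₀, τ (ι X₀), (ι X₀).2) := by
      rw [hι0, hτ0]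
      exact (hΦ.contDiff.differentiable hr0 _).hasFDerivAt
    have e5 := HasFDerivAt.comp (g := Φ) X₀ hΦD e4
    rw [HasFDerivAt.fderiv (f := fun X => R (ι X)) e5] at e3
    have e6 : fderiv ℝ Φ (X₀, T₀, (0, 0)) (V, fderiv ℝ (fun X => τ (ι X)) X₀ V, 0) = 0 := by
      refine Eq.trans ?_ e3
      simp only [ContinuousLinearMap.comp_apply, ContinuousLinearMap.prod_apply, hιf, hp']
      rfl
    have e7 : (V, fderiv ℝ (fun X => τ (ι X)) X₀ V, (0 : Plane)) =
        (V, (0 : ℝ), (0 : Plane)) + (0, fderiv ℝ (fun X => τ (ι X)) X₀ V, 0) := by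
      simp
    rw [e7, map_add, hΦ.fderiv_time hr] at e6
    have e8 := hΦ.cross_fderiv_pos hr X₀ V (0, 0) h.time_pos hV
    rw [eq_neg_of_add_eq_zero_left e6] at e8
    simp only [cross, Prod.snd_neg, Prod.fst_neg, Prod.smul_fst, Prod.smul_snd, smul_eq_mul] at e8
    linarith
  refine ⟨p, fun X => (R (ι X)).1,
    fun X => -(β (ι X)) / ((ι X).1.field (ι X).2).1 * b (ι X) / 2, hp0, ?_, hp, hRι.fst, ?_, hdp, hdq,
    ?_⟩
  · simp only [hι0, hR0]
  · have hιc : ContinuousAt ι X₀ := hιd.continuousAt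
    have e1 : ContinuousAt (fun X => β (ι X)) X₀ := by
      refine ContinuousAt.comp (g := β) ?_ hιc
      rw [hι0]
      exact hβc hRd
    have e2 : ContinuousAt (fun X => ((ι X).1.field (ι X).2).1) X₀ :=
      (hevc.fst.continuousAt).comp hιc
    have e3 : ContinuousAt (fun X => b (ι X)) X₀ := hbc.continuousAt.comp hιc
    refine ((e1.neg.div e2 ?_).mul e3).div_const 2
    simp only [hι0]
    exact h.fst_pos.ne'
  · have hgood : ∀ᶠ w in 𝓝 (X₀, ((0, 0) : Plane)), 0 < (w.1.field w.2).1 ∧ 0 < b w :=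
      ((hevc.fst.tendsto _).eventually_const_lt h.fst_pos).and
        ((hbc.tendsto _).eventually_const_lt h.deriv_pos)
    -- The versions with `eventually_nhds` provide the identities on a neighbourhood of `(X, (p X,
    -- 0))`. They are needed at the nearby points `(x, 0)` in order to differentiate in `x`.
    filter_upwards [hpz, hιt.eventually hgood, hιt.eventually hret.eventually_nhds,
      hιt.eventually hconst.eventually_nhds, hιt.eventually hRev.eventually_nhds,
      hιt.eventually hgood.eventually_nhds] with X hXp hXg hXr hXc hXR hXg'
    have hseg : Tendsto (fun x : ℝ => (X, ((x, 0) : Plane))) (𝓝 (p X)) (𝓝 (ι X)) :=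
      (by fun_prop : Continuous fun x : ℝ => (X, ((x, 0) : Plane))).tendsto (p X)
    have hshift : Tendsto (fun s : ℝ => p X + s) (𝓝 0) (𝓝 (p X)) := by
      have : Continuous fun s : ℝ => p X + s := by fun_prop
      simpa using this.tendsto 0
    have hvd := X.hasDerivAt_field_snd hr (p X)
    have hq : R (ι X) = ((R (ι X)).1, 0) :=
      Prod.ext rfl (hXr.self_of_nhds rfl hXp.ge).apply_time
    refine ⟨hXp, hXg.1, hXg.2, ?_, ?_⟩
    · rw [← hq]
      exact (hXr.self_of_nhds rfl hXp.ge).snd_neg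
    obtain ⟨δ, hδ, hball⟩ := Metric.eventually_nhds_iff.1
      ((hvd.eventually_pos_of_pos hXp hXg.2).and ((hseg.comp hshift).eventually hXr))
    refine ⟨δ, hδ, fun s => (R (X, (p X + s, 0))).1, by simp [hι], fun s hs => ?_, ?_⟩
    · have hs' : dist s 0 < δ := by
        rw [Real.dist_eq, sub_zero, abs_of_nonneg hs.1]
        exact hs.2
      obtain ⟨h1, h2⟩ := hball hs'
      have h3 := h2 rfl (hs.1.eq_or_lt.elim (fun h => by simpa [← h] using hXp.ge) fun h => (h1 h).le)
      exact ⟨τ (X, (p X + s, 0)), h3.time_pos, Prod.ext rfl h3.apply_time, h3.pos, h3.mem⟩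
    set α : ℝ → ℝ := fun x => (fderiv ℝ R (X, (x, 0)) (0, (1, 0))).1 with hα
    set κ : ℝ → ℝ := fun x => -(β (X, (x, 0))) / (X.field (x, 0)).1 with hκ
    -- Constancy of `R` along the trajectory through `(x, 0)` gives `X¹ ∂ₓR + X² ∂ᵧR = 0`. So `∂ₓR`
    -- is the continuous factor `κ` times `X²`, which vanishes at the fold and is differentiable
    -- there. No second derivative of `R` is needed.
    have hακ : ∀ᶠ x in 𝓝 (p X), α x = κ x * (X.field (x, 0)).2 := by
      filter_upwards [hseg.eventually hXc, hseg.eventually hXR, hseg.eventually hXg'] with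
        x hx1 hx2 hx3
      have e1 : HasDerivAt (fun t : ℝ => (X, Φ (X, t, (x, 0)))) ((0 : BJet r), X.field (x, 0)) 0 := by
        have := (hasDerivAt_const (0 : ℝ) X).prodMk (hΦ.hasDerivAt X 0 (x, 0))
        rwa [hΦ.zero] at this
      have e2 : HasFDerivAt R (fderiv ℝ R (X, (x, 0))) (X, Φ (X, 0, (x, 0))) := by
        rw [hΦ.zero]
        exact (hx2.differentiableAt hr0).hasFDerivAt
      have e3 := e2.comp_hasDerivAt 0 e1
      replace e3 := e3.congr_of_eventuallyEq
        (f₁ := fun _ => R (X, (x, 0))) (hx1.mono fun t ht => ht.symm)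
      have e4 := e3.unique (hasDerivAt_const (0 : ℝ) (R (X, (x, 0))))
      have e5 : ((0 : BJet r), X.field (x, 0)) = (X.field (x, 0)).1 • ((0 : BJet r), ((1, 0) : Plane))
          + (X.field (x, 0)).2 • ((0 : BJet r), ((0, 1) : Plane)) := by
        ext <;> simp
      rw [e5, map_add, map_smul, map_smul] at e4
      have e6 := congrArg Prod.fst e4
      simp only [Prod.fst_add, Prod.smul_fst, smul_eq_mul, Prod.fst_zero] at e6
      simp only [hκ, hα, hβ]
      have : (X.field (x, 0)).1 ≠ 0 := hx3.1.ne'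
      field_simp
      linarith
    have hκc : ContinuousAt κ (p X) := by
      have e1 : ContinuousAt (fun x : ℝ => β (X, (x, 0))) (p X) :=
        ContinuousAt.comp (g := β) (hβc hXR.self_of_nhds) hseg
      have e2 : ContinuousAt (fun x : ℝ => (X.field (x, 0)).1) (p X) :=
        (hevc.fst.tendsto _).comp hseg
      exact e1.neg.div e2 hXg.1.ne'
    have hαd : HasDerivAt α (κ (p X) * b (ι X)) (p X) :=
      (hvd.mul_of_eq_zero hXp hκc).congr_of_eventuallyEq hακ
    have hα0 : α (p X) = 0 := by
      rw [hακ.self_of_nhds, hXp, mul_zero]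
    have hgd : ∀ᶠ x in 𝓝 (p X), HasDerivAt (fun x => (R (X, (x, 0))).1) (α x) x := by
      filter_upwards [hseg.eventually hXR] with x hx
      have e1 : HasDerivAt (fun x : ℝ => (X, ((x, 0) : Plane))) ((0 : BJet r), ((1, 0) : Plane)) x :=
        (hasDerivAt_const x X).prodMk ((hasDerivAt_id x).prodMk (hasDerivAt_const x 0))
      have e2 := (hx.differentiableAt hr0).hasFDerivAt.comp_hasDerivAt x e1
      exact e2.fst_plane
    exact sub_sub_isLittleO_sq hgd hαd hα0

end FirstReturn


/-! ### First returns of vector fields on an open set -/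

section Side

variable {r : ℕ} {U : Opens Plane}

theorem CrField.differentiableAt (hr : 1 ≤ r) (X : CrField r U) {z : Plane} (hz : z ∈ U) :
    DifferentiableAt ℝ X z :=
  (X.contDiffAt le_rfl hz).differentiableAt (by exact_mod_cast (by omega : r ≠ 0))

theorem lieLieH_of_lieH_eq_zero (hr : 1 ≤ r) (X : CrField r U) {z : Plane} (hz : z ∈ U)
    (h : lieH X z = 0) : lieLieH X z = (X z).1 * (fderiv ℝ X z (1, 0)).2 := by
  have h1 : HasFDerivAt (lieH X) (ContinuousLinearMap.snd ℝ ℝ ℝ ∘L fderiv ℝ X z) z :=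
    (ContinuousLinearMap.snd ℝ ℝ ℝ).hasFDerivAt.comp z (X.differentiableAt hr hz).hasFDerivAt
  have h2 : X z = (X z).1 • ((1, 0) : Plane) := by
    refine Prod.ext (by simp) ?_
    simpa [lieH] using h
  rw [lieLieH, h1.fderiv]
  conv_lhs => rw [h2]
  rw [map_smul]
  rfl

theorem Cutoff.fderiv_field_jetCLM (c : Cutoff U) {O : Set Plane} (hO : IsOpen O)
    (hc : ∀ z ∈ O, c.toFun z = 1) (X : CrField r U) {z : Plane} (hz : z ∈ O) :
    fderiv ℝ (c.jetCLM X).field z = fderiv ℝ X z := by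
  refine Filter.EventuallyEq.fderiv_eq ?_
  filter_upwards [hO.mem_nhds hz] with w hw
  rw [c.field_jetCLM, hc w hw, one_smul]

theorem Cutoff.field_jetCLM_of_mem (c : Cutoff U) {O : Set Plane}
    (hc : ∀ z ∈ O, c.toFun z = 1) (X : CrField r U) {z : Plane} (hz : z ∈ O) :
    (c.jetCLM X).field z = X z := by
  rw [c.field_jetCLM, hc z hz, one_smul]

theorem IsIntegralCurveOn.continuousOn_Icc {v : ℝ → Plane → Plane} {φ : ℝ → Plane} {a b : ℝ}
    (h : IsIntegralCurveOn φ v (Icc a b)) : ContinuousOn φ (Icc a b) :=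
  fun t ht => (h t ht).continuousWithinAt

theorem IsForwardArc.isCompact {X : CrField r U} {x q : ℝ} {G : Set Plane}
    (h : IsForwardArc X x q G) : IsCompact G := by
  obtain ⟨T, hT, φ, hφ, hU, h0, hTq, hpos, rfl⟩ := h
  exact isCompact_Icc.image_of_continuousOn hφ.continuousOn_Icc

theorem IsForwardArc.subset {X : CrField r U} {x q : ℝ} {G : Set Plane}
    (h : IsForwardArc X x q G) : G ⊆ U := by
  obtain ⟨T, hT, φ, hφ, hU, h0, hTq, hpos, rfl⟩ := h
  rintro _ ⟨t, ht, rfl⟩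
  exact hU t ht

/-- An arc that stays where a cutoff function is `1` is an orbit of the flow of the jet. -/
theorem IsForwardArc.exists_flow (hr : 1 ≤ r) {Φ : BJet r × ℝ × Plane → Plane}
    (hΦ : IsSmoothFlow Φ) (c : Cutoff U) {X : CrField r U} {x q : ℝ} {G : Set Plane}
    (h : IsForwardArc X x q G) (hG : ∀ z ∈ G, c.toFun z = 1) :
    ∃ T > 0, Φ (c.jetCLM X, T, (x, 0)) = (q, 0) ∧
      (∀ t ∈ Ioo 0 T, 0 < (Φ (c.jetCLM X, t, (x, 0))).2) ∧
      G = (fun t => Φ (c.jetCLM X, t, (x, 0))) '' Icc 0 T := by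
  obtain ⟨T, hT, φ, hφ, hU, h0, hTq, hpos, rfl⟩ := h
  have h1 : IsIntegralCurveOn φ (fun _ => (c.jetCLM X).field) (Icc 0 T) := fun t ht => by
    change HasDerivWithinAt φ ((c.jetCLM X).field (φ t)) (Icc 0 T) t
    rw [c.field_jetCLM_of_mem hG X ⟨t, ht, rfl⟩]
    exact hφ t ht
  have h2 : ∀ t ∈ Icc 0 T, φ t = Φ (c.jetCLM X, t, (x, 0)) := fun t ht => by
    rw [← h0]
    exact hΦ.eq_of_isIntegralCurveOn hr _ h1 ht
  refine ⟨T, hT, ?_, fun t ht => ?_, image_congr h2⟩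
  · rw [← h2 T (right_mem_Icc.2 hT.le), hTq]
  · rw [← h2 t (Ioo_subset_Icc_self ht)]
    exact hpos t ht

theorem IsForwardArc.of_flow {Φ : BJet r × ℝ × Plane → Plane}
    (hΦ : IsSmoothFlow Φ) (c : Cutoff U) {O : Set Plane} (hOU : O ⊆ U)
    (hc : ∀ z ∈ O, c.toFun z = 1) {X : CrField r U} {x q T : ℝ} (hT : 0 < T)
    (hTq : Φ (c.jetCLM X, T, (x, 0)) = (q, 0))
    (hpos : ∀ t ∈ Ioo 0 T, 0 < (Φ (c.jetCLM X, t, (x, 0))).2)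
    (hO : ∀ t ∈ Icc 0 T, Φ (c.jetCLM X, t, (x, 0)) ∈ O) :
    IsForwardArc X x q ((fun t => Φ (c.jetCLM X, t, (x, 0))) '' Icc 0 T) := by
  refine ⟨T, hT, _, fun t ht => ?_, fun t ht => hOU (hO t ht), hΦ.zero _ _, hTq, hpos, rfl⟩
  have := (hΦ.hasDerivAt (c.jetCLM X) t (x, 0)).hasDerivWithinAt (s := Icc 0 T)
  rwa [c.field_jetCLM_of_mem hc X (hO t ht)] at this

/-- The first return is unique. -/
theorem IsForwardArc.unique (hr : 1 ≤ r) {X : CrField r U} {x q q' : ℝ} {G G' : Set Plane}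
    (h : IsForwardArc X x q G) (h' : IsForwardArc X x q' G') : q = q' ∧ G = G' := by
  obtain ⟨Φ, hΦ⟩ := exists_isSmoothFlow (r := r) hr
  obtain ⟨c, O, -, hKO, -, hc⟩ := exists_cutoff (h.isCompact.union h'.isCompact)
    (union_subset h.subset h'.subset)
  obtain ⟨T, hT, hTq, hpos, hG⟩ := h.exists_flow hr hΦ c fun z hz => hc z (hKO (Or.inl hz))
  obtain ⟨T', hT', hTq', hpos', hG'⟩ := h'.exists_flow hr hΦ c fun z hz => hc z (hKO (Or.inr hz))
  have hTT : T = T' := by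
    rcases lt_trichotomy T T' with hlt | heq | hlt
    · have := hpos' T ⟨hT, hlt⟩
      rw [hTq] at this
      exact absurd this (lt_irrefl _)
    · exact heq
    · have := hpos T' ⟨hT', hlt⟩
      rw [hTq'] at this
      exact absurd this (lt_irrefl _)
  subst hTT
  exact ⟨congrArg Prod.fst (hTq.symm.trans hTq'), hG.trans hG'.symm⟩

theorem IsBackwardArc.unique (hr : 1 ≤ r) {Y : CrField r U} {x q q' : ℝ} {G G' : Set Plane}
    (h : IsBackwardArc Y x q G) (h' : IsBackwardArc Y x q' G') : q = q' ∧ G = G' := by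
  obtain ⟨h1, h2⟩ := ((isForwardArc_mirror Y x q G).2 h).unique hr
    ((isForwardArc_mirror Y x q' G').2 h')
  exact ⟨h1, reflect.injective.image_injective h2⟩

theorem HasDerivAt.nonpos_of_pos_left {y : ℝ → ℝ} {v T : ℝ} (hy : HasDerivAt y v T) (hT : 0 < T)
    (h0 : y T = 0) (hpos : ∀ t ∈ Ioo 0 T, 0 < y t) : v ≤ 0 := by
  have h1 : Tendsto (slope y T) (𝓝[<] T) (𝓝 v) :=
    (hasDerivAt_iff_tendsto_slope.1 hy).mono_left (nhdsWithin_mono _ fun t ht => ne_of_lt ht)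
  refine le_of_tendsto h1 ?_
  filter_upwards [Ioo_mem_nhdsLT hT] with t ht
  rw [slope_def_field, h0, sub_zero]
  exact div_nonpos_of_nonneg_of_nonpos (hpos t ht).le (by linarith [ht.2])

/-- Cramer's rule on two fixed vectors. For fixed `a` and `b` the nonvanishing of the determinant is
an open condition on `(f, g)`, so surjectivity at one field carries over to its neighbours. -/
theorem exists_apply_eq_of_det_ne_zero {E : Type*} [AddCommGroup E] [Module ℝ E] (f g : E →ₗ[ℝ] ℝ)
    {a b : E} (h : f a * g b - f b * g a ≠ 0) (w : ℝ × ℝ) : ∃ v, f v = w.1 ∧ g v = w.2 := by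
  set d := f a * g b - f b * g a with hd
  refine ⟨((w.1 * g b - f b * w.2) / d) • a + ((f a * w.2 - w.1 * g a) / d) • b, ?_, ?_⟩ <;>
  · simp only [map_add, map_smul, smul_eq_mul]
    field_simp
    rw [hd]
    ring

/-- `(p, 0)` is the only tangency point of `X` in `A`, it is a visible fold with `X¹ > 0`, and the
trajectories of `X` from `(p + s, 0)`, for small `s ≥ 0`, return to `y = 0` inside `A`, at
`q + m s² + o(s²)`. -/
structure IsSideReturn (A : Set Plane) (X : CrField r U) (p q m : ℝ) : Prop where
  mem : ((p, 0) : Plane) ∈ A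
  isVisibleFold : IsVisibleFoldAbove X (p, 0)
  fst_pos : 0 < (X (p, 0)).1
  eq_of_lieH : ∀ x : ℝ, (x, 0) ∈ A → lieH X (x, 0) = 0 → x = p
  lieH_neg : lieH X (q, 0) < 0
  exists_arc : ∃ δ > 0, ∃ (ξ : ℝ → ℝ) (G : ℝ → Set Plane), ξ 0 = q ∧
    (∀ s ∈ Ico 0 δ, IsForwardArc X (p + s) (ξ s) (G s) ∧ G s ⊆ A) ∧
    (fun s => ξ s - q - m * s ^ 2) =o[𝓝 0] (fun s : ℝ => s ^ 2)

/-- The constant field `(0, 1)` on `U`. -/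
def verticalField (r : ℕ) (U : Opens Plane) : CrField r U :=
  ⟨(U : Set Plane).indicator fun _ => (0, 1),
    contDiffOn_const.congr fun _ hz => indicator_of_mem hz _,
    fun _ hz => indicator_of_notMem hz _⟩

/-- The field `X` rotated by a right angle and multiplied by `|z|²`. -/
def rotatedField (X : CrField r U) : CrField r U :=
  ⟨fun z => (z.1 ^ 2 + z.2 ^ 2) • ((-(X z).2, (X z).1) : Plane), by
    have h1 : ContDiffOn ℝ r (fun z : Plane => z.1 ^ 2 + z.2 ^ 2) U := by fun_prop
    exact h1.smul ((contDiff_snd.comp_contDiffOn X.2.1).neg.prodMk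
      (contDiff_fst.comp_contDiffOn X.2.1)), fun z hz => by
    have : X z = 0 := X.2.2 z hz
    simp [this]⟩

theorem rotatedField_apply (X : CrField r U) (z : Plane) :
    rotatedField X z = (z.1 ^ 2 + z.2 ^ 2) • ((-(X z).2, (X z).1) : Plane) := rfl

/-- Transfers the results for bounded fields to fields on `U`: a cutoff equal to `1` near everything
relevant changes neither the folds nor the arcs in `A`. The tangency in `A` is unique because `X²`
is strictly increasing for `|x| ≤ δ₀` and, by compactness, has no zero in the rest of `closure A` on
the line. -/
theorem exists_isSideReturn (hr : 1 ≤ r) {X₀ : CrField r U} {q₀ δ₀ : ℝ} {G₀ A : Set Plane}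
    (hfold : IsVisibleFoldAbove X₀ (0, 0)) (hfst : 0 < (X₀ (0, 0)).1)
    (harc : IsForwardArc X₀ 0 q₀ G₀) (hq : lieH X₀ (q₀, 0) ≠ 0)
    (hA : IsOpen A) (hGA : G₀ ⊆ A) (hAc : IsCompact (closure A)) (hAU : closure A ⊆ U)
    (hδ₀ : 0 < δ₀)
    (hδ : ∀ x : ℝ, |x| ≤ δ₀ → ((x, 0) : Plane) ∈ U ∧ 0 < (fderiv ℝ X₀ (x, 0) (1, 0)).2)
    (hδ' : ∀ x : ℝ, ((x, 0) : Plane) ∈ closure A → δ₀ ≤ |x| → lieH X₀ (x, 0) ≠ 0) :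
    ∃ (L : CrField r U →L[ℝ] BJet r) (O : Set (BJet r)) (p q m : BJet r → ℝ),
      IsOpen O ∧ L X₀ ∈ O ∧ ContDiffOn ℝ r p O ∧ ContDiffOn ℝ r q O ∧ ContinuousAt m (L X₀) ∧
      p (L X₀) = 0 ∧ q (L X₀) = q₀ ∧
      (∀ X, L X ∈ O → IsSideReturn A X (p (L X)) (q (L X)) (m (L X))) ∧
      ∀ n ∈ O, ∀ w : ℝ × ℝ, ∃ V : CrField r U,
        fderiv ℝ p n (L V) = w.1 ∧ fderiv ℝ q n (L V) = w.2 := by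
  obtain ⟨Φ, hΦ⟩ := exists_isSmoothFlow (r := r) hr
  -- The cutoff has to be `1` on the entire segment and not only on `A`: the trace of `A` on the
  -- line may be disconnected, and the monotonicity argument runs over the whole segment.
  have hseg : IsCompact ((fun x : ℝ => ((x, 0) : Plane)) '' Icc (-δ₀) δ₀) :=
    isCompact_Icc.image (by fun_prop)
  obtain ⟨c, O₁, hO₁, hKO, hOU, hc⟩ := exists_cutoff (U := U) (hAc.union hseg)
    (union_subset hAU (by
      rintro _ ⟨x, hx, rfl⟩
      exact (hδ x (abs_le.2 hx)).1))
  have hAO : A ⊆ O₁ := subset_closure.trans (subset_union_left.trans hKO)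
  have hsegO : ∀ x : ℝ, |x| ≤ δ₀ → ((x, 0) : Plane) ∈ O₁ := fun x hx =>
    hKO (Or.inr ⟨x, abs_le.1 hx, rfl⟩)
  obtain ⟨T₀, hT₀, hTq, hpos, hG₀⟩ := harc.exists_flow hr hΦ c fun z hz => hc z (hAO (hGA hz))
  have hmemA : ∀ t ∈ Icc 0 T₀, Φ (c.jetCLM X₀, t, (0, 0)) ∈ A := fun t ht =>
    hGA (by rw [hG₀]; exact ⟨t, ht, rfl⟩)
  have h0O : ((0, 0) : Plane) ∈ O₁ := hsegO 0 (by simpa using hδ₀.le)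
  have hqA : ((q₀, 0) : Plane) ∈ A := by
    rw [← hTq]
    exact hmemA T₀ (right_mem_Icc.2 hT₀.le)
  have horb : IsFoldOrbit Φ A (c.jetCLM X₀) T₀ q₀ := by
    refine ⟨?_, ?_, ?_, hT₀, hTq, ?_, hpos, hA, hmemA⟩
    · rw [c.field_jetCLM_of_mem hc X₀ h0O]
      exact hfold.2.2.1
    · rwa [c.field_jetCLM_of_mem hc X₀ h0O]
    · rw [c.fderiv_field_jetCLM hO₁ hc X₀ h0O]
      exact (hδ 0 (by simpa using hδ₀.le)).2
    · have h1 := (hΦ.hasDerivAt_snd (c.jetCLM X₀) T₀ (0, 0)).nonpos_of_pos_left hT₀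
        (by rw [hTq]) hpos
      rw [hTq, c.field_jetCLM_of_mem hc X₀ (hAO hqA)] at h1
      rw [c.field_jetCLM_of_mem hc X₀ (hAO hqA)]
      exact lt_of_le_of_ne h1 hq
  obtain ⟨p, q, m, hp0, hq0, hp, hqd, hm, hdp, hdq, hev⟩ := horb.exists_isFoldReturn hr hΦ
  set n₀ := c.jetCLM X₀ with hn₀
  have hr0 : (r : WithTop ℕ∞) ≠ 0 := by exact_mod_cast (by omega : r ≠ 0)
  have hu1 : ∀ᶠ n : BJet r in 𝓝 n₀, ∀ x ∈ Icc (-δ₀) δ₀, 0 < (fderiv ℝ n.field (x, 0) (1, 0)).2 := by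
    refine isCompact_Icc.eventually_forall_of_forall_eventually fun x hx => ?_
    have hcont : Continuous fun v : BJet r × ℝ => (fderiv ℝ v.1.field (v.2, 0) (1, 0)).2 :=
      (((BJet.continuous_fderiv_field hr).comp (by fun_prop : Continuous
        fun v : BJet r × ℝ => (v.1, ((v.2, 0) : Plane)))).clm_apply continuous_const).snd
    refine (hcont.tendsto (n₀, x)).eventually_const_lt ?_
    rw [hn₀, c.fderiv_field_jetCLM hO₁ hc X₀ (hsegO x (abs_le.2 hx))]
    exact (hδ x (abs_le.2 hx)).2
  have hK2 : IsCompact {x : ℝ | ((x, 0) : Plane) ∈ closure A ∧ δ₀ ≤ |x|} := by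
    have h1 : IsCompact {z : Plane | z ∈ closure A ∧ (z.2 = 0 ∧ δ₀ ≤ |z.1|)} :=
      hAc.inter_right ((isClosed_eq continuous_snd continuous_const).inter
        (isClosed_le continuous_const continuous_fst.abs))
    convert h1.image continuous_fst using 1
    ext x
    constructor
    · rintro ⟨h2, h3⟩
      exact ⟨(x, 0), ⟨h2, rfl, h3⟩, rfl⟩
    · rintro ⟨⟨x', y⟩, ⟨h2, h3, h4⟩, rfl⟩
      simp only at h3
      subst h3
      exact ⟨h2, h4⟩
  have hu2 : ∀ᶠ n : BJet r in 𝓝 n₀, ∀ x ∈ {x : ℝ | ((x, 0) : Plane) ∈ closure A ∧ δ₀ ≤ |x|},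
      (n.field (x, 0)).2 ≠ 0 := by
    refine hK2.eventually_forall_of_forall_eventually fun x hx => ?_
    have hcont : Continuous fun v : BJet r × ℝ => (v.1.field (v.2, 0)).2 :=
      (BJet.contDiff_field.continuous.comp (by fun_prop : Continuous
        fun v : BJet r × ℝ => (v.1, ((v.2, 0) : Plane)))).snd
    refine (hcont.tendsto (n₀, x)).eventually_ne ?_
    rw [hn₀, c.field_jetCLM_of_mem hc X₀ (hKO (Or.inl hx.1))]
    exact hδ' x hx.1 hx.2
  have hu3 : ∀ᶠ n in 𝓝 n₀, |p n| < δ₀ := by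
    have := hp.continuousAt.abs.tendsto.eventually_lt_const (u := δ₀) (by simpa [hp0] using hδ₀)
    exact this
  set V₁ := c.jetCLM (verticalField r U) with hV₁
  set V₂ := c.jetCLM (rotatedField X₀) with hV₂
  -- The matrix is triangular. The vertical field `V₁` moves the fold. The factor `|z|²` makes `V₂`
  -- vanish at the fold, so `V₂` does not move it, but it moves the return since `X ∧ V₂ = |z|² |X|²
  -- > 0` on the open arc.
  have hdet : fderiv ℝ p n₀ V₁ * fderiv ℝ q n₀ V₂ - fderiv ℝ p n₀ V₂ * fderiv ℝ q n₀ V₁ ≠ 0 := by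
    have e1 : fderiv ℝ p n₀ V₁ ≠ 0 := fun h => by
      have := hdp V₁
      rw [h, zero_mul, hV₁, c.field_jetCLM_of_mem hc _ h0O] at this
      have h2 : verticalField r U (0, 0) = (0, 1) :=
        indicator_of_mem (s := (U : Set Plane)) (f := fun _ => ((0, 1) : Plane)) (hOU h0O)
      rw [h2] at this
      norm_num at this
    have e0 : (V₂.field (0, 0)).2 = 0 := by
      rw [hV₂, c.field_jetCLM_of_mem hc _ h0O, rotatedField_apply]
      simp
    have e2 : fderiv ℝ p n₀ V₂ = 0 := by
      have := hdp V₂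
      rw [e0, neg_zero] at this
      exact (mul_eq_zero.1 this).resolve_right horb.deriv_pos.ne'
    have e3 : fderiv ℝ q n₀ V₂ ≠ 0 := by
      refine hdq V₂ e0 fun t ht => ?_
      have hy := hpos t ht
      have hne := hΦ.field_ne_zero hr (X := n₀) (z := (0, 0))
        (fun h => horb.fst_pos.ne' (by rw [h]; rfl)) t
      have hO := hAO (hmemA t (Ioo_subset_Icc_self ht))
      set z := Φ (n₀, t, (0, 0)) with hz
      rw [hn₀, hV₂, c.field_jetCLM_of_mem hc _ hO, c.field_jetCLM_of_mem hc _ hO,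
        rotatedField_apply]
      rw [hn₀, c.field_jetCLM_of_mem hc _ hO] at hne
      have h1 : 0 < (X₀ z).1 ^ 2 + (X₀ z).2 ^ 2 := by
        rcases ne_or_eq (X₀ z).1 0 with h | h
        · positivity
        · have : (X₀ z).2 ≠ 0 := fun h' => hne (Prod.ext h h')
          positivity
      have h2 : 0 < z.1 ^ 2 + z.2 ^ 2 := by positivity
      have h3 := mul_pos h2 h1
      simp only [cross, Prod.smul_fst, Prod.smul_snd, smul_eq_mul]
      linarith [h3]
    rw [e2, zero_mul, sub_zero]
    exact mul_ne_zero e1 e3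
  have hdet' : ∀ᶠ n in 𝓝 n₀,
      fderiv ℝ p n V₁ * fderiv ℝ q n V₂ - fderiv ℝ p n V₂ * fderiv ℝ q n V₁ ≠ 0 := by
    have hcp : ContinuousAt (fderiv ℝ p) n₀ :=
      (hp.fderiv_right (m := 0) (by rw [zero_add]; exact_mod_cast hr)).continuousAt
    have hcq : ContinuousAt (fderiv ℝ q) n₀ :=
      (hqd.fderiv_right (m := 0) (by rw [zero_add]; exact_mod_cast hr)).continuousAt
    have hcont : ContinuousAt (fun n =>
        fderiv ℝ p n V₁ * fderiv ℝ q n V₂ - fderiv ℝ p n V₂ * fderiv ℝ q n V₁) n₀ :=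
      ((hcp.clm_apply continuousAt_const).mul (hcq.clm_apply continuousAt_const)).sub
        ((hcp.clm_apply continuousAt_const).mul (hcq.clm_apply continuousAt_const))
    exact hcont.eventually_ne hdet
  have hall := ((hu1.and hu2).and (hu3.and hdet')).and
    (hev.and ((hp.eventually (by simp)).and (hqd.eventually (by simp))))
  obtain ⟨O, hO, hOo, hnO⟩ := eventually_nhds_iff.1 hall
  refine ⟨c.jetCLM, O, p, q, m, hOo, hnO, fun n hn => ((hO n hn).2.2.1).contDiffWithinAt,
    fun n hn => ((hO n hn).2.2.2).contDiffWithinAt, hm, hp0, hq0, fun X hX => ?_,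
    fun n hn w => ?_⟩
  · obtain ⟨⟨⟨h1, h2⟩, h3, -⟩, h4, -⟩ := hO _ hX
    set n := c.jetCLM X with hn
    obtain ⟨δ, hδ, ξ, hξ0, hξ, hξo⟩ := h4.exists_return
    have hpO := hsegO (p n) h3.le
    have hpA : ((p n, 0) : Plane) ∈ A := by
      obtain ⟨T, hT, -, -, h5⟩ := hξ 0 ⟨le_rfl, hδ⟩
      have := h5 0 ⟨le_rfl, hT.le⟩
      rwa [hΦ.zero, add_zero] at this
    have hqA : ((q n, 0) : Plane) ∈ A := by
      obtain ⟨T, hT, h6, -, h5⟩ := hξ 0 ⟨le_rfl, hδ⟩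
      have := h5 T ⟨hT.le, le_rfl⟩
      rwa [h6, hξ0] at this
    have hf : X (p n, 0) = n.field (p n, 0) := (c.field_jetCLM_of_mem hc X hpO).symm
    have hl0 : lieH X (p n, 0) = 0 := by
      rw [lieH, hf]
      exact h4.snd_eq_zero
    have hf1 : 0 < (X (p n, 0)).1 := by
      rw [hf]
      exact h4.fst_pos
    refine ⟨hpA, ⟨hOU hpO, rfl, hl0, ?_⟩, hf1, fun x hx hx0 => ?_, ?_, ?_⟩
    · rw [lieLieH_of_lieH_eq_zero hr X (hOU hpO) hl0,
        ← c.fderiv_field_jetCLM hO₁ hc X hpO]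
      exact mul_pos hf1 h4.deriv_pos
    · have hx0' : (n.field (x, 0)).2 = 0 := by
        rw [hn, c.field_jetCLM_of_mem hc X (hAO hx)]
        exact hx0
      have hxδ : |x| < δ₀ := by
        by_contra hcon
        exact h2 x ⟨subset_closure hx, not_lt.1 hcon⟩ hx0'
      have hmono : StrictMonoOn (fun x => (n.field (x, 0)).2) (Icc (-δ₀) δ₀) := by
        refine strictMonoOn_of_deriv_pos (convex_Icc _ _)
          (fun x _ => (n.hasDerivAt_field_snd hr x).continuousAt.continuousWithinAt) fun x hx => ?_
        rw [interior_Icc] at hx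
        rw [(n.hasDerivAt_field_snd hr x).deriv]
        exact h1 x (Ioo_subset_Icc_self hx)
      exact hmono.injOn (abs_le.1 hxδ.le) (abs_le.1 h3.le) (hx0'.trans h4.snd_eq_zero.symm)
    · rw [lieH, ← c.field_jetCLM_of_mem hc X (hAO hqA)]
      exact h4.snd_neg
    · choose! T hT hTq' hpos' hmem' using hξ
      refine ⟨δ, hδ, ξ, fun s => (fun t => Φ (n, t, (p n + s, 0))) '' Icc 0 (T s), hξ0,
        fun s hs => ⟨IsForwardArc.of_flow hΦ c hOU hc (hT s hs) (hTq' s hs) (hpos' s hs)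
          fun t ht => hAO (hmem' s hs t ht), ?_⟩, hξo⟩
      rintro _ ⟨t, ht, rfl⟩
      exact hmem' s hs t ht
  · have h1 := (hO n hn).1.2.2
    exact exists_apply_eq_of_det_ne_zero
      ((fderiv ℝ p n ∘L c.jetCLM : CrField r U →L[ℝ] ℝ) : CrField r U →ₗ[ℝ] ℝ)
      ((fderiv ℝ q n ∘L c.jetCLM : CrField r U →L[ℝ] ℝ) : CrField r U →ₗ[ℝ] ℝ)
      (a := verticalField r U) (b := rotatedField X₀) h1 w

end Side


/-! ### Functions and submanifolds that factor through a Banach space -/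

section TVS

/-- The remainder is small compared with `L (x' - x)`, and a continuous linear map is of the order
of its argument, also when the source is only a topological vector space. -/
theorem HasFDerivAt.comp_clm_tvs {E N G : Type*} [AddCommGroup E] [Module ℝ E] [TopologicalSpace E]
    [NormedAddCommGroup N] [NormedSpace ℝ N] [NormedAddCommGroup G] [NormedSpace ℝ G]
    (L : E →L[ℝ] N) {g : N → G} {g' : N →L[ℝ] G} {x : E} (h : HasFDerivAt g g' (L x)) :
    HasFDerivAt (fun x => g (L x)) (g' ∘L L) x := by
  refine .of_isLittleOTVS ?_
  have h2 := h.isLittleOTVS.comp_tendsto (L.continuous.tendsto x)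
  have h3 : ((fun x' : N => x' - L x) ∘ L) = L ∘ fun x' : E => x' - x := by
    funext x'
    simp
  rw [h3] at h2
  have h4 := h2.trans_isBigOTVS L.isBigOTVS_comp
  refine h4.congr_left fun x' => ?_
  simp

/-- The shape `c + A x + j (g (L x))` reproduces itself under directional derivatives: the
derivative is `A v + j (Dg(L x)(L v))`, of the same shape for `L × L`. It covers both `η`, with `A =
0`, and the straightening charts, with `A` the identity. -/
theorem isCrOn_add_comp (n : ℕ) {F G : Type*} [AddCommGroup F] [Module ℝ F] [TopologicalSpace F]
    [IsTopologicalAddGroup F] [ContinuousSMul ℝ F] [NormedAddCommGroup G] [NormedSpace ℝ G]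
    (j : G →L[ℝ] F) :
    ∀ {E N : Type*} [AddCommGroup E] [Module ℝ E] [TopologicalSpace E]
      [NormedAddCommGroup N] [NormedSpace ℝ N] (c : F) (A : E →L[ℝ] F) (L : E →L[ℝ] N) {g : N → G}
      {O : Set N}, IsOpen O → ContDiffOn ℝ n g O →
      IsCrOn n (fun x => c + A x + j (g (L x))) (L ⁻¹' O) := by
  induction n with
  | zero =>
    intro E N _ _ _ _ _ c A L g O hO hg
    exact (continuousOn_const.add A.continuous.continuousOn).add
      (j.continuous.comp_continuousOn (hg.continuousOn.comp L.continuous.continuousOn fun _ h => h))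
  | succ n ih =>
    intro E N _ _ _ _ _ c A L g O hO hg
    refine ⟨(continuousOn_const.add A.continuous.continuousOn).add
      (j.continuous.comp_continuousOn (hg.continuousOn.comp L.continuous.continuousOn fun _ h => h)),
      fun w => 0 + (A ∘L .snd ℝ E E) w +
        j ((fun w : N × N => fderiv ℝ g w.1 w.2) ((L.prodMap L) w)), fun x hx v => ?_, ?_⟩
    · have h1 : HasFDerivAt g (fderiv ℝ g (L x)) (L x) :=
        ((hg.contDiffAt (hO.mem_nhds hx)).differentiableAt (by simp)).hasFDerivAt
      have h2 := (h1.hasLineDerivAt (L v)).tendsto_slope_zero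
      have h3 := (tendsto_const_nhds (x := A v)).add ((j.continuous.tendsto _).comp h2)
      have h4 : (0 : F) + (A ∘L .snd ℝ E E) (x, v) + j (fderiv ℝ g (L x) (L v)) =
          A v + j (fderiv ℝ g (L x) (L v)) := by
        rw [zero_add]
        rfl
      change Tendsto _ _ (𝓝 ((0 : F) + (A ∘L .snd ℝ E E) (x, v) + j (fderiv ℝ g (L x) (L v))))
      rw [h4]
      refine h3.congr' ?_
      filter_upwards [self_mem_nhdsWithin] with t ht
      have e1 : t⁻¹ • t • A v = A v := by
        rw [smul_smul, inv_mul_cancel₀ ht, one_smul]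
      simp only [map_add, map_smul, Function.comp_apply, map_sub, smul_sub]
      have e2 : c + (A x + t • A v) + j (g (L x + t • L v)) - (c + A x + j (g (L x))) =
        t • A v + (j (g (L x + t • L v)) - j (g (L x))) := by abel
      rw [← smul_sub, ← smul_sub, e2, smul_add, e1]
    · have h1 : ContDiffOn ℝ n (fun w : N × N => fderiv ℝ g w.1 w.2) (O ×ˢ univ) := by
        have h2 : ContDiffOn ℝ n (fderiv ℝ g) O := hg.fderiv_of_isOpen hO (by norm_cast)
        exact (h2.comp contDiffOn_fst fun w hw => hw.1).clm_apply contDiffOn_snd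
      have h2 := ih (0 : F) (A ∘L .snd ℝ E E) (L.prodMap L) (hO.prod isOpen_univ) h1
      convert h2 using 1
      ext w
      simp

theorem isCrOn_comp (n : ℕ) {E N G : Type*} [NormedAddCommGroup G] [NormedSpace ℝ G]
    [AddCommGroup E] [Module ℝ E] [TopologicalSpace E] [NormedAddCommGroup N] [NormedSpace ℝ N]
    (L : E →L[ℝ] N) {g : N → G} {O : Set N} (hO : IsOpen O) (hg : ContDiffOn ℝ n g O) :
    IsCrOn n (fun x => g (L x)) (L ⁻¹' O) := by
  have := isCrOn_add_comp n (ContinuousLinearMap.id ℝ G) (0 : G) (0 : E →L[ℝ] G) L hO hg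
  simpa using this

/-- The zero set of a submersion that factors through a Banach space. -/
theorem isSubmanifoldOfCodim_preimage {n : ℕ} (hn : 1 ≤ n) {E N : Type*}
    [AddCommGroup E] [Module ℝ E] [TopologicalSpace E] [IsTopologicalAddGroup E]
    [ContinuousSMul ℝ E] [NormedAddCommGroup N] [NormedSpace ℝ N] [CompleteSpace N]
    (L : E →L[ℝ] N) {g : N → ℝ × ℝ} {O : Set N} (hO : IsOpen O) (hg : ContDiffOn ℝ n g O)
    (hsurj : ∀ x, L x ∈ O → ∀ w, ∃ v, fderiv ℝ g (L x) (L v) = w) :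
    IsSubmanifoldOfCodim n 2 {x : E | L x ∈ O ∧ g (L x) = 0} := by
  rintro z ⟨hzO, hz0⟩
  have hn0 : (n : WithTop ℕ∞) ≠ 0 := by exact_mod_cast (by omega : n ≠ 0)
  set D := fderiv ℝ g (L z) with hD
  set DL : E →L[ℝ] ℝ × ℝ := D ∘L L with hDL
  have hDLs : Function.Surjective DL := hsurj z hzO
  -- A linear right inverse on the finite-dimensional space `ℝ × ℝ` is automatically continuous, so
  -- the kernel of `DL` is complemented in `E`.
  obtain ⟨j₀, hj₀⟩ := (DL : E →ₗ[ℝ] ℝ × ℝ).exists_rightInverse_of_surjective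
    (LinearMap.range_eq_top.2 hDLs)
  set j : ℝ × ℝ →L[ℝ] E := LinearMap.toContinuousLinearMap j₀ with hj
  have hDj : ∀ w, D (L (j w)) = w := fun w => LinearMap.congr_fun hj₀ w
  -- The nonlinear part of `g`, with zero derivative at `L z`. The chart will be `x ↦ x - z + j (h
  -- (L x))`. The map `L` carries it to `ψ`, whose derivative at `L z` is the identity, so the
  -- inverse function theorem is needed only in `N`.
  set h : N → ℝ × ℝ := fun x => g x - D (x - L z) with hh
  have hhO : ContDiffOn ℝ n h O := hg.sub (by fun_prop)
  have hgz : ContDiffAt ℝ n g (L z) := hg.contDiffAt (hO.mem_nhds hzO)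
  have hhz : HasFDerivAt h (0 : N →L[ℝ] ℝ × ℝ) (L z) := by
    have e1 := (hgz.differentiableAt hn0).hasFDerivAt
    have e2 : HasFDerivAt (fun x => D (x - L z)) D (L z) :=
      D.hasFDerivAt.comp (L z) ((hasFDerivAt_id (L z)).sub_const (L z))
    exact (e1.sub e2).congr_fderiv (sub_self _)
  set ψ : N → N := fun x => (x - L z) + (L ∘L j) (h x) with hψ
  have hψO : ContDiffOn ℝ n ψ O :=
    (contDiffOn_id.sub contDiffOn_const).add ((L ∘L j).contDiff.comp_contDiffOn hhO)
  have hψz : ContDiffAt ℝ n ψ (L z) := hψO.contDiffAt (hO.mem_nhds hzO)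
  have hψ' : HasFDerivAt ψ ((ContinuousLinearEquiv.refl ℝ N : N ≃L[ℝ] N) : N →L[ℝ] N) (L z) := by
    have e1 := ((hasFDerivAt_id (𝕜 := ℝ) (L z)).sub_const (L z)).add
      ((L ∘L j).hasFDerivAt.comp (L z) hhz)
    refine e1.congr_fderiv ?_
    ext v
    simp
  set Ψ := hψz.toOpenPartialHomeomorph ψ hψ' hn0 with hΨ
  have hΨc : ∀ x, Ψ x = ψ x := fun _ => rfl
  -- The local inverse is known to be smooth only near `ψ (L z)`. The chart domain is cut down
  -- accordingly, and also to `O`.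
  have hsymm : ∀ᶠ w in 𝓝 (ψ (L z)), ContDiffAt ℝ n Ψ.symm w :=
    (hψz.to_localInverse hψ' hn0).eventually (by simp)
  obtain ⟨T, hT, hTo, hTz⟩ := eventually_nhds_iff.1 hsymm
  have hs : IsOpen (Ψ.source ∩ (O ∩ Ψ ⁻¹' T)) := by
    rw [← inter_assoc, inter_comm Ψ.source, inter_assoc]
    exact hO.inter (Ψ.isOpen_inter_preimage hTo)
  set Ψ' := Ψ.restrOpen _ hs with hΨ'
  have hsource : ∀ {x}, x ∈ Ψ'.source → x ∈ O ∧ ψ x ∈ T := fun {x} hx => by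
    have := hx.2
    exact ⟨this.2.1, this.2.2⟩
  have hzs : L z ∈ Ψ'.source :=
    ⟨hψz.mem_toOpenPartialHomeomorph_source hψ' hn0,
      hψz.mem_toOpenPartialHomeomorph_source hψ' hn0, hzO, hTz⟩
  have hψ1 : ∀ {x}, x ∈ Ψ'.source → ψ x ∈ Ψ'.target := fun hx => Ψ'.map_source hx
  have hψ2 : ∀ {w}, w ∈ Ψ'.target → Ψ'.symm w ∈ Ψ'.source := fun hx => Ψ'.map_target hx
  have hψ3 : ∀ {x}, x ∈ Ψ'.source → Ψ'.symm (ψ x) = x := fun hx => Ψ'.left_inv hx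
  have hψ4 : ∀ {w}, w ∈ Ψ'.target → ψ (Ψ'.symm w) = w := fun hx => Ψ'.right_inv hx
  have hsO : ContDiffOn ℝ n h Ψ'.source := hhO.mono fun x hx => (hsource hx).1
  have hsymmO : ContDiffOn ℝ n Ψ'.symm Ψ'.target := fun w hw => by
    have h1 := (hsource (hψ2 hw)).2
    rw [hψ4 hw] at h1
    exact (hT w h1).contDiffWithinAt
  have hsT : ContDiffOn ℝ n (fun w => h (Ψ'.symm w)) Ψ'.target :=
    hsO.comp hsymmO fun w hw => hψ2 hw
  set fwd : E → E := fun x => -z + ContinuousLinearMap.id ℝ E x + j (h (L x)) with hfwd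
  -- To invert `fwd` one has to know only `L x`, because the correction depends on `x` through `L
  -- x`, and `L x` is recovered from `L w` by the inverse of `ψ`.
  set bwd : E → E := fun w => z + ContinuousLinearMap.id ℝ E w + (-j) (h (Ψ'.symm (L w))) with hbwd
  have hLf : ∀ x, L (fwd x) = ψ (L x) := fun x => by
    simp only [hfwd, hψ, map_add, map_neg, ContinuousLinearMap.id_apply,
      ContinuousLinearMap.comp_apply]
    abel
  have hLb : ∀ {w}, L w ∈ Ψ'.target → L (bwd w) = Ψ'.symm (L w) := fun {w} hw => by
    have e1 := hψ4 hw
    simp only [hψ, ContinuousLinearMap.comp_apply] at e1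
    simp only [hbwd, map_add, ContinuousLinearMap.id_apply, neg_apply, map_neg]
    nth_rewrite 1 [← e1]
    abel
  have hfwdC : IsCrOn n fwd (L ⁻¹' Ψ'.source) :=
    isCrOn_add_comp n j (-z) (.id ℝ E) L Ψ'.open_source hsO
  have hbwdC : IsCrOn n bwd (L ⁻¹' Ψ'.target) :=
    isCrOn_add_comp n (-j) z (.id ℝ E) L Ψ'.open_target hsT
  have hcont : ∀ {f : E → E} {s : Set E}, IsCrOn n f s → ContinuousOn f s := fun {f s} hf => by
    cases n with
    | zero => exact hf
    | succ n => exact hf.1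
  let Θ : OpenPartialHomeomorph E E :=
    { toFun := fwd
      invFun := bwd
      source := L ⁻¹' Ψ'.source
      target := L ⁻¹' Ψ'.target
      map_source' := fun x hx => by
        rw [mem_preimage, hLf]
        exact hψ1 hx
      map_target' := fun w hw => by
        rw [mem_preimage, hLb hw]
        exact hψ2 hw
      left_inv' := fun x hx => by
        simp only [hbwd, hLf, hψ3 hx]
        simp only [hfwd, ContinuousLinearMap.id_apply, neg_apply]
        abel
      right_inv' := fun w hw => by
        simp only [hfwd, hLb hw]
        simp only [hbwd, ContinuousLinearMap.id_apply, neg_apply]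
        abel
      open_source := Ψ'.open_source.preimage L.continuous
      open_target := Ψ'.open_target.preimage L.continuous
      continuousOn_toFun := hcont hfwdC
      continuousOn_invFun := hcont hbwdC }
  have hquot : (E ⧸ LinearMap.ker (DL : E →ₗ[ℝ] ℝ × ℝ)) ≃ₗ[ℝ] ℝ × ℝ :=
    (DL : E →ₗ[ℝ] ℝ × ℝ).quotKerEquivOfSurjective hDLs
  refine ⟨Θ, LinearMap.ker (DL : E →ₗ[ℝ] ℝ × ℝ), hzs, hfwdC, hbwdC, ?_, ?_, ?_, fun x hx => ?_⟩
  · exact isClosed_singleton.preimage DL.continuous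
  · exact Module.Finite.equiv hquot.symm
  · rw [hquot.finrank_eq]
    simp
  -- In the chart `g` becomes linear: `j` is a right inverse of `DL`, so the correction restores
  -- exactly the nonlinear part.
  · have e1 : DL (fwd x) = g (L x) := by
      change D (L (fwd x)) = _
      rw [hLf]
      simp only [hψ, map_add, ContinuousLinearMap.comp_apply, hDj, hh]
      abel
    have e2 : fwd x ∈ LinearMap.ker (DL : E →ₗ[ℝ] ℝ × ℝ) ↔ DL (fwd x) = 0 := LinearMap.mem_ker
    have e3 : L x ∈ O := (hsource hx).1
    change L x ∈ O ∧ g (L x) = 0 ↔ fwd x ∈ LinearMap.ker (DL : E →ₗ[ℝ] ℝ × ℝ)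
    rw [e2, e1]
    exact and_iff_right e3

end TVS


/-! ### Annular neighbourhoods of closed curves -/

section Annulus

/-- `F` is injective and open on a neighbourhood of `x`. -/
def IsOpenInjAt {X Y : Type*} [TopologicalSpace X] [TopologicalSpace Y] (F : X → Y) (x : X) : Prop :=
  ∃ S ∈ 𝓝 x, InjOn F S ∧ ∀ w ∈ S, 𝓝 (F w) ≤ map F (𝓝 w)

namespace IsOpenInjAt

variable {X Y : Type*} [TopologicalSpace X] [TopologicalSpace Y] {F F' : X → Y} {x : X}

theorem congr (h : IsOpenInjAt F x) (hFF : F =ᶠ[𝓝 x] F') : IsOpenInjAt F' x := by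
  obtain ⟨S, hS, hinj, hopen⟩ := h
  obtain ⟨O, hO, hOo, hxO⟩ := eventually_nhds_iff.1 hFF
  refine ⟨S ∩ O, inter_mem hS (hOo.mem_nhds hxO), ?_, fun w hw => ?_⟩
  · exact (hinj.mono inter_subset_left).congr fun w hw => hO w hw.2
  · have h1 : F =ᶠ[𝓝 w] F' := by
      filter_upwards [hOo.mem_nhds hw.2] with w' hw' using hO w' hw'
    rw [← hO w hw.2, ← map_congr h1]
    exact hopen w hw.1

theorem comp_homeomorph {X' Y' : Type*} [TopologicalSpace X'] [TopologicalSpace Y']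
    (e : X' ≃ₜ X) (e' : Y ≃ₜ Y') {x' : X'} (h : IsOpenInjAt F (e x')) :
    IsOpenInjAt (fun x => e' (F (e x))) x' := by
  obtain ⟨S, hS, hinj, hopen⟩ := h
  refine ⟨e ⁻¹' S, e.continuous.continuousAt.preimage_mem_nhds hS, fun w hw w' hw' hww => ?_,
    fun w hw => ?_⟩
  · exact e.injective (hinj hw hw' (e'.injective hww))
  · have h1 : map (fun x => e' (F (e x))) (𝓝 w) = map e' (map F (map e (𝓝 w))) := by
      simp only [map_map]
      rfl
    rw [h1, e.map_nhds_eq, ← e'.map_nhds_eq]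
    exact map_mono (hopen (e w) hw)

theorem of_hasStrictFDerivAt {E G : Type*} [NormedAddCommGroup E] [NormedSpace ℝ E]
    [CompleteSpace E] [NormedAddCommGroup G] [NormedSpace ℝ G] {F : E → G} {F' : E ≃L[ℝ] G} {x : E}
    (h : HasStrictFDerivAt F (F' : E →L[ℝ] G) x) : IsOpenInjAt F x := by
  set e := h.toOpenPartialHomeomorph F with he
  refine ⟨e.source, e.open_source.mem_nhds h.mem_toOpenPartialHomeomorph_source, e.injOn,
    fun w hw => ?_⟩
  exact (e.map_nhds_eq hw).ge

/-- The tubular map of a curve `a` with transversal `n`. -/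
theorem tube_of_cross_ne_zero {a n : ℝ → Plane} {t : ℝ} {v : Plane} (ha : ContDiffAt ℝ 1 a t)
    (hn : ContDiffAt ℝ 1 n t) (hv : HasDerivAt a v t) (hc : cross v (n t) ≠ 0) :
    IsOpenInjAt (fun w : Plane => a w.1 + w.2 • n w.1) (t, 0) := by
  have hF : ContDiffAt ℝ 1 (fun w : Plane => a w.1 + w.2 • n w.1) (t, 0) :=
    (ContDiffAt.comp (g := a) ((t, 0) : Plane) ha contDiffAt_fst).add
      (contDiffAt_snd.smul (ContDiffAt.comp (g := n) ((t, 0) : Plane) hn contDiffAt_fst))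
  set F' : Plane →ₗ[ℝ] Plane :=
    { toFun := fun h => h.1 • v + h.2 • n t
      map_add' := fun x y => by simp only [Prod.fst_add, Prod.snd_add, add_smul]; abel
      map_smul' := fun c x => by simp [smul_smul] } with hF'
  have hinj : Function.Injective F' := by
    rw [injective_iff_map_eq_zero]
    intro h hh
    have h1 : h.1 * v.1 + h.2 * (n t).1 = 0 := congrArg Prod.fst hh
    have h2 : h.1 * v.2 + h.2 * (n t).2 = 0 := congrArg Prod.snd hh
    have h3 : h.1 * cross v (n t) = 0 := by
      simp only [cross]
      linear_combination (n t).2 * h1 - (n t).1 * h2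
    have h4 : h.2 * cross v (n t) = 0 := by
      simp only [cross]
      linear_combination v.1 * h2 - v.2 * h1
    exact Prod.ext ((mul_eq_zero.1 h3).resolve_right hc) ((mul_eq_zero.1 h4).resolve_right hc)
  have hder : HasFDerivAt (fun w : Plane => a w.1 + w.2 • n w.1)
      (LinearMap.toContinuousLinearMap F') (t, 0) := by
    have e1 : HasFDerivAt (fun w : Plane => a w.1) (ContinuousLinearMap.toSpanSingleton ℝ v ∘L
        ContinuousLinearMap.fst ℝ ℝ ℝ) (t, 0) :=
      HasFDerivAt.comp (g := a) ((t, 0) : Plane) hv.hasFDerivAt hasFDerivAt_fst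
    have e2 := (hn.differentiableAt one_ne_zero).hasFDerivAt
    have e3 : HasFDerivAt (fun w : Plane => n w.1) (fderiv ℝ n t ∘L
        ContinuousLinearMap.fst ℝ ℝ ℝ) (t, 0) :=
      HasFDerivAt.comp (g := n) ((t, 0) : Plane) e2 hasFDerivAt_fst
    have e4 := (e1.add ((hasFDerivAt_snd (𝕜 := ℝ) (p := ((t, 0) : Plane))).smul e3))
    refine e4.congr_fderiv (ContinuousLinearMap.ext fun h => ?_)
    simp [hF']
  have hst := hF.hasStrictFDerivAt' hder one_ne_zero
  set e := (LinearEquiv.ofInjectiveEndo F' hinj).toContinuousLinearEquiv with he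
  exact of_hasStrictFDerivAt (F' := e) hst

/-- The tubular map of a curve that is a graph over the second coordinate. -/
theorem tube_of_strictMonoOn {a n : ℝ → Plane} {t₀ ε σ : ℝ} (hε : 0 < ε)
    (hac : ContinuousOn a (Icc (t₀ - ε) (t₀ + ε)))
    (hmono : StrictMonoOn (fun t => (a t).2) (Icc (t₀ - ε) (t₀ + ε))) (hσ : σ ≠ 0)
    (hn : ∀ t ∈ Icc (t₀ - ε) (t₀ + ε), n t = (σ, 0)) :
    IsOpenInjAt (fun w : Plane => a w.1 + w.2 • n w.1) (t₀, 0) := by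
  set F : Plane → Plane := fun w => a w.1 + w.2 • n w.1 with hF
  have hF' : ∀ t ∈ Icc (t₀ - ε) (t₀ + ε), ∀ s, F (t, s) = ((a t).1 + s * σ, (a t).2) :=
    fun t ht s => by
      simp only [hF, hn t ht]
      ext <;> simp
  refine ⟨Ioo (t₀ - ε) (t₀ + ε) ×ˢ univ, ?_, ?_, ?_⟩
  · exact prod_mem_nhds (Ioo_mem_nhds (by linarith) (by linarith)) univ_mem
  · rintro ⟨t, s⟩ ⟨ht, -⟩ ⟨t', s'⟩ ⟨ht', -⟩ h
    have ht := Ioo_subset_Icc_self ht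
    have ht' := Ioo_subset_Icc_self ht'
    rw [hF' t ht, hF' t' ht'] at h
    have h0 : (a t).2 = (a t').2 := (Prod.ext_iff.1 h).2
    have h1 : t = t' := hmono.injOn ht ht' h0
    subst h1
    have h2 := congrArg Prod.fst h
    simp only [add_right_inj] at h2
    rw [mul_right_cancel₀ hσ h2]
  · rintro ⟨t, s⟩ ⟨ht, -⟩
    simp only at ht
    intro N hN
    rw [mem_map, Metric.mem_nhds_iff] at hN
    obtain ⟨ρ, hρ, hball⟩ := hN
    have hac1 : ContinuousAt (fun t => (a t).1) t :=
      (hac.continuousAt (Icc_mem_nhds ht.1 ht.2)).fst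
    -- A target `(x, y)` is hit by finding `t'` from `y` with the intermediate value theorem and
    -- then solving for `s' = (x - a¹(t')) / σ`. The error `ρ |σ|` is shared equally between `x` and
    -- `a¹(t')`. Only continuity of `a` is used, so corners and cusps are allowed.
    obtain ⟨η, hη, hηa⟩ := Metric.continuousAt_iff.1 hac1 (ρ * |σ| / 2)
      (by have := abs_pos.2 hσ; positivity)
    obtain ⟨κ, hκ0, hκη, hκρ, hκl, hκr⟩ : ∃ κ > 0, κ < η ∧ κ < ρ ∧ t₀ - ε < t - κ ∧
        t + κ < t₀ + ε := by
      refine ⟨min (min η ρ) (min (t - (t₀ - ε)) (t₀ + ε - t)) / 2, ?_, ?_, ?_, ?_, ?_⟩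
      · have : 0 < min (min η ρ) (min (t - (t₀ - ε)) (t₀ + ε - t)) :=
          lt_min (lt_min hη hρ) (lt_min (by linarith [ht.1]) (by linarith [ht.2]))
        positivity
      all_goals
        have h0 : 0 < min (min η ρ) (min (t - (t₀ - ε)) (t₀ + ε - t)) :=
          lt_min (lt_min hη hρ) (lt_min (by linarith [ht.1]) (by linarith [ht.2]))
        have h1 := min_le_left (min η ρ) (min (t - (t₀ - ε)) (t₀ + ε - t))
        have h2 := min_le_right (min η ρ) (min (t - (t₀ - ε)) (t₀ + ε - t))
        have h3 := min_le_left η ρ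
        have h4 := min_le_right η ρ
        have h5 := min_le_left (t - (t₀ - ε)) (t₀ + ε - t)
        have h6 := min_le_right (t - (t₀ - ε)) (t₀ + ε - t)
        linarith
    have htI := Ioo_subset_Icc_self ht
    have hl : t - κ ∈ Icc (t₀ - ε) (t₀ + ε) := ⟨by linarith, by linarith⟩
    have hr : t + κ ∈ Icc (t₀ - ε) (t₀ + ε) := ⟨by linarith, by linarith⟩
    have hl' : (a (t - κ)).2 < (a t).2 := hmono hl htI (by linarith)
    have hr' : (a t).2 < (a (t + κ)).2 := hmono htI hr (by linarith)
    have hsub : Icc (t - κ) (t + κ) ⊆ Icc (t₀ - ε) (t₀ + ε) := Icc_subset_Icc hl.1 hr.2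
    rw [hF' t htI s]
    have hnhds : Metric.ball ((a t).1 + s * σ) (ρ * |σ| / 2) ×ˢ
        Ioo (a (t - κ)).2 (a (t + κ)).2 ∈ 𝓝 (((a t).1 + s * σ, (a t).2) : Plane) :=
      prod_mem_nhds (Metric.ball_mem_nhds _ (by have := abs_pos.2 hσ; positivity))
        (Ioo_mem_nhds hl' hr')
    refine mem_of_superset hnhds ?_
    rintro ⟨x, y⟩ ⟨hx, hy⟩
    simp only at hx hy
    have hcont : ContinuousOn (fun t => (a t).2) (Icc (t - κ) (t + κ)) :=
      (continuous_snd.comp_continuousOn hac).mono hsub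
    obtain ⟨t', ht', hty⟩ := intermediate_value_Icc (by linarith) hcont (Ioo_subset_Icc_self hy)
    simp only at hty
    have hz : F (t', (x - (a t').1) / σ) = (x, y) := by
      rw [hF' t' (hsub ht'), hty, div_mul_cancel₀ _ hσ]
      simp
    rw [← hz]
    refine hball ?_
    have htt : |t' - t| ≤ κ := abs_le.2 ⟨by linarith [ht'.1], by linarith [ht'.2]⟩
    rw [Metric.mem_ball, Prod.dist_eq, max_lt_iff]
    refine ⟨by rw [Real.dist_eq]; linarith, ?_⟩
    rw [Real.dist_eq]
    have e1 : (x - (a t').1) / σ - s = (x - ((a t).1 + s * σ) - ((a t').1 - (a t).1)) / σ := by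
      field_simp
      ring
    have e2 := hηa (x := t') (by rw [Real.dist_eq]; linarith)
    rw [Metric.mem_ball, Real.dist_eq] at hx
    rw [Real.dist_eq] at e2
    rw [e1, abs_div, div_lt_iff₀ (abs_pos.2 hσ)]
    refine (abs_sub _ _).trans_lt ?_
    linarith

end IsOpenInjAt

/-- The tubular map `(θ, s) ↦ γ θ + s n θ` is injective on the compact core and locally injective
and open near it. Hence it is injective and open on a neighbourhood of the core, which contains a
uniform strip. -/
theorem exists_isAnnulusAround {T : ℝ} [hT : Fact (0 < T)] {γ n : AddCircle T → Plane}
    (hγ : Continuous γ) (hn : Continuous n) (hinj : Function.Injective γ)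
    (hloc : ∀ θ : AddCircle T, ∃ t₀ : ℝ, (t₀ : AddCircle T) = θ ∧
      IsOpenInjAt (fun w : Plane => γ (w.1 : AddCircle T) + w.2 • n (w.1 : AddCircle T)) (t₀, 0))
    {W : Set Plane} (hW : IsOpen W) (hγW : range γ ⊆ W) :
    ∃ A ⊆ W, IsOpen A ∧ IsAnnulusAround A (range γ) := by
  set F : AddCircle T × ℝ → Plane := fun x => γ x.1 + x.2 • n x.1 with hF
  have hFc : Continuous F := by fun_prop
  set π : Plane → AddCircle T × ℝ := fun w => ((w.1 : AddCircle T), w.2) with hπ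
  have hπc : Continuous π := by
    have : Continuous fun t : ℝ => (t : AddCircle T) := AddCircle.continuous_mk' T
    exact (this.comp continuous_fst).prodMk continuous_snd
  have hπo : IsOpenMap π := QuotientAddGroup.isOpenMap_coe.prodMap IsOpenMap.id
  set K : Set (AddCircle T × ℝ) := univ ×ˢ {0} with hK
  have hKc : IsCompact K := isCompact_univ.prod isCompact_singleton
  have hgood : ∀ x ∈ K, ∃ u ∈ 𝓝 x, InjOn F u ∧ ∀ w ∈ u, 𝓝 (F w) ≤ map F (𝓝 w) := by
    rintro ⟨θ, s⟩ ⟨-, hs⟩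
    obtain rfl : s = 0 := hs
    obtain ⟨t₀, rfl, S, hS, hSinj, hSopen⟩ := hloc θ
    refine ⟨π '' S, hπo.image_mem_nhds hS, ?_, ?_⟩
    · rintro _ ⟨w, hw, rfl⟩ _ ⟨w', hw', rfl⟩ h
      rw [hSinj hw hw' h]
    · rintro _ ⟨w, hw, rfl⟩
      refine (hSopen w hw).trans ?_
      have : map (F ∘ π) (𝓝 w) ≤ map F (𝓝 (π w)) := by
        rw [← map_map]
        exact map_mono (hπc.tendsto w)
      exact this
  have hKinj : InjOn F K := by
    rintro ⟨θ, s⟩ ⟨-, hs⟩ ⟨θ', s'⟩ ⟨-, hs'⟩ h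
    obtain rfl : s = 0 := hs
    obtain rfl : s' = 0 := hs'
    simp only [hF, zero_smul, add_zero] at h
    rw [hinj h]
  obtain ⟨t, ht, htinj⟩ := hKinj.exists_mem_nhdsSet hKc (fun x _ => hFc.continuousAt)
    fun x hx => by
      obtain ⟨u, hu, hui, -⟩ := hgood x hx
      exact ⟨u, hu, hui⟩
  have hopen : {w | 𝓝 (F w) ≤ map F (𝓝 w)} ∈ 𝓝ˢ K := by
    rw [mem_nhdsSet_iff_forall]
    intro x hx
    obtain ⟨u, hu, -, huo⟩ := hgood x hx
    exact mem_of_superset hu huo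
  have hFW : F ⁻¹' W ∈ 𝓝ˢ K := by
    refine (hW.preimage hFc).mem_nhdsSet.2 ?_
    rintro ⟨θ, s⟩ ⟨-, hs⟩
    obtain rfl : s = 0 := hs
    simp only [hF, mem_preimage, zero_smul, add_zero]
    exact hγW ⟨θ, rfl⟩
  obtain ⟨N, hNo, hKN, hN⟩ := mem_nhdsSet_iff_exists.1 (inter_mem ht (inter_mem hopen hFW))
  -- Compactness of the circle gives one width `ε` valid for all angles. The strip is then rescaled
  -- to `(-1, 1)`.
  obtain ⟨u, v, -, hv, hu, h0v, huv⟩ := generalized_tube_lemma isCompact_univ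
    (isCompact_singleton (x := (0 : ℝ))) hNo hKN
  obtain ⟨ε, hε, hball⟩ := Metric.isOpen_iff.1 hv 0 (h0v rfl)
  have hmem : ∀ (θ : AddCircle T) (s : ℝ), |s| < ε → (θ, s) ∈ N := fun θ s hs =>
    huv ⟨hu (mem_univ θ), hball (by simpa [Real.dist_eq] using hs)⟩
  set h := (AddCircle.homeomorphCircle (T := T) hT.out.ne').symm with hh
  set ι : Circle × Ioo (-1 : ℝ) 1 → AddCircle T × ℝ := Prod.map h (fun s => ε * (s : ℝ)) with hι
  have hιo : IsOpenEmbedding ι := by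
    refine h.isOpenEmbedding.prodMap ?_
    exact (Homeomorph.mulLeft₀ ε hε.ne').isOpenEmbedding.comp isOpen_Ioo.isOpenEmbedding_subtypeVal
  have hιN : ∀ w, ι w ∈ N := fun w => hmem _ _ (by
    change |ε * (w.2 : ℝ)| < ε
    rw [abs_mul, abs_of_pos hε]
    have : |(w.2 : ℝ)| < 1 := abs_lt.2 w.2.2
    nlinarith)
  have hemb : IsOpenEmbedding (F ∘ ι) := by
    refine .of_continuous_injective_isOpenMap (hFc.comp hιo.continuous) ?_ ?_
    · intro w w' hww
      exact hιo.injective (htinj (hN (hιN w)).1 (hN (hιN w')).1 hww)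
    · rw [isOpenMap_iff_nhds_le]
      intro w
      rw [← map_map, hιo.map_nhds_eq]
      exact (hN (hιN w)).2.1
  refine ⟨range (F ∘ ι), ?_, hemb.isOpen_range, F ∘ ι, hemb, rfl, ?_⟩
  · rintro _ ⟨w, rfl⟩
    exact (hN (hιN w)).2.2
  · ext z
    constructor
    · rintro ⟨w, hw, rfl⟩
      refine ⟨h w.1, ?_⟩
      have hw : (w.2 : ℝ) = 0 := hw
      simp [hF, hι, hw]
    · rintro ⟨θ, rfl⟩
      refine ⟨(h.symm θ, ⟨0, by norm_num⟩), rfl, ?_⟩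
      simp [hF, hι]

end Annulus


/-! ### The annulus around a two-fold cycle -/

section CycleAnnulus

/-- A regular simple arc `a`, with velocity `v`, in the closed upper half plane, from `(0, 0)` to
`(q, 0)`, that leaves `y = 0` and returns to it strictly monotonically. -/
structure IsUpperArc (a v : ℝ → Plane) (q ε : ℝ) : Prop where
  hasDerivAt : ∀ t, HasDerivAt a (v t) t
  contDiff : ContDiff ℝ 1 v
  ne_zero : ∀ t, v t ≠ 0
  apply_zero : a 0 = (0, 0)
  apply_one : a 1 = (q, 0)
  pos : ∀ t ∈ Ioo (0 : ℝ) 1, 0 < (a t).2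
  injOn : InjOn a (Icc 0 1)
  eps_pos : 0 < ε
  eps_lt : ε < 1 / 2
  snd_pos : ∀ t ∈ Ioo 0 ε, 0 < (v t).2
  snd_neg : ∀ t ∈ Ioo (1 - ε) 1, (v t).2 < 0

/-- A smooth function that is `1` for `t ≤ ε / 2` and `0` for `t ≥ ε`. -/
def endBump (ε t : ℝ) : ℝ := Real.smoothTransition (2 - 2 * t / ε)

theorem contDiff_endBump (ε : ℝ) : ContDiff ℝ 1 (endBump ε) :=
  (Real.smoothTransition.contDiff (n := 1)).comp (by fun_prop)

theorem endBump_eq_one {ε t : ℝ} (hε : 0 < ε) (ht : t ≤ ε / 2) : endBump ε t = 1 := by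
  refine Real.smoothTransition.one_of_one_le ?_
  have : 2 * t / ε ≤ 1 := by
    rw [div_le_one hε]
    linarith
  linarith

theorem endBump_eq_zero {ε t : ℝ} (hε : 0 < ε) (ht : ε ≤ t) : endBump ε t = 0 := by
  refine Real.smoothTransition.zero_of_nonpos ?_
  have : 2 ≤ 2 * t / ε := by
    rw [le_div_iff₀ hε]
    linarith
  linarith

/-- The transversal of an upper arc. -/
def transversal (v : ℝ → Plane) (ε t : ℝ) : Plane :=
  (endBump ε t) • ((-1, 0) : Plane) + (endBump ε (1 - t)) • ((1, 0) : Plane) +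
    (1 - endBump ε t - endBump ε (1 - t)) • ((-(v t).2, (v t).1) : Plane)

namespace IsUpperArc

variable {a v : ℝ → Plane} {q ε : ℝ}

theorem contDiff_transversal (h : IsUpperArc a v q ε) : ContDiff ℝ 1 (transversal v ε) := by
  have h1 := contDiff_endBump ε
  have h2 : ContDiff ℝ 1 fun t => endBump ε (1 - t) := h1.comp (by fun_prop)
  have h3 : ContDiff ℝ 1 fun t => ((-(v t).2, (v t).1) : Plane) :=
    (contDiff_snd.comp h.contDiff).neg.prodMk (contDiff_fst.comp h.contDiff)
  exact ((h1.smul contDiff_const).add (h2.smul contDiff_const)).add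
    (((contDiff_const.sub h1).sub h2).smul h3)

theorem contDiff_arc (h : IsUpperArc a v q ε) : ContDiff ℝ 1 a := by
  rw [contDiff_one_iff_deriv]
  refine ⟨fun t => (h.hasDerivAt t).differentiableAt, ?_⟩
  have : deriv a = v := funext fun t => (h.hasDerivAt t).deriv
  rw [this]
  exact h.contDiff.continuous

theorem continuous_arc (h : IsUpperArc a v q ε) : Continuous a := h.contDiff_arc.continuous

theorem transversal_left (h : IsUpperArc a v q ε) {t : ℝ} (ht : t ≤ ε / 2) :
    transversal v ε t = (-1, 0) := by
  have h1 := h.eps_pos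
  have h2 := h.eps_lt
  rw [transversal, endBump_eq_one h1 ht, endBump_eq_zero h1 (by linarith : ε ≤ 1 - t)]
  simp

theorem transversal_right (h : IsUpperArc a v q ε) {t : ℝ} (ht : 1 - ε / 2 ≤ t) :
    transversal v ε t = (1, 0) := by
  have h1 := h.eps_pos
  have h2 := h.eps_lt
  rw [transversal, endBump_eq_zero h1 (by linarith : ε ≤ t),
    endBump_eq_one h1 (by linarith : 1 - t ≤ ε / 2)]
  simp

/-- The transversal is a convex combination of vectors to the left of the velocity: `(-1, 0)` where
the arc rises, `(1, 0)` where it descends, and the rotated velocity throughout. The horizontal ends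
are fixed by the reflection, so the transversals of the upper and lower arcs match although the
velocities do not. -/
theorem cross_transversal_pos (h : IsUpperArc a v q ε) {t : ℝ} (ht : t ∈ Ioo (0 : ℝ) 1) :
    0 < cross (v t) (transversal v ε t) := by
  have hε := h.eps_pos
  have hε2 := h.eps_lt
  have hsq : 0 < (v t).1 ^ 2 + (v t).2 ^ 2 := by
    rcases ne_or_eq (v t).1 0 with h1 | h1
    · positivity
    · have : (v t).2 ≠ 0 := fun h2 => h.ne_zero t (Prod.ext h1 h2)
      positivity
  have hb : ∀ s, 0 ≤ endBump ε s ∧ endBump ε s ≤ 1 := fun s =>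
    ⟨Real.smoothTransition.nonneg _, Real.smoothTransition.le_one _⟩
  have key : cross (v t) (transversal v ε t) = endBump ε t * (v t).2 -
      endBump ε (1 - t) * (v t).2 + (1 - endBump ε t - endBump ε (1 - t)) *
        ((v t).1 ^ 2 + (v t).2 ^ 2) := by
    simp only [cross, transversal, Prod.fst_add, Prod.snd_add, Prod.smul_fst, Prod.smul_snd,
      smul_eq_mul]
    ring
  have conv : ∀ {c x y : ℝ}, 0 ≤ c → c ≤ 1 → 0 < x → 0 < y → 0 < c * x + (1 - c) * y := by
    intro c x y h0 h1 hx hy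
    rcases h0.eq_or_lt with rfl | h0
    · simpa using hy
    · have := mul_pos h0 hx
      have := mul_nonneg (sub_nonneg.2 h1) hy.le
      linarith
  rw [key]
  rcases lt_or_ge t ε with h1 | h1
  · rw [endBump_eq_zero hε (by linarith : ε ≤ 1 - t)]
    have := conv (hb t).1 (hb t).2 (h.snd_pos t ⟨ht.1, h1⟩) hsq
    linarith
  · rw [endBump_eq_zero hε h1]
    rcases lt_or_ge (1 - ε) t with h2 | h2
    · have := conv (hb (1 - t)).1 (hb (1 - t)).2 (neg_pos.2 (h.snd_neg t ⟨h2, ht.2⟩)) hsq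
      linarith
    · rw [endBump_eq_zero hε (by linarith : ε ≤ 1 - t)]
      linarith

theorem isOpenInjAt (h : IsUpperArc a v q ε) {t : ℝ} (ht : t ∈ Ioo (0 : ℝ) 1) :
    IsOpenInjAt (fun w : Plane => a w.1 + w.2 • transversal v ε w.1) (t, 0) :=
  .tube_of_cross_ne_zero h.contDiff_arc.contDiffAt h.contDiff_transversal.contDiffAt
    (h.hasDerivAt t) (h.cross_transversal_pos ht).ne'

theorem strictMonoOn_snd (h : IsUpperArc a v q ε) :
    StrictMonoOn (fun t => (a t).2) (Icc 0 ε) := by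
  refine strictMonoOn_of_deriv_pos (convex_Icc _ _) (h.continuous_arc.snd.continuousOn) ?_
  rw [interior_Icc]
  intro t ht
  rw [(h.hasDerivAt t).snd_plane.deriv]
  exact h.snd_pos t ht

theorem strictAntiOn_snd (h : IsUpperArc a v q ε) :
    StrictAntiOn (fun t => (a t).2) (Icc (1 - ε) 1) := by
  refine strictAntiOn_of_deriv_neg (convex_Icc _ _) (h.continuous_arc.snd.continuousOn) ?_
  rw [interior_Icc]
  intro t ht
  rw [(h.hasDerivAt t).snd_plane.deriv]
  exact h.snd_neg t ht

end IsUpperArc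

/-- Two arcs, the second one reflected and reversed, joined to a function on `[0, 2]`. -/
def joinArcs (a b : ℝ → Plane) (t : ℝ) : Plane := if t ≤ 1 then a t else reflect (b (2 - t))

theorem joinArcs_of_le {a b : ℝ → Plane} {t : ℝ} (ht : t ≤ 1) : joinArcs a b t = a t := if_pos ht

theorem joinArcs_of_ge {a b : ℝ → Plane} (h1 : a 1 = reflect (b 1)) {t : ℝ} (ht : 1 ≤ t) :
    joinArcs a b t = reflect (b (2 - t)) := by
  rcases ht.eq_or_lt with rfl | ht
  · rw [joinArcs, if_pos le_rfl, h1]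
    norm_num
  · exact if_neg (not_le.2 ht)

theorem continuous_joinArcs {a b : ℝ → Plane} (ha : Continuous a) (hb : Continuous b)
    (h1 : a 1 = reflect (b 1)) : Continuous (joinArcs a b) := by
  refine Continuous.if_le ha (reflect.continuous.comp (hb.comp (by fun_prop))) continuous_id
    continuous_const ?_
  rintro t rfl
  rw [h1]
  norm_num

instance : Fact ((0 : ℝ) < 2) := ⟨two_pos⟩

/-- Two arcs as a function on the circle. -/
def loopArcs (a b : ℝ → Plane) : AddCircle (2 : ℝ) → Plane := AddCircle.liftIco 2 0 (joinArcs a b)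

section Loop

variable {a b : ℝ → Plane}

theorem continuous_loopArcs (ha : Continuous a) (hb : Continuous b)
    (h0 : a 0 = reflect (b 0)) (h1 : a 1 = reflect (b 1)) : Continuous (loopArcs a b) := by
  refine AddCircle.liftIco_continuous ?_ (continuous_joinArcs ha hb h1).continuousOn
  rw [joinArcs_of_le zero_le_one, joinArcs_of_ge h1 (by norm_num), h0]
  norm_num

theorem loopArcs_coe_upper {t : ℝ} (ht : t ∈ Icc (0 : ℝ) 1) :
    loopArcs a b (t : AddCircle (2 : ℝ)) = a t := by
  rw [loopArcs, AddCircle.liftIco_coe_apply ⟨ht.1, by linarith [ht.2]⟩, joinArcs_of_le ht.2]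

theorem loopArcs_coe_lower (h1 : a 1 = reflect (b 1)) {t : ℝ} (ht : t ∈ Ico (1 : ℝ) 2) :
    loopArcs a b (t : AddCircle (2 : ℝ)) = reflect (b (2 - t)) := by
  rw [loopArcs, AddCircle.liftIco_coe_apply ⟨by linarith [ht.1], by linarith [ht.2]⟩,
    joinArcs_of_ge h1 ht.1]

theorem loopArcs_coe_neg (h1 : a 1 = reflect (b 1)) (h0 : a 0 = reflect (b 0)) {t : ℝ}
    (ht : t ∈ Icc (-1 : ℝ) 0) : loopArcs a b (t : AddCircle (2 : ℝ)) = reflect (b (-t)) := by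
  rcases ht.2.eq_or_lt with rfl | h2
  · rw [loopArcs_coe_upper ⟨le_rfl, zero_le_one⟩, h0, neg_zero]
  · have h3 : ((t : ℝ) : AddCircle (2 : ℝ)) = ((t + 2 : ℝ) : AddCircle (2 : ℝ)) := by
      rw [AddCircle.coe_add, AddCircle.coe_period, add_zero]
    rw [h3, loopArcs_coe_lower h1 ⟨by linarith [ht.1], by linarith⟩]
    congr 2
    ring

theorem exists_Ico_coe (θ : AddCircle (2 : ℝ)) : ∃ t ∈ Ico (0 : ℝ) 2, (t : AddCircle (2 : ℝ)) = θ := by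
  have h := AddCircle.coe_image_Ico_eq (2 : ℝ) 0
  rw [zero_add] at h
  exact (h ▸ mem_univ θ : θ ∈ _ '' Ico (0 : ℝ) 2)

theorem range_loopArcs (h0 : a 0 = reflect (b 0)) (h1 : a 1 = reflect (b 1)) :
    range (loopArcs a b) = a '' Icc 0 1 ∪ reflect '' (b '' Icc 0 1) := by
  ext z
  constructor
  · rintro ⟨θ, rfl⟩
    obtain ⟨t, ht, rfl⟩ := exists_Ico_coe θ
    rcases le_total t 1 with h | h
    · left
      exact ⟨t, ⟨ht.1, h⟩, (loopArcs_coe_upper ⟨ht.1, h⟩).symm⟩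
    · right
      exact ⟨_, ⟨2 - t, ⟨by linarith [ht.2], by linarith⟩, rfl⟩,
        (loopArcs_coe_lower h1 ⟨h, ht.2⟩).symm⟩
  · rintro (⟨t, ht, rfl⟩ | ⟨_, ⟨t, ht, rfl⟩, rfl⟩)
    · exact ⟨_, loopArcs_coe_upper ht⟩
    · refine ⟨((-t : ℝ) : AddCircle (2 : ℝ)), ?_⟩
      rw [loopArcs_coe_neg h1 h0 ⟨by linarith [ht.2], by linarith [ht.1]⟩, neg_neg]

end Loop

/-- At interior points of an arc the transversal is independent of the velocity. At the two
junctions the loop is not smooth, but its height is strictly monotone and the transversal is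
horizontal, so `IsOpenInjAt.tube_of_strictMonoOn` applies. The arcs are separated by the sign of
`y`. -/
theorem exists_isAnnulusAround_upperArcs {a v b u : ℝ → Plane} {q ε ε' : ℝ}
    (ha : IsUpperArc a v q ε) (hb : IsUpperArc b u q ε') {W : Set Plane}
    (hW : IsOpen W) (hWa : a '' Icc 0 1 ⊆ W) (hWb : reflect '' (b '' Icc 0 1) ⊆ W) :
    ∃ A ⊆ W, IsOpen A ∧ IsAnnulusAround A (a '' Icc 0 1 ∪ reflect '' (b '' Icc 0 1)) := by
  have h0 : a 0 = reflect (b 0) := by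
    rw [ha.apply_zero, hb.apply_zero]
    simp [reflect_apply]
  have h1 : a 1 = reflect (b 1) := by
    rw [ha.apply_one, hb.apply_one]
    simp [reflect_apply]
  have hε := ha.eps_pos
  have hε' := hb.eps_pos
  have hε2 := ha.eps_lt
  have hε2' := hb.eps_lt
  set m := transversal v ε with hm
  set n := transversal u ε' with hn
  have h0' : m 0 = reflect (n 0) := by
    rw [hm, hn, ha.transversal_left (by linarith), hb.transversal_left (by linarith)]
    simp [reflect_apply]
  have h1' : m 1 = reflect (n 1) := by
    rw [hm, hn, ha.transversal_right (by linarith), hb.transversal_right (by linarith)]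
    simp [reflect_apply]
  have hac := ha.continuous_arc
  have hbc := hb.continuous_arc
  rw [← range_loopArcs h0 h1]
  have hγc := continuous_loopArcs hac hbc h0 h1
  have hcoe : Continuous fun t : ℝ => (t : AddCircle (2 : ℝ)) := AddCircle.continuous_mk' 2
  refine exists_isAnnulusAround (n := loopArcs m n) hγc
    (continuous_loopArcs ha.contDiff_transversal.continuous
      hb.contDiff_transversal.continuous h0' h1') ?_ ?_ hW ?_
  · have hpos : ∀ t ∈ Ico (0 : ℝ) 2, 1 < t →
        (loopArcs a b (t : AddCircle (2 : ℝ))).2 < 0 := fun t ht h => by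
      rw [loopArcs_coe_lower h1 ⟨h.le, ht.2⟩, reflect_apply]
      have := hb.pos (2 - t) ⟨by linarith [ht.2], by linarith⟩
      simpa using this
    have hnonneg : ∀ t ∈ Ico (0 : ℝ) 2, t ≤ 1 →
        0 ≤ (loopArcs a b (t : AddCircle (2 : ℝ))).2 := fun t ht h => by
      rw [loopArcs_coe_upper ⟨ht.1, h⟩]
      rcases ht.1.eq_or_lt with rfl | h2
      · simp [ha.apply_zero]
      · rcases h.eq_or_lt with rfl | h3
        · simp [ha.apply_one]
        · exact (ha.pos t ⟨h2, h3⟩).le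
    intro θ θ' hθ
    obtain ⟨t, ht, rfl⟩ := exists_Ico_coe θ
    obtain ⟨t', ht', rfl⟩ := exists_Ico_coe θ'
    rcases le_or_gt t 1 with h2 | h2 <;> rcases le_or_gt t' 1 with h3 | h3
    · rw [loopArcs_coe_upper ⟨ht.1, h2⟩, loopArcs_coe_upper ⟨ht'.1, h3⟩] at hθ
      rw [ha.injOn ⟨ht.1, h2⟩ ⟨ht'.1, h3⟩ hθ]
    · have := hpos t' ht' h3
      have := hnonneg t ht h2
      rw [hθ] at this
      linarith
    · have := hpos t ht h2
      have := hnonneg t' ht' h3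
      rw [hθ] at *
      linarith
    · rw [loopArcs_coe_lower h1 ⟨h2.le, ht.2⟩, loopArcs_coe_lower h1 ⟨h3.le, ht'.2⟩] at hθ
      have := hb.injOn ⟨by linarith [ht.2], by linarith⟩ ⟨by linarith [ht'.2], by linarith⟩
        (reflect.injective hθ)
      rw [show t = t' by linarith]
  · intro θ
    obtain ⟨t, ht, rfl⟩ := exists_Ico_coe θ
    refine ⟨t, rfl, ?_⟩
    rcases ht.1.eq_or_lt with rfl | ht0
    · -- the cusp
      obtain ⟨δ, hδ0, hδ1, hδ2⟩ : ∃ δ > 0, δ ≤ ε / 2 ∧ δ ≤ ε' / 2 :=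
        ⟨min (ε / 2) (ε' / 2), by positivity, min_le_left _ _, min_le_right _ _⟩
      refine IsOpenInjAt.tube_of_strictMonoOn (σ := -1)
        (a := fun t : ℝ => loopArcs a b (t : AddCircle (2 : ℝ)))
        (n := fun t : ℝ => loopArcs m n (t : AddCircle (2 : ℝ))) hδ0
        (hγc.comp hcoe).continuousOn ?_ (by norm_num) fun t ht => ?_
      · have e1 : StrictMonoOn (fun t : ℝ => (loopArcs a b (t : AddCircle (2 : ℝ))).2)
            (Icc (0 - δ) 0) := by
          intro t ht t' ht' htt
          simp only
          rw [loopArcs_coe_neg h1 h0 ⟨by linarith [ht.1], ht.2⟩,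
            loopArcs_coe_neg h1 h0 ⟨by linarith [ht'.1], ht'.2⟩, reflect_apply, reflect_apply]
          have := hb.strictMonoOn_snd
            (show -t' ∈ Icc 0 ε' from ⟨by linarith [ht'.2], by linarith [ht'.1]⟩)
            (show -t ∈ Icc 0 ε' from ⟨by linarith [ht.2], by linarith [ht.1]⟩) (by linarith)
          simpa using this
        have e2 : StrictMonoOn (fun t : ℝ => (loopArcs a b (t : AddCircle (2 : ℝ))).2)
            (Icc 0 (0 + δ)) := by
          intro t ht t' ht' htt
          simp only
          rw [loopArcs_coe_upper ⟨ht.1, by linarith [ht.2]⟩,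
            loopArcs_coe_upper ⟨ht'.1, by linarith [ht'.2]⟩]
          exact ha.strictMonoOn_snd ⟨ht.1, by linarith [ht.2]⟩ ⟨ht'.1, by linarith [ht'.2]⟩ htt
        have e3 := e1.union e2 (c := 0) ⟨⟨by linarith, le_rfl⟩, fun x hx => hx.2⟩
          ⟨⟨le_rfl, by linarith⟩, fun x hx => hx.1⟩
        rwa [Icc_union_Icc_eq_Icc (by linarith) (by linarith)] at e3
      · rcases le_total t 0 with h2 | h2
        · rw [loopArcs_coe_neg h1' h0' ⟨by linarith [ht.1], h2⟩, hn,
            hb.transversal_left (by linarith [ht.1])]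
          simp [reflect_apply]
        · rw [loopArcs_coe_upper ⟨h2, by linarith [ht.2]⟩, hm,
            ha.transversal_left (by linarith [ht.2])]
    rcases lt_trichotomy t 1 with ht1 | rfl | ht1
    · refine (ha.isOpenInjAt ⟨ht0, ht1⟩).congr ?_
      filter_upwards [prod_mem_nhds (Ioo_mem_nhds ht0 ht1) univ_mem] with w hw
      rw [loopArcs_coe_upper (Ioo_subset_Icc_self hw.1), loopArcs_coe_upper
        (Ioo_subset_Icc_self hw.1)]
    · -- the transversal crossing
      obtain ⟨δ, hδ0, hδ1, hδ2⟩ : ∃ δ > 0, δ ≤ ε / 2 ∧ δ ≤ ε' / 2 :=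
        ⟨min (ε / 2) (ε' / 2), by positivity, min_le_left _ _, min_le_right _ _⟩
      -- At this junction the height decreases, so the increasing case is applied to the reflected
      -- loop.
      have key := IsOpenInjAt.tube_of_strictMonoOn (σ := 1) (t₀ := 1)
        (a := fun t : ℝ => reflect (loopArcs a b (t : AddCircle (2 : ℝ))))
        (n := fun t : ℝ => reflect (loopArcs m n (t : AddCircle (2 : ℝ)))) hδ0
        (reflect.continuous.comp (hγc.comp hcoe)).continuousOn ?_ one_ne_zero ?_
      · have := IsOpenInjAt.comp_homeomorph (Homeomorph.refl Plane) reflect.toHomeomorph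
          (x' := ((1, 0) : Plane)) key
        refine this.congr (Eventually.of_forall fun w => ?_)
        simp
      · have e1 : StrictMonoOn (fun t : ℝ => (reflect (loopArcs a b (t : AddCircle (2 : ℝ)))).2)
            (Icc (1 - δ) 1) := by
          intro t ht t' ht' htt
          simp only
          rw [loopArcs_coe_upper ⟨by linarith [ht.1], ht.2⟩,
            loopArcs_coe_upper ⟨by linarith [ht'.1], ht'.2⟩, reflect_apply, reflect_apply]
          have := ha.strictAntiOn_snd
            (show t ∈ Icc (1 - ε) 1 from ⟨by linarith [ht.1], ht.2⟩)
            (show t' ∈ Icc (1 - ε) 1 from ⟨by linarith [ht'.1], ht'.2⟩) htt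
          simpa using this
        have e2 : StrictMonoOn (fun t : ℝ => (reflect (loopArcs a b (t : AddCircle (2 : ℝ)))).2)
            (Icc 1 (1 + δ)) := by
          intro t ht t' ht' htt
          simp only
          rw [loopArcs_coe_lower h1 ⟨ht.1, by linarith [ht.2]⟩,
            loopArcs_coe_lower h1 ⟨ht'.1, by linarith [ht'.2]⟩, reflect_reflect, reflect_reflect]
          exact hb.strictAntiOn_snd
            (show 2 - t' ∈ Icc (1 - ε') 1 from ⟨by linarith [ht'.2], by linarith [ht'.1]⟩)
            (show 2 - t ∈ Icc (1 - ε') 1 from ⟨by linarith [ht.2], by linarith [ht.1]⟩)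
            (by linarith)
        have e3 := e1.union e2 (c := 1) ⟨⟨by linarith, le_rfl⟩, fun x hx => hx.2⟩
          ⟨⟨le_rfl, by linarith⟩, fun x hx => hx.1⟩
        rwa [Icc_union_Icc_eq_Icc (by linarith) (by linarith)] at e3
      · intro t ht
        rcases le_total t 1 with h2 | h2
        · rw [loopArcs_coe_upper ⟨by linarith [ht.1], h2⟩, hm,
            ha.transversal_right (by linarith [ht.1])]
          simp [reflect_apply]
        · rw [loopArcs_coe_lower h1' ⟨h2, by linarith [ht.2]⟩, reflect_reflect, hn,
            hb.transversal_right (by linarith [ht.2])]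
    · have ht2 : 2 - t ∈ Ioo (0 : ℝ) 1 := ⟨by linarith [ht.2], by linarith⟩
      have key := IsOpenInjAt.comp_homeomorph ((Homeomorph.subLeft (2 : ℝ)).prodCongr
        (Homeomorph.refl ℝ)) reflect.toHomeomorph (x' := ((t, 0) : Plane)) (hb.isOpenInjAt ht2)
      refine key.congr ?_
      filter_upwards [prod_mem_nhds (Ioo_mem_nhds ht1 ht.2) univ_mem] with w hw
      rw [loopArcs_coe_lower h1 (Ioo_subset_Ico_self hw.1),
        loopArcs_coe_lower h1' (Ioo_subset_Ico_self hw.1)]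
      simp [hn]
  · rw [range_loopArcs h0 h1]
    exact union_subset hWa hWb

end CycleAnnulus


/-! ### Two-fold cycles -/

section Cycle

variable {r : ℕ} {U : Opens Plane}

/-- The arc is the orbit of a globally defined flow with time rescaled to `[0, 1]`. The height
increases just after the fold because its second derivative is positive there, and decreases just
before the return by transversality. -/
theorem IsForwardArc.exists_isUpperArc (hr : 1 ≤ r) {X : CrField r U} {q : ℝ} {G : Set Plane}
    (hfold : IsVisibleFoldAbove X (0, 0)) (hfst : 0 < (X (0, 0)).1) (harc : IsForwardArc X 0 q G)
    (hq : lieH X (q, 0) ≠ 0) (hq0 : q ≠ 0) :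
    ∃ (a v : ℝ → Plane) (ε : ℝ), IsUpperArc a v q ε ∧ a '' Icc 0 1 = G := by
  obtain ⟨Φ, hΦ⟩ := exists_isSmoothFlow (r := r) hr
  obtain ⟨c, O, hO, hGO, -, hc⟩ := exists_cutoff harc.isCompact harc.subset
  obtain ⟨T, hT, hTq, hpos, hG⟩ := harc.exists_flow hr hΦ c fun z hz => hc z (hGO hz)
  set n := c.jetCLM X with hn
  have h0G : ((0, 0) : Plane) ∈ G := by
    rw [hG]
    exact ⟨0, ⟨le_rfl, hT.le⟩, hΦ.zero _ _⟩
  have hqG : ((q, 0) : Plane) ∈ G := by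
    rw [hG]
    exact ⟨T, ⟨hT.le, le_rfl⟩, hTq⟩
  have hn0 : n.field (0, 0) = X (0, 0) := c.field_jetCLM_of_mem hc X (hGO h0G)
  have hnq : n.field (q, 0) = X (q, 0) := c.field_jetCLM_of_mem hc X (hGO hqG)
  have hne : n.field (0, 0) ≠ 0 := fun h => hfst.ne' (by rw [← hn0, h]; rfl)
  have hv0 : (n.field (Φ (n, 0, (0, 0)))).2 = 0 := by
    rw [hΦ.zero, hn0]
    exact hfold.2.2.1
  have hvT : (n.field (Φ (n, T, (0, 0)))).2 < 0 := by
    refine lt_of_le_of_ne ((hΦ.hasDerivAt_snd n T (0, 0)).nonpos_of_pos_left hT (by rw [hTq]) hpos) ?_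
    rw [hTq, hnq]
    exact hq
  have hvd := hΦ.hasDerivAt_field_snd hr n 0 (0, 0)
  have hS : 0 < (fderiv ℝ n.field (Φ (n, 0, (0, 0))) (n.field (Φ (n, 0, (0, 0))))).2 := by
    have e1 := lieLieH_of_lieH_eq_zero hr X hfold.1 hfold.2.2.1
    have e2 : X (0, 0) = (X (0, 0)).1 • ((1, 0) : Plane) := by
      refine Prod.ext (by simp) ?_
      simpa [lieH] using hfold.2.2.1
    rw [hΦ.zero, hn0, c.fderiv_field_jetCLM hO hc X (hGO h0G), e2, map_smul, Prod.smul_snd,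
      smul_eq_mul, ← e1]
    exact hfold.2.2.2
  obtain ⟨ε₁, hε₁, hball₁⟩ := Metric.eventually_nhds_iff.1 (hvd.eventually_pos_of_pos hv0 hS)
  have hvTc : ContinuousAt (fun t => (n.field (Φ (n, t, (0, 0)))).2) T :=
    (hΦ.hasDerivAt_field_snd hr n T (0, 0)).continuousAt
  obtain ⟨ε₂, hε₂, hball₂⟩ := Metric.eventually_nhds_iff.1 (hvTc.eventually_lt_const hvT)
  have hac : ContDiff ℝ 1 fun t : ℝ => Φ (n, T * t, (0, 0)) :=
    (hΦ.contDiff.of_le (by exact_mod_cast hr)).comp (by fun_prop)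
  refine ⟨fun t => Φ (n, T * t, (0, 0)), fun t => T • n.field (Φ (n, T * t, (0, 0))),
    min (min (ε₁ / T) (ε₂ / T)) (1 / 4), ⟨fun t => ?_, ?_, fun t => ?_, ?_, ?_, fun t ht => ?_, ?_,
      ?_, ?_, fun t ht => ?_, fun t ht => ?_⟩, ?_⟩
  · have e1 : HasDerivAt (fun t : ℝ => T * t) T t := by
      simpa using (hasDerivAt_id t).const_mul T
    have e2 := hΦ.hasDerivAt n (T * t) (0, 0)
    exact e2.scomp t e1
  · exact ((n.contDiff_field_right.of_le (by exact_mod_cast hr)).comp hac).const_smul T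
  · exact smul_ne_zero hT.ne' (hΦ.field_ne_zero hr hne _)
  · simp [hΦ.zero]
  · simp [hTq]
  · exact hpos _ ⟨mul_pos hT ht.1, by nlinarith [ht.2]⟩
  -- Flowing a coincidence back by `T s` would bring the orbit of the origin back to it at the time
  -- `T (t - s) ≤ T`. At that time the orbit is either above the line or at `(q, 0)` with `q ≠ 0`.
  · have key : ∀ s ∈ Icc (0 : ℝ) 1, ∀ t ∈ Icc (0 : ℝ) 1,
        Φ (n, T * s, (0, 0)) = Φ (n, T * t, (0, 0)) → ¬ s < t := by
      intro s hs t ht hst hlt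
      have e1 : Φ (n, T * t + -(T * s), (0, 0)) = (0, 0) := by
        rw [add_comm, hΦ.add hr, ← hst, ← hΦ.add hr, neg_add_cancel, hΦ.zero]
      have e2 : T * t + -(T * s) = T * (t - s) := by ring
      rw [e2] at e1
      have hts : 0 < t - s := by linarith
      rcases lt_or_ge (t - s) 1 with h | h
      · have := hpos (T * (t - s)) ⟨mul_pos hT hts, by nlinarith⟩
        rw [e1] at this
        exact lt_irrefl _ this
      · have e3 : t - s = 1 := by linarith [hs.1, ht.2]
        rw [e3, mul_one, hTq] at e1
        exact hq0 (congrArg Prod.fst e1)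
    intro s hs t ht hst
    rcases lt_trichotomy s t with h | h | h
    · exact absurd h (key s hs t ht hst)
    · exact h
    · exact absurd h (key t ht s hs hst.symm)
  · positivity
  · exact (min_le_right _ _).trans_lt (by norm_num)
  · have h1 : t < ε₁ / T := ht.2.trans_le ((min_le_left _ _).trans (min_le_left _ _))
    rw [lt_div_iff₀ hT] at h1
    have hTt := mul_pos hT ht.1
    have h2 := hball₁ (y := T * t) (by
      rw [Real.dist_eq, sub_zero, abs_of_pos hTt]
      linarith) hTt
    rw [zero_add] at h2
    exact mul_pos hT h2
  · have h1 : 1 - t < ε₂ / T := by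
      have := (min_le_left (min (ε₁ / T) (ε₂ / T)) (1 / 4)).trans (min_le_right _ _)
      linarith [ht.1]
    rw [lt_div_iff₀ hT] at h1
    have h2 := hball₂ (y := T * t) (by
      rw [Real.dist_eq, abs_lt]
      have := mul_pos hT (sub_pos.2 ht.2)
      constructor <;> nlinarith)
    exact mul_neg_of_pos_of_neg hT h2
  · rw [hG]
    ext z
    constructor
    · rintro ⟨t, ht, rfl⟩
      exact ⟨T * t, ⟨mul_nonneg hT.le ht.1, by nlinarith [ht.2]⟩, rfl⟩
    · rintro ⟨t, ht, rfl⟩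
      refine ⟨t / T, ⟨div_nonneg ht.1 hT.le, (div_le_one hT).2 ht.2⟩, ?_⟩
      simp only
      rw [mul_div_cancel₀ _ hT.ne']

theorem IsForwardArc.ne_zero (hr : 1 ≤ r) {X : CrField r U} {x q : ℝ} {G : Set Plane}
    (h : IsForwardArc X x q G) (hx : X (x, 0) ≠ 0) {z : Plane} (hz : z ∈ G) : X z ≠ 0 := by
  obtain ⟨Φ, hΦ⟩ := exists_isSmoothFlow (r := r) hr
  obtain ⟨c, O, -, hGO, -, hc⟩ := exists_cutoff h.isCompact h.subset
  obtain ⟨T, hT, hTq, hpos, hG⟩ := h.exists_flow hr hΦ c fun z hz => hc z (hGO hz)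
  have hxG : ((x, 0) : Plane) ∈ G := by
    rw [hG]
    exact ⟨0, ⟨le_rfl, hT.le⟩, hΦ.zero _ _⟩
  rw [← c.field_jetCLM_of_mem hc X (hGO hz)]
  rw [← c.field_jetCLM_of_mem hc X (hGO hxG)] at hx
  rw [hG] at hz
  obtain ⟨t, -, rfl⟩ := hz
  exact hΦ.field_ne_zero hr hx t

theorem mirror_eq_zero_iff (Y : CrField r U) (z : Plane) : mirror Y (reflect z) = 0 ↔ Y z = 0 := by
  rw [mirror_apply, reflect_reflect, neg_eq_zero]
  exact reflect.map_eq_zero_iff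

theorem IsBackwardArc.ne_zero (hr : 1 ≤ r) {Y : CrField r U} {x q : ℝ} {G : Set Plane}
    (h : IsBackwardArc Y x q G) (hx : Y (x, 0) ≠ 0) {z : Plane} (hz : z ∈ G) : Y z ≠ 0 := by
  have h0 : reflect ((x, 0) : Plane) = (x, 0) := by simp [reflect_apply]
  have h1 : mirror Y (x, 0) ≠ 0 := by
    rw [← h0, Ne, mirror_eq_zero_iff]
    exact hx
  have h2 := ((isForwardArc_mirror Y x q G).2 h).ne_zero hr h1 (mem_image_of_mem reflect hz)
  rwa [Ne, mirror_eq_zero_iff] at h2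

theorem mirror_surjective : Function.Surjective (mirror : CrField r U → CrField r (mirrorOpens U)) := by
  intro V
  refine ⟨⟨fun z => -reflect (V (reflect z)), ?_, fun z hz => ?_⟩, ?_⟩
  · refine (reflect.contDiff.comp_contDiffOn
      (V.2.1.comp reflect.contDiff.contDiffOn fun z hz => ?_)).neg
    change reflect (reflect z) ∈ U
    rwa [reflect_reflect]
  · have : V (reflect z) = 0 := V.2.2 _ fun h => hz (by
      have : reflect (reflect z) ∈ U := h
      rwa [reflect_reflect] at this)
    exact (congrArg (fun w => -reflect w) this).trans (by simp)
  · refine Subtype.ext (funext fun z => ?_)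
    change -reflect (-reflect (V (reflect (reflect z)))) = V z
    rw [map_neg, neg_neg, reflect_reflect, reflect_reflect]

theorem exists_fderiv_pos_of_isVisibleFoldAbove (hr : 1 ≤ r) {X : CrField r U}
    (hfold : IsVisibleFoldAbove X (0, 0)) (hfst : 0 < (X (0, 0)).1) :
    ∃ δ > 0, ∀ x : ℝ, |x| < δ → ((x, 0) : Plane) ∈ U ∧ 0 < (fderiv ℝ X (x, 0) (1, 0)).2 := by
  have h1 : 0 < (fderiv ℝ X (0, 0) (1, 0)).2 := by
    have := hfold.2.2.2
    rw [lieLieH_of_lieH_eq_zero hr X hfold.1 hfold.2.2.1] at this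
    exact (mul_pos_iff_of_pos_left hfst).1 this
  have h2 : ContinuousAt (fderiv ℝ X) ((0, 0) : Plane) :=
    ((X.contDiffAt le_rfl hfold.1).fderiv_right (m := 0)
      (by rw [zero_add]; exact_mod_cast hr)).continuousAt
  have h3 : Tendsto (fun x : ℝ => ((x, 0) : Plane)) (𝓝 0) (𝓝 (0, 0)) :=
    (by fun_prop : Continuous fun x : ℝ => ((x, 0) : Plane)).tendsto 0
  have h4 : ContinuousAt (fun z : Plane => (fderiv ℝ X z (1, 0)).2) (0, 0) :=
    (h2.clm_apply continuousAt_const).snd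
  have h5 := h3.eventually ((U.isOpen.eventually_mem hfold.1).and (h4.eventually_const_lt h1))
  obtain ⟨δ, hδ, hball⟩ := Metric.eventually_nhds_iff.1 h5
  exact ⟨δ, hδ, fun x hx => hball (by simpa [Real.dist_eq] using hx)⟩

theorem lieLieH_eq_zero_of_eq_zero {X : CrField r U} {z : Plane} (h : X z = 0) : lieLieH X z = 0 := by
  rw [lieLieH, h, map_zero]

theorem exists_lipschitz_of_isIntegralCurveOn {X : CrField r U} {φ : ℝ → Plane} {a b : ℝ}
    (hφ : IsIntegralCurveOn φ (fun _ => X) (Icc a b)) (hU : ∀ t ∈ Icc a b, φ t ∈ U) :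
    ∃ C, 0 ≤ C ∧ ∀ s ∈ Icc a b, ∀ t ∈ Icc a b, ‖φ t - φ s‖ ≤ C * ‖t - s‖ := by
  have h1 : ContinuousOn (fun t => X (φ t)) (Icc a b) :=
    X.2.1.continuousOn.comp hφ.continuousOn_Icc hU
  obtain ⟨C, hC⟩ := isCompact_Icc.exists_bound_of_continuousOn h1
  refine ⟨max C 0, le_max_right _ _, fun s hs t ht => ?_⟩
  exact (convex_Icc a b).norm_image_sub_le_of_norm_hasDerivWithin_le (fun u hu => hφ u hu)
    (fun u hu => (hC u hu).trans (le_max_left _ _)) hs ht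

/-- The forward arc of `X` and the backward arc of `Y` between a two-fold and a crossing point form
a simple two-fold cycle. -/
theorem isSimpleTwoFoldCycle_of_arcs (hr : 1 ≤ r) {Z : PiecewiseField r U} {p q : ℝ}
    {GX GY : Set Plane} (hp : IsVisibleTwoFold Z (p, 0)) (hX : IsForwardArc Z.1 p q GX)
    (hY : IsBackwardArc Z.2 p q GY) (hqX : lieH Z.1 (q, 0) < 0) (hqY : lieH Z.2 (q, 0) < 0) :
    IsSimpleTwoFoldCycle Z (p, 0) (GX ∪ GY) := by
  have hX0 : Z.1 (p, 0) ≠ 0 := fun h => hp.1.2.2.2.ne' (lieLieH_eq_zero_of_eq_zero h)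
  have hY0 : Z.2 (p, 0) ≠ 0 := fun h => hp.2.2.2.2.ne (lieLieH_eq_zero_of_eq_zero h)
  have hXne := fun {z} hz => hX.ne_zero hr hX0 (z := z) hz
  have hYne := fun {z} hz => hY.ne_zero hr hY0 (z := z) hz
  obtain ⟨S, hS, φ, hφ, hφU, hφ0, hφS, hφpos, hGX⟩ := hX
  obtain ⟨R, hR, ψ, hψ, hψU, hψ0, hψR, hψneg, hGY⟩ := hY
  set T := S - R with hT
  -- As `R < 0`, the arc of `Y` shifted by `T = S - R` is run forward in time, from the crossing
  -- point at the time `S` to the two-fold at the time `T`.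
  set γ : ℝ → Plane := fun t => if t ≤ S then φ t else ψ (t - T) with hγ
  have hγ1 : ∀ {t}, t ≤ S → γ t = φ t := fun ht => if_pos ht
  have hγ2 : ∀ {t}, S ≤ t → γ t = ψ (t - T) := fun {t} ht => by
    rcases ht.eq_or_lt with rfl | ht
    · have : S - T = R := by rw [hT]; ring
      rw [hγ1 le_rfl, this, hφS, hψR]
    · exact if_neg (not_le.2 ht)
  have hshift : ∀ {t}, t ∈ Icc S T → t - T ∈ Icc R 0 := fun {t} ht =>
    ⟨by linarith [ht.1], by linarith [ht.2]⟩
  have hT0 : 0 < T := by linarith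
  have hST : S < T := by linarith
  refine ⟨hp, T, hT0, γ, ⟨fun t ht => ?_, ?_, ?_⟩, ?_, ?_, fun t ht => ?_, ?_⟩
  · rcases le_total t S with h | h
    · rw [hγ1 h]
      exact hφU t ⟨ht.1, h⟩
    · rw [hγ2 h]
      exact hψU _ (hshift ⟨h, ht.2⟩)
  · obtain ⟨C, hC0, hC⟩ := exists_lipschitz_of_isIntegralCurveOn hφ hφU
    obtain ⟨D, hD0, hD⟩ := exists_lipschitz_of_isIntegralCurveOn hψ hψU
    have key : ∀ s ∈ Icc 0 T, ∀ t ∈ Icc 0 T, s ≤ t → ‖γ t - γ s‖ ≤ (C + D) * (t - s) := by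
      have k1 : ∀ s ∈ Icc 0 S, ∀ t ∈ Icc 0 S, s ≤ t → ‖γ t - γ s‖ ≤ (C + D) * (t - s) := by
        intro s hs t ht hst
        rw [hγ1 hs.2, hγ1 ht.2]
        have := hC s hs t ht
        rw [Real.norm_of_nonneg (sub_nonneg.2 hst)] at this
        nlinarith [mul_nonneg hD0 (sub_nonneg.2 hst)]
      have k2 : ∀ s ∈ Icc S T, ∀ t ∈ Icc S T, s ≤ t → ‖γ t - γ s‖ ≤ (C + D) * (t - s) := by
        intro s hs t ht hst
        rw [hγ2 hs.1, hγ2 ht.1]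
        have := hD _ (hshift hs) _ (hshift ht)
        rw [sub_sub_sub_cancel_right, Real.norm_of_nonneg (sub_nonneg.2 hst)] at this
        nlinarith [mul_nonneg hC0 (sub_nonneg.2 hst)]
      intro s hs t ht hst
      rcases le_total t S with h | h
      · exact k1 s ⟨hs.1, hst.trans h⟩ t ⟨ht.1, h⟩ hst
      · rcases le_total s S with h' | h'
        · have e1 := k1 s ⟨hs.1, h'⟩ S ⟨hS.le, le_rfl⟩ h'
          have e2 := k2 S ⟨le_rfl, hST.le⟩ t ⟨h, ht.2⟩ h
          have e3 : γ t - γ s = (γ t - γ S) + (γ S - γ s) := by abel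
          rw [e3]
          refine (norm_add_le _ _).trans ?_
          linarith
        · exact k2 s ⟨h', hs.2⟩ t ⟨h, ht.2⟩ hst
    have hlip : LipschitzOnWith (Real.toNNReal (C + D)) γ (uIcc 0 T) := by
      rw [uIcc_of_le hT0.le]
      refine LipschitzOnWith.of_dist_le_mul fun s hs t ht => ?_
      rw [Real.coe_toNNReal _ (add_nonneg hC0 hD0)]
      rcases le_total s t with h | h
      · rw [dist_comm, dist_comm s t, dist_eq_norm, Real.dist_eq, abs_of_nonneg (sub_nonneg.2 h)]
        exact key s hs t ht h
      · rw [dist_eq_norm, Real.dist_eq, abs_of_nonneg (sub_nonneg.2 h)]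
        exact key t ht s hs h
    exact hlip.absolutelyContinuousOnInterval
  · rw [ae_restrict_iff' measurableSet_Icc]
    -- The switching line is met only at these three times, which form a null set, so the convex
    -- hull condition on the line is never needed.
    have hfin : ∀ᵐ t : ℝ, t ∉ ({0, S, T} : Set ℝ) :=
      measure_eq_zero_iff_ae_notMem.1 ((Set.toFinite _).measure_zero volume)
    filter_upwards [hfin] with t htn ht
    simp only [mem_insert_iff, mem_singleton_iff, not_or] at htn
    have ht0 : 0 < t := lt_of_le_of_ne ht.1 (Ne.symm htn.1)
    have htT : t < T := lt_of_le_of_ne ht.2 htn.2.2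
    rcases lt_or_gt_of_ne htn.2.1 with h | h
    · have hy := hφpos t ⟨ht0, h⟩
      refine ⟨Z.1 (φ t), ⟨fun _ => by rw [hγ1 h.le], fun h' => ?_, fun h' => ?_⟩, ?_⟩
      · rw [hγ1 h.le] at h'
        linarith
      · rw [hγ1 h.le] at h'
        linarith
      · refine ((hφ t ⟨ht0.le, h.le⟩).hasDerivAt (Icc_mem_nhds ht0 h)).congr_of_eventuallyEq ?_
        filter_upwards [Iio_mem_nhds h] with u hu using hγ1 hu.le
    · have hy := hψneg (t - T) ⟨by linarith, by linarith⟩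
      refine ⟨Z.2 (ψ (t - T)), ⟨fun h' => ?_, fun _ => by rw [hγ2 h.le], fun h' => ?_⟩, ?_⟩
      · rw [hγ2 h.le] at h'
        linarith
      · rw [hγ2 h.le] at h'
        linarith
      · have e1 := (hψ (t - T) (hshift ⟨h.le, htT.le⟩)).hasDerivAt
          (Icc_mem_nhds (by linarith) (by linarith))
        refine (e1.comp_sub_const t T).congr_of_eventuallyEq ?_
        filter_upwards [Ioi_mem_nhds h] with u hu using hγ2 hu.le
  · rw [hγ1 hS.le, hφ0]
  · rw [hγ2 hST.le, sub_self, hψ0]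
  · rcases lt_trichotomy t S with h | h | h
    · have hy := hφpos t ⟨ht.1, h⟩
      rw [hγ1 h.le]
      refine ⟨hφU t ⟨ht.1.le, h.le⟩, fun _ => hXne ?_, fun h' => ?_, fun h' => ?_⟩
      · rw [hGX]
        exact ⟨t, ⟨ht.1.le, h.le⟩, rfl⟩
      · linarith
      · linarith
    · rw [h, hγ1 le_rfl, hφS]
      refine ⟨?_, fun _ h' => hqX.ne (by rw [lieH, h']; rfl), fun _ h' => hqY.ne (by rw [lieH, h']; rfl),
        fun _ => ⟨(mul_pos_of_neg_of_neg hqX hqY).ne', fun h' => ?_⟩⟩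
      · rw [← hφS]
        exact hφU S ⟨hS.le, le_rfl⟩
      · exact absurd h' (mul_pos_of_neg_of_neg hqX hqY).le.not_gt
    · have hy := hψneg (t - T) ⟨by linarith, by linarith [ht.2]⟩
      rw [hγ2 h.le]
      have hm := hshift ⟨h.le, ht.2.le⟩
      refine ⟨hψU _ hm, fun h' => ?_, fun _ => hYne ?_, fun h' => ?_⟩
      · linarith
      · rw [hGY]
        exact ⟨_, hm, rfl⟩
      · linarith
  · rw [hGX, hGY]
    ext z
    constructor
    · rintro (⟨t, ht, rfl⟩ | ⟨t, ht, rfl⟩)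
      · exact ⟨t, ⟨ht.1, ht.2.trans hST.le⟩, hγ1 ht.2⟩
      · refine ⟨t + T, ⟨by linarith [ht.1], by linarith [ht.2]⟩, ?_⟩
        rw [hγ2 (by linarith [ht.1]), add_sub_cancel_right]
    · rintro ⟨t, ht, rfl⟩
      rcases le_total t S with h | h
      · rw [hγ1 h]
        exact Or.inl ⟨t, ⟨ht.1, h⟩, rfl⟩
      · rw [hγ2 h]
        exact Or.inr ⟨_, hshift ⟨h, ht.2⟩, rfl⟩

end Cycle


/-! ### Elementary cycles in terms of the return data -/

section Elementary

variable {r : ℕ} {U : Opens Plane} {A : Set Plane}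

/-- The counterpart of `IsSideReturn` for the field in `y < 0`, with time reversed. -/
structure IsSideReturnBelow (A : Set Plane) (Y : CrField r U) (p q m : ℝ) : Prop where
  mem : ((p, 0) : Plane) ∈ A
  isVisibleFold : IsVisibleFoldBelow Y (p, 0)
  fst_neg : (Y (p, 0)).1 < 0
  eq_of_lieH : ∀ x : ℝ, (x, 0) ∈ A → lieH Y (x, 0) = 0 → x = p
  lieH_neg : lieH Y (q, 0) < 0
  exists_arc : ∃ δ > 0, ∃ (ξ : ℝ → ℝ) (G : ℝ → Set Plane), ξ 0 = q ∧
    (∀ s ∈ Ico 0 δ, IsBackwardArc Y (p + s) (ξ s) (G s) ∧ G s ⊆ A) ∧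
    (fun s => ξ s - q - m * s ^ 2) =o[𝓝 0] (fun s : ℝ => s ^ 2)

theorem IsSideReturn.below (hr : 1 ≤ r) {Y : CrField r U} {p q m : ℝ}
    (h : IsSideReturn (reflect ⁻¹' A) (mirror Y) p q m) : IsSideReturnBelow A Y p q m := by
  have h0 : ∀ x : ℝ, reflect ((x, 0) : Plane) = (x, 0) := fun x => by simp [reflect_apply]
  obtain ⟨δ, hδ, ξ, G, hξ, hG, ho⟩ := h.exists_arc
  refine ⟨?_, (isVisibleFoldAbove_mirror hr Y p).1 h.isVisibleFold, ?_, fun x hx hl => ?_, ?_,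
    δ, hδ, ξ, fun s => reflect '' G s, hξ, fun s hs => ⟨?_, ?_⟩, ho⟩
  · have := h.mem
    rwa [mem_preimage, h0] at this
  · have := h.fst_pos
    rw [mirror_fst] at this
    linarith
  · refine h.eq_of_lieH x ?_ ((lieH_mirror Y x).trans hl)
    rwa [mem_preimage, h0]
  · have := h.lieH_neg
    rwa [lieH_mirror] at this
  · rw [← isForwardArc_mirror, image_image]
    simp only [reflect_reflect, image_id']
    exact (hG s hs).1
  · rintro _ ⟨z, hz, rfl⟩
    exact (hG s hs).2 hz

theorem IsSideReturn.isFoldReturnData {Z : PiecewiseField r U} {pX qX mX pY qY mY : ℝ}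
    (hX : IsSideReturn A Z.1 pX qX mX) (hY : IsSideReturnBelow A Z.2 pY qY mY) :
    IsFoldReturnData A Z pX qX pY qY := by
  obtain ⟨δ, hδ, ξ, G, hξ, hG, -⟩ := hX.exists_arc
  obtain ⟨δ', hδ', ξ', G', hξ', hG', -⟩ := hY.exists_arc
  have h1 := hG 0 ⟨le_rfl, hδ⟩
  have h2 := hG' 0 ⟨le_rfl, hδ'⟩
  rw [add_zero, hξ] at h1
  rw [add_zero, hξ'] at h2
  exact ⟨⟨hX.mem, hX.isVisibleFold, hX.fst_pos, hX.eq_of_lieH, ⟨_, h1.2, h1.1⟩, hX.lieH_neg.ne⟩,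
    hY.mem, hY.isVisibleFold, hY.fst_neg, hY.eq_of_lieH, ⟨_, h2.2, h2.1⟩, hY.lieH_neg.ne⟩

theorem eq_zero_of_mul_sq_isLittleO {c : ℝ}
    (h : (fun s : ℝ => c * s ^ 2) =o[𝓝[≥] 0] (fun s : ℝ => s ^ 2)) : c = 0 := by
  have h1 : (fun s : ℝ => c * s ^ 2) =o[𝓝[>] 0] (fun s : ℝ => s ^ 2) :=
    h.mono (nhdsWithin_mono _ Ioi_subset_Ici_self)
  have h2 := h1.tendsto_div_nhds_zero
  have h3 : Tendsto (fun _ : ℝ => c) (𝓝[>] (0 : ℝ)) (𝓝 0) := by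
    refine h2.congr' ?_
    filter_upwards [self_mem_nhdsWithin] with s hs
    have : s ≠ 0 := ne_of_gt hs
    field_simp
  exact tendsto_nhds_unique tendsto_const_nhds h3

/-- An elementary cycle in `A` has the return data of the folds in `A`. -/
theorem IsElementarySimpleTwoFoldCycle.eq_and_ne (hr : 1 ≤ r) {Z : PiecewiseField r U}
    {pX qX mX pY qY mY : ℝ} (hX : IsSideReturn A Z.1 pX qX mX)
    (hY : IsSideReturnBelow A Z.2 pY qY mY) {Γ : Set Plane} (hΓA : Γ ⊆ A)
    (hΓ : IsElementarySimpleTwoFoldCycle Z Γ) : pX = pY ∧ qX = qY ∧ mX ≠ mY := by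
  obtain ⟨p, ⟨hp, T, hT, γ, -, hγ0, -, -, hγΓ⟩, δ, hδ, ξX, ξY, GX, GY, hG, -, M, hM, ho⟩ := hΓ
  have hpA : ((p, 0) : Plane) ∈ A := hΓA (by
    rw [hγΓ]
    exact ⟨0, ⟨le_rfl, hT.le⟩, hγ0⟩)
  obtain rfl := hX.eq_of_lieH p hpA hp.1.2.2.1
  obtain rfl := hY.eq_of_lieH p hpA hp.2.2.2.1
  obtain ⟨δX, hδX, ξX', GX', hξX, hGX', hoX⟩ := hX.exists_arc
  obtain ⟨δY, hδY, ξY', GY', hξY, hGY', hoY⟩ := hY.exists_arc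
  have hXeq : ∀ s ∈ Ico 0 (min δ (min δX δY)), ξX s = ξX' s := fun s hs =>
    ((hG s ⟨hs.1, hs.2.trans_le (min_le_left _ _)⟩).1.unique hr (hGX' s ⟨hs.1, hs.2.trans_le
      ((min_le_right _ _).trans (min_le_left _ _))⟩).1).1
  have hYeq : ∀ s ∈ Ico 0 (min δ (min δX δY)), ξY s = ξY' s := fun s hs =>
    ((hG s ⟨hs.1, hs.2.trans_le (min_le_left _ _)⟩).2.unique hr (hGY' s ⟨hs.1, hs.2.trans_le
      ((min_le_right _ _).trans (min_le_right _ _))⟩).1).1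
  have hδ0 : 0 < min δ (min δX δY) := lt_min hδ (lt_min hδX hδY)
  have hq : qX = qY := by
    -- The filter `𝓝[≥] 0` contains the point `0` itself, where the estimate bounds the displacement
    -- by zero. Thus the two returns of the fold agree.
    have h1 := (Asymptotics.isLittleO_iff.1 ho one_pos).self_of_nhdsWithin (mem_Ici.2 le_rfl)
    have h2 : ξX 0 - ξY 0 = 0 := by simpa using h1
    rw [hXeq 0 ⟨le_rfl, hδ0⟩, hYeq 0 ⟨le_rfl, hδ0⟩, hξX, hξY] at h2
    linarith
  refine ⟨rfl, hq, fun hm => hM ?_⟩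
  have h1 := (hoX.mono (nhdsWithin_le_nhds (s := Ici 0))).sub
    (hoY.mono (nhdsWithin_le_nhds (s := Ici 0)))
  have h2 := h1.sub ho
  refine eq_zero_of_mul_sq_isLittleO (h2.congr' ?_ EventuallyEq.rfl)
  filter_upwards [Ico_mem_nhdsGE hδ0] with s hs
  rw [hXeq s hs, hYeq s hs, hq, hm]
  ring

/-- Coinciding folds and returns close the two arcs up, and subtracting the expansions gives `M = mX
- mY`. The assumption `hm` ensures that every such cycle is elementary; the converse is
`IsElementarySimpleTwoFoldCycle.eq_and_ne`. -/
theorem IsSideReturn.exists_cycle_iff (hr : 1 ≤ r) {Z : PiecewiseField r U}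
    {pX qX mX pY qY mY : ℝ} (hX : IsSideReturn A Z.1 pX qX mX)
    (hY : IsSideReturnBelow A Z.2 pY qY mY) (hm : mX ≠ mY) :
    (pY - pX, qX - qY) = ((0, 0) : ℝ × ℝ) ↔ ∃ Γ ⊆ A, IsElementarySimpleTwoFoldCycle Z Γ := by
  constructor
  · intro h
    rw [Prod.mk.injEq, sub_eq_zero, sub_eq_zero] at h
    obtain ⟨rfl, rfl⟩ := h
    obtain ⟨δX, hδX, ξX, GX, hξX, hGX, hoX⟩ := hX.exists_arc
    obtain ⟨δY, hδY, ξY, GY, hξY, hGY, hoY⟩ := hY.exists_arc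
    refine ⟨GX 0 ∪ GY 0, union_subset (hGX 0 ⟨le_rfl, hδX⟩).2 (hGY 0 ⟨le_rfl, hδY⟩).2, pY, ?_,
      min δX δY, lt_min hδX hδY, ξX, ξY, GX, GY, fun s hs => ⟨(hGX s ⟨hs.1, hs.2.trans_le
        (min_le_left _ _)⟩).1, (hGY s ⟨hs.1, hs.2.trans_le (min_le_right _ _)⟩).1⟩, rfl, mX - mY,
      sub_ne_zero.2 hm, ?_⟩
    · have h1 := (hGX 0 ⟨le_rfl, hδX⟩).1
      have h2 := (hGY 0 ⟨le_rfl, hδY⟩).1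
      rw [add_zero, hξX] at h1
      rw [add_zero, hξY] at h2
      exact isSimpleTwoFoldCycle_of_arcs hr ⟨hX.isVisibleFold, hY.isVisibleFold⟩ h1 h2 hX.lieH_neg
        hY.lieH_neg
    · refine ((hoX.sub hoY).mono nhdsWithin_le_nhds).congr_left fun s => ?_
      ring
  · rintro ⟨Γ, hΓA, hΓ⟩
    obtain ⟨h1, h2, -⟩ := hΓ.eq_and_ne hr hX hY hΓA
    rw [h1, h2, sub_self, sub_self]

end Elementary

/-! ### Assembly of the annulus, the two sides and the zero set of `η`. -/

theorem IsForwardArc.eq_of_snd_eq_zero {r : ℕ} {U : Opens Plane} {X : CrField r U} {x q : ℝ}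
    {G : Set Plane} (h : IsForwardArc X x q G) {z : Plane} (hz : z ∈ G) (hz0 : z.2 = 0) :
    z = (x, 0) ∨ z = (q, 0) := by
  obtain ⟨T, hT, φ, -, -, h0, hTq, hpos, rfl⟩ := h
  obtain ⟨t, ht, rfl⟩ := hz
  rcases ht.1.eq_or_lt with rfl | h1
  · exact Or.inl h0
  rcases ht.2.eq_or_lt with rfl | h2
  · exact Or.inr hTq
  · exact absurd hz0 (hpos t ⟨h1, h2⟩).ne'

theorem isOpen_lieH_ne_zero {r : ℕ} {U : Opens Plane} (X : CrField r U) :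
    IsOpen {z : Plane | z ∈ U ∧ lieH X z ≠ 0} :=
  (continuous_snd.comp_continuousOn X.2.1.continuousOn).isOpen_inter_preimage U.isOpen
    isOpen_compl_singleton

end

theorem theoremA (r : ℕ) (hr : 1 ≤ r) (U : TopologicalSpace.Opens Plane)
    (hU : Bornology.IsBounded (U : Set Plane)) (h0 : ((0, 0) : Plane) ∈ U)
    (Z₀ : PiecewiseField r U) (Γ₀ : Set Plane)
    (hC : ConditionC Z₀ Γ₀) (hΓ₀ : IsElementarySimpleTwoFoldCycle Z₀ Γ₀) :
    ∃ (A₀ : Set Plane) (V₀ : Set (PiecewiseField r U)) (pX qX pY qY : PiecewiseField r U → ℝ)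
      (η : PiecewiseField r U → ℝ × ℝ),
      IsAnnulusAround A₀ Γ₀ ∧ A₀ ⊆ U ∧ IsOpen V₀ ∧ Z₀ ∈ V₀ ∧
      -- the folds and the first returns are well defined on `V₀`, and so is `η`
      (∀ Z ∈ V₀, IsFoldReturnData A₀ Z (pX Z) (qX Z) (pY Z) (qY Z)) ∧
      (∀ Z, η Z = (pY Z - pX Z, qX Z - qY Z)) ∧
      IsCrOn r η V₀ ∧
      -- (i)
      (∀ Z ∈ V₀, η Z = (0, 0) ↔ ∃ Γ ⊆ A₀, IsElementarySimpleTwoFoldCycle Z Γ) ∧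
      -- (ii), on `Ω` and on the subspace normalized by `p_X = 0`
      (∀ Z ∈ V₀, ∃ dη : PiecewiseField r U →L[ℝ] ℝ × ℝ, HasFDerivAt η dη Z ∧
        Function.Surjective dη ∧
        (Z ∈ normalizedFields r U → ∀ w, ∃ W ∈ normalizedFields r U, dη W = w)) ∧
      -- the zero set is a submanifold of codimension two, in `Ω` and in the normalized subspace
      IsSubmanifoldOfCodim r 2 {Z | Z ∈ V₀ ∧ η Z = (0, 0)} ∧
      IsSubmanifoldOfCodim r 2
        {Z : normalizedFields r U | (Z : PiecewiseField r U) ∈ V₀ ∧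
          η (Z : PiecewiseField r U) = (0, 0)} := by
  obtain ⟨hfold, hX1, hY1, q, hq0, GX, GY, hGX, hqX, hGY, hqY, hΓ⟩ := hC
  have hrefl : ∀ x : ℝ, reflect ((x, 0) : Plane) = (x, 0) := fun x => by simp [reflect_apply]
  -- the lower field, reflected
  have hGY' := (isForwardArc_mirror Z₀.2 0 q GY).2 hGY
  have hfoldY : IsVisibleFoldAbove (mirror Z₀.2) (0, 0) :=
    (isVisibleFoldAbove_mirror hr Z₀.2 0).2 hfold.2
  have hY1' : 0 < (mirror Z₀.2 (0, 0)).1 := by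
    rw [mirror_fst]
    linarith
  have hqY' : lieH (mirror Z₀.2) (q, 0) ≠ 0 := by rwa [lieH_mirror]
  -- the annulus
  obtain ⟨δX, hδX, hδX'⟩ := exists_fderiv_pos_of_isVisibleFoldAbove hr hfold.1 hX1
  obtain ⟨δY, hδY, hδY'⟩ := exists_fderiv_pos_of_isVisibleFoldAbove hr hfoldY hY1'
  -- The strict inequalities are needed because `exists_isSideReturn` uses the closed segment `|x| ≤
  -- δ`.
  obtain ⟨δ, hδ, hδ1, hδ2⟩ : ∃ δ > 0, δ < δX ∧ δ < δY :=
    ⟨min δX δY / 2, by positivity, by linarith [min_le_left δX δY, lt_min hδX hδY],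
      by linarith [min_le_right δX δY, lt_min hδX hδY]⟩
  -- An open set that leaves out the tangency points with `|x| ≥ δ`. It contains the cycle, which
  -- meets the line only at `(0, 0)` and at `(q, 0)`, where both fields are transversal. Any annulus
  -- with closure in `W₁` has tangencies only near the origin.
  set W₁ : Set Plane := (U : Set Plane) ∩ ({z | z.2 ≠ 0} ∪ {z | |z.1| < δ} ∪
    ({z | z ∈ U ∧ lieH Z₀.1 z ≠ 0} ∩ {z | z ∈ U ∧ lieH Z₀.2 z ≠ 0})) with hW₁
  have hW₁o : IsOpen W₁ := by
    refine U.isOpen.inter (IsOpen.union (IsOpen.union ?_ ?_)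
      ((isOpen_lieH_ne_zero Z₀.1).inter (isOpen_lieH_ne_zero Z₀.2)))
    · exact isOpen_ne_fun continuous_snd continuous_const
    · exact isOpen_lt continuous_fst.abs continuous_const
  have hpt : ∀ z ∈ (U : Set Plane), (z.2 = 0 → z = (0, 0) ∨ z = (q, 0)) → z ∈ W₁ := by
    intro z hzU hz
    refine ⟨hzU, ?_⟩
    by_cases hz2 : z.2 = 0
    · rcases hz hz2 with rfl | rfl
      · exact Or.inl (Or.inr (by simpa using hδ))
      · exact Or.inr ⟨⟨hzU, hqX⟩, hzU, hqY⟩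
    · exact Or.inl (Or.inl hz2)
  have hGXW : GX ⊆ W₁ := fun z hz => hpt z (hGX.subset hz) fun h => hGX.eq_of_snd_eq_zero hz h
  have hGYW : GY ⊆ W₁ := fun z hz => by
    refine hpt z ?_ fun h => ?_
    · have := hGY'.subset (mem_image_of_mem reflect hz)
      rwa [SetLike.mem_coe, mem_mirrorOpens, reflect_reflect] at this
    · have h1 : reflect z = z := by
        rw [reflect_apply, h, neg_zero, ← h]
      have := hGY'.eq_of_snd_eq_zero (mem_image_of_mem reflect hz) (by rw [h1, h])
      rwa [h1] at this
  obtain ⟨a, v, ε, ha, haG⟩ := hGX.exists_isUpperArc hr hfold.1 hX1 hqX hq0.ne'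
  obtain ⟨b, u, ε', hb, hbG⟩ := hGY'.exists_isUpperArc hr hfoldY hY1' hqY' hq0.ne'
  have hbG' : reflect '' (b '' Icc 0 1) = GY := by
    rw [hbG, image_image]
    simp
  have hΓc : IsCompact Γ₀ := by
    rw [hΓ, ← haG, ← hbG']
    exact (isCompact_Icc.image ha.continuous_arc).union
      ((isCompact_Icc.image hb.continuous_arc).image reflect.continuous)
  have hΓW : Γ₀ ⊆ W₁ := by
    rw [hΓ]
    exact union_subset hGXW hGYW
  obtain ⟨W, hWo, hΓW', hWW₁, hWc⟩ := exists_open_between_and_isCompact_closure hΓc hW₁o hΓW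
  obtain ⟨A₀, hAW, hAo, hA⟩ : ∃ A ⊆ W, IsOpen A ∧ IsAnnulusAround A Γ₀ := by
    have h1 := exists_isAnnulusAround_upperArcs ha hb hWo
      (by rw [haG]; exact fun z hz => hΓW' (by rw [hΓ]; exact Or.inl hz))
      (by rw [hbG']; exact fun z hz => hΓW' (by rw [hΓ]; exact Or.inr hz))
    rwa [haG, hbG', ← hΓ] at h1
  have hAc : IsCompact (closure A₀) := hWc.of_isClosed_subset isClosed_closure (closure_mono hAW)
  have hAW₁ : closure A₀ ⊆ W₁ := (closure_mono hAW).trans hWW₁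
  have hAU : closure A₀ ⊆ U := hAW₁.trans inter_subset_left
  have hΓA : Γ₀ ⊆ A₀ := by
    obtain ⟨Ψ, -, hΨ, hΨ0⟩ := hA
    rw [← hΨ, ← hΨ0]
    exact image_subset_range _ _
  have hlie : ∀ x : ℝ, ((x, 0) : Plane) ∈ closure A₀ → δ ≤ |x| →
      lieH Z₀.1 (x, 0) ≠ 0 ∧ lieH Z₀.2 (x, 0) ≠ 0 := by
    intro x hx hxδ
    rcases (hAW₁ hx).2 with (h | h) | h
    · exact absurd rfl h
    · exact absurd h (not_lt.2 hxδ)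
    · exact ⟨h.1.2, h.2.2⟩
  -- the two sides
  obtain ⟨LX, OX, pX, qX, mX, hOX, hZX, hpX, hqXd, hmX, -, -, hsideX, -⟩ :=
    exists_isSideReturn hr hfold.1 hX1 hGX hqX hAo
      (fun z hz => hΓA (by rw [hΓ]; exact Or.inl hz)) hAc hAU hδ
      (fun x hx => hδX' x (hx.trans_lt hδ1)) fun x hx hxδ => (hlie x hx hxδ).1
  have hclosure : closure (reflect ⁻¹' A₀) = reflect ⁻¹' closure A₀ :=
    (reflect.toHomeomorph.preimage_closure A₀).symm
  obtain ⟨LY, OY, pY, qY, mY, hOY, hZY, hpY, hqYd, hmY, -, -, hsideY, hsurjY⟩ :=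
    exists_isSideReturn hr hfoldY hY1' hGY' hqY' (hAo.preimage reflect.continuous)
      (by
        rintro _ ⟨z, hz, rfl⟩
        rw [mem_preimage, reflect_reflect]
        exact hΓA (by rw [hΓ]; exact Or.inr hz))
      (by
        rw [hclosure]
        exact reflect.toHomeomorph.isCompact_preimage.2 hAc)
      (by
        rw [hclosure]
        exact fun z hz => hAU hz) hδ
      (fun x hx => hδY' x (hx.trans_lt hδ2)) fun x hx hxδ => by
        rw [hclosure, mem_preimage, hrefl] at hx
        rw [lieH_mirror]
        exact (hlie x hx hxδ).2
  -- everything factors through a Banach space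
  set L : PiecewiseField r U →L[ℝ] BJet r × BJet r :=
    (LX ∘L .fst ℝ _ _).prod ((LY ∘L mirror) ∘L .snd ℝ _ _) with hL
  have hL1 : ∀ Z, (L Z).1 = LX Z.1 := fun _ => rfl
  have hL2 : ∀ Z, (L Z).2 = LY (mirror Z.2) := fun _ => rfl
  set g : BJet r × BJet r → ℝ × ℝ := fun n => (pY n.2 - pX n.1, qX n.1 - qY n.2) with hg
  -- This is where the elementarity of the given cycle enters. Since `mX` and `mY` are continuous at
  -- the base fields, the inequality persists nearby.
  have hm₀ : mX (LX Z₀.1) ≠ mY (LY (mirror Z₀.2)) :=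
    (hΓ₀.eq_and_ne hr (hsideX _ hZX) ((hsideY _ hZY).below hr) hΓA).2.2
  have hmev : ∀ᶠ n in 𝓝 (L Z₀), mX n.1 ≠ mY n.2 := by
    have h1 : ContinuousAt (fun n : BJet r × BJet r => mX n.1) (L Z₀) :=
      ContinuousAt.comp (g := mX) hmX continuousAt_fst
    have h2 : ContinuousAt (fun n : BJet r × BJet r => mY n.2) (L Z₀) :=
      ContinuousAt.comp (g := mY) hmY continuousAt_snd
    exact h1.ne_iff_eventually_ne h2 |>.1 hm₀
  obtain ⟨M, hM, hMo, hZM⟩ := eventually_nhds_iff.1 hmev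
  set O : Set (BJet r × BJet r) := (OX ×ˢ OY) ∩ M with hO
  have hOo : IsOpen O := (hOX.prod hOY).inter hMo
  have hgO : ContDiffOn ℝ r g O := by
    have e1 : MapsTo Prod.fst O OX := fun n hn => hn.1.1
    have e2 : MapsTo Prod.snd O OY := fun n hn => hn.1.2
    exact ((hpY.comp contDiffOn_snd e2).sub (hpX.comp contDiffOn_fst e1)).prodMk
      ((hqXd.comp contDiffOn_fst e1).sub (hqYd.comp contDiffOn_snd e2))
  have hr0 : (r : WithTop ℕ∞) ≠ 0 := by exact_mod_cast (by omega : r ≠ 0)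
  have hgd : ∀ n ∈ O, HasFDerivAt g (fderiv ℝ g n) n := fun n hn =>
    ((hgO.contDiffAt (hOo.mem_nhds hn)).differentiableAt hr0).hasFDerivAt
  -- Perturbations `(0, V)` of the lower field alone already reach every `w`. They lie in the
  -- normalized subspace, so the same statement serves for both spaces.
  have hsurj : ∀ Z, L Z ∈ O → ∀ w : ℝ × ℝ, ∃ V : CrField r U,
      fderiv ℝ g (L Z) (L ((0, V) : PiecewiseField r U)) = w := by
    intro Z hZ w
    -- The sign is that of `qY` in the second component of `η`.
    obtain ⟨V', hV1, hV2⟩ := hsurjY (L Z).2 hZ.1.2 (w.1, -w.2)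
    obtain ⟨V, rfl⟩ := mirror_surjective V'
    refine ⟨V, ?_⟩
    have hd : ∀ {f : BJet r → ℝ} {S : Set (BJet r)} {n : BJet r}, IsOpen S → ContDiffOn ℝ r f S →
        n ∈ S → HasFDerivAt f (fderiv ℝ f n) n := fun hS hf hn =>
      ((hf.contDiffAt (hS.mem_nhds hn)).differentiableAt hr0).hasFDerivAt
    have e1 : HasFDerivAt (fun n : BJet r × BJet r => pX n.1) _ (L Z) :=
      HasFDerivAt.comp (g := pX) (L Z) (hd hOX hpX hZ.1.1) hasFDerivAt_fst
    have e2 : HasFDerivAt (fun n : BJet r × BJet r => qX n.1) _ (L Z) :=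
      HasFDerivAt.comp (g := qX) (L Z) (hd hOX hqXd hZ.1.1) hasFDerivAt_fst
    have e3 : HasFDerivAt (fun n : BJet r × BJet r => pY n.2) _ (L Z) :=
      HasFDerivAt.comp (g := pY) (L Z) (hd hOY hpY hZ.1.2) hasFDerivAt_snd
    have e4 : HasFDerivAt (fun n : BJet r × BJet r => qY n.2) _ (L Z) :=
      HasFDerivAt.comp (g := qY) (L Z) (hd hOY hqYd hZ.1.2) hasFDerivAt_snd
    have e5 := (e3.sub e1).prodMk (e2.sub e4)
    rw [HasFDerivAt.fderiv (f := g) e5]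
    have e6 : L ((0, V) : PiecewiseField r U) = (0, LY (mirror V)) :=
      Prod.ext (map_zero LX) rfl
    rw [e6]
    refine Prod.ext ?_ ?_
    · change fderiv ℝ pY (L Z).2 (LY (mirror V)) - fderiv ℝ pX (L Z).1 0 = w.1
      rw [hV1, map_zero, sub_zero]
    · change fderiv ℝ qX (L Z).1 0 - fderiv ℝ qY (L Z).2 (LY (mirror V)) = w.2
      rw [hV2, map_zero, zero_sub, neg_neg]
  have hnorm : ∀ V : CrField r U, ((0, V) : PiecewiseField r U) ∈ normalizedFields r U :=
    fun V => rfl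
  refine ⟨A₀, L ⁻¹' O, fun Z => pX (LX Z.1), fun Z => qX (LX Z.1), fun Z => pY (LY (mirror Z.2)),
    fun Z => qY (LY (mirror Z.2)), fun Z => g (L Z), hA, subset_closure.trans hAU,
    hOo.preimage L.continuous, ⟨⟨hZX, hZY⟩, hZM⟩, fun Z hZ => ?_, fun _ => rfl,
    isCrOn_comp r L hOo hgO, fun Z hZ => ?_, fun Z hZ => ?_, ?_, ?_⟩
  · exact (hsideX _ hZ.1.1).isFoldReturnData ((hsideY _ hZ.1.2).below hr)
  · exact (hsideX _ hZ.1.1).exists_cycle_iff hr ((hsideY _ hZ.1.2).below hr) (hM _ hZ.2)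
  · refine ⟨fderiv ℝ g (L Z) ∘L L, HasFDerivAt.comp_clm_tvs L (hgd _ hZ), fun w => ?_,
      fun _ w => ?_⟩
    · obtain ⟨V, hV⟩ := hsurj Z hZ w
      exact ⟨(0, V), hV⟩
    · obtain ⟨V, hV⟩ := hsurj Z hZ w
      exact ⟨(0, V), hnorm V, hV⟩
  · refine isSubmanifoldOfCodim_preimage hr L hOo hgO fun Z hZ w => ?_
    obtain ⟨V, hV⟩ := hsurj Z hZ w
    exact ⟨(0, V), hV⟩
  · refine isSubmanifoldOfCodim_preimage hr (L ∘L (normalizedFields r U).subtypeL) hOo hgO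
      fun Z hZ w => ?_
    obtain ⟨V, hV⟩ := hsurj Z hZ w
    exact ⟨⟨(0, V), hnorm V⟩, hV⟩
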